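/- **Setting.** Let $A\subseteq\tilde A$ be abelian groups and let $V$ be a strongly $A$-graded Möbius or conformal vertex algebra over $\mathbb C$: a ($\mathbb Z$-graded by $L(0)$-eigenvalues) Möbius or conformal vertex algebra with a second grading $V=\coprod_{\alpha\in A}V^{(\alpha)}$ compatible with the weight grading, the vertex operators and the operators $L(j)$, $j=-1,0,1$, such that each $V_{(n)}^{(\alpha)}$ is finite-dimensional and vanishes for $n$ sufficiently negative. A *weak $V$-module* is a space with a vertex operator map $Y$ and operators $L(j)$, $j=-1,0,1$, satisfying all axioms of a module except those on gradings. A *generalized $V$-module* means a strongly $\tilde A$-graded one: a weak module $W=\coprod_{n\in\mathbb C}W_{[n]}=\coprod_{\beta\in\tilde A}W^{(\beta)}$, with $W_{[n]}$ the generalized $L(0)$-eigenspaces, with the two gradings compatible, $V^{(\alpha)}$ mapping $W^{(\beta)}$ to $W^{(\alpha+\beta)}$, the $L(j)$ preserving each $W^{(\beta)}$, $\dim W_{[n]}^{(\beta)}<\infty$, and $W_{[n+k]}^{(\beta)}=0$ for $k\in\mathbb Z$ sufficiently negative; it is a *$V$-module* if $W$ is the sum of ordinary $L(0)$-eigenspaces.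 Let $\mathcal{GM}_{sg}$ and $\mathcal M_{sg}$ be the categories of these. The contragredient $W'$ is the graded dual $\coprod_{n,\beta}(W_{[n]}^{(\beta)})^*$, with $\langle Y'(v,x)w',w\rangle=\langle w',Y^o(v,x)w\rangle$, $Y^o(v,x)=Y(e^{xL(1)}(-x^{-2})^{L(0)}v,x^{-1})=\sum_n v^o_nx^{-n-1}$, with $\langle L'(j)w',w\rangle=\langle w',L(-j)w\rangle$, and with $(W')^{(\beta)}$ dual to $W^{(-\beta)}$. Fix $z\in\mathbb C^\times$ and generalized modules $W_1,W_2$. **The $Q(z)$-action.** For $v\in V$ and $m,n\in\mathbb Z$, the operator $\tau_{Q(z)}(v\otimes\iota_+((z+t)^mt^n))$ on $(W_1\otimes W_2)^*$ is defined by $$\big(\tau_{Q(z)}(v\otimes\iota_+((z+t)^mt^n))\lambda\big)(w_1\otimes w_2)=\sum_{k\ge0}\binom nk(-z)^k\,\lambda\big(v^o_{m+n-k}w_1\otimes w_2\big)-\sum_{k\ge0}\binom nk(-z)^{n-k}\,\lambda\big(w_1\otimes v_{m+k}w_2\big),$$ where both sums are finite for given $v$, $w_1$, $w_2$. Here $\iota_+$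 denotes expansion in nonnegative powers of $t$, and the $(z+t)^mt^n$ span $\mathbb C[t,t^{-1},(z+t)^{-1}]$. Put $Y'_{Q(z)}(v,x)=\sum_n\tau_{Q(z)}(v\otimes t^n)x^{-n-1}$ and $$(L'_{Q(z)}(j)\lambda)(w_1\otimes w_2)=\sum_{i=0}^{j+1}\binom{j+1}i(-z)^i\Big(\lambda(L(i-j)w_1\otimes w_2)-\lambda(w_1\otimes L(j-i)w_2)\Big),\qquad j=-1,0,1.$$ Let $((W_1\otimes W_2)^*)^{(\beta)}$ be the space of the $\lambda$ vanishing on $W_1^{(\gamma_1)}\otimes W_2^{(\gamma_2)}$ whenever $\gamma_1+\gamma_2\neq-\beta$. Let $((W_1\otimes W_2)^*)^{(\beta)}_{[n]}$ and $((W_1\otimes W_2)^*)^{(\beta)}_{(n)}$ be the intersections of this space with the generalized and with the ordinary $L'_{Q(z)}(0)$-eigenspace for $n\in\mathbb C$. A generalized module $U$ is *included in* $(W_1\otimes W_2)^*$ if it is a subspace, stable under the components of $Y'_{Q(z)}$ and under $L'_{Q(z)}(j)$, $j=-1,0,1$, if its structure is the restriction of these operators and of the subspaces $((W_1\otimes W_2)^*)^{(\beta)}$,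 and if the inclusion map intertwines the actions of $V\otimes\iota_+\mathbb C[t,t^{-1},(z+t)^{-1}]$, where $v\otimes\iota_+((z+t)^mt^n)$ acts on $U$ by $\sum_{k\ge0}\binom mkz^{m-k}v_{n+k}$. * $\mathrm{COMP}_{Q(z)}$ is the set of the $\lambda\in(W_1\otimes W_2)^*$ satisfying the $Q(z)$-compatibility condition: for each $v\in V$, $\tau_{Q(z)}(v\otimes t^n)\lambda=0$ for $n$ sufficiently large, and for all $m,n\in\mathbb Z$, $$\tau_{Q(z)}(v\otimes\iota_+((z+t)^mt^n))\lambda=\sum_{k\ge0}\binom mkz^{m-k}\,\tau_{Q(z)}(v\otimes t^{n+k})\lambda .$$ (This is the coefficient form of $\tau_{Q(z)}\big(z^{-1}\delta(\tfrac{x_1-x_0}z)Y_t(v,x_0)\big)\lambda=z^{-1}\delta(\tfrac{x_1-x_0}z)Y'_{Q(z)}(v,x_0)\lambda$.) * $W_{\lambda;Q(z)}$ is the smallest subspace of $(W_1\otimes W_2)^*$ that contains $\lambda$, is doubly graded (by $\mathbb C$ via generalized $L'_{Q(z)}(0)$-eigenspaces, and by $\tilde A$), and is stable under the components of $Y'_{Q(z)}$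 and under $L'_{Q(z)}(j)$, $j=-1,0,1$. * $\mathrm{LGR}_{[\mathbb C];Q(z)}$ is the set of the $\lambda\in\sum_{n,\beta}((W_1\otimes W_2)^*)^{(\beta)}_{[n]}$ such that, for all $n\in\mathbb C$, $\beta\in\tilde A$, the space $W_{\lambda;Q(z)}\cap((W_1\otimes W_2)^*)^{(\beta)}_{[n]}$ is finite-dimensional and $W_{\lambda;Q(z)}\cap((W_1\otimes W_2)^*)^{(\beta)}_{[n+k]}=0$ for $k\in\mathbb Z$ sufficiently negative. $\mathrm{LGR}_{(\mathbb C);Q(z)}$ is defined in the same way with $(\cdot)_{(n)}$ in place of $(\cdot)_{[n]}$. For a full subcategory $\mathcal C$ of $\mathcal{GM}_{sg}$ closed under contragredients with $W_1,W_2\in\mathcal C$, let $W_1\,\diamond_{Q(z)}W_2\subseteq(W_1\otimes W_2)^*$ (the "$\boxtimes$-backslash" product, written $\diamond_{Q(z)}$ here) be the union of the images $I'(W')$ over all $W\in\mathcal C$ and all linear maps $I':W'\to(W_1\otimes W_2)^*$ which are $\tilde A$-compatible ($I'((W')^{(\beta)})\subseteq((W_1\otimes W_2)^*)^{(\beta)}$)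 and intertwine the actions of $V\otimes\iota_+\mathbb C[t,t^{-1},(z+t)^{-1}]$ and of $L(j)$, $j=-1,0,1$ (these maps correspond to the $Q(z)$-intertwining maps of type $\binom{W}{W_1\,W_2}$). **Theorem.** 1. Each of $\mathrm{COMP}_{Q(z)}$, $\mathrm{COMP}_{Q(z)}\cap\mathrm{LGR}_{[\mathbb C];Q(z)}$ and $\mathrm{COMP}_{Q(z)}\cap\mathrm{LGR}_{(\mathbb C);Q(z)}$ is a subspace of $(W_1\otimes W_2)^*$ stable under the components of $Y'_{Q(z)}$ and under $L'_{Q(z)}(j)$, $j=-1,0,1$, and is a weak $V$-module under these operators. 2. If $\lambda\in\mathrm{COMP}_{Q(z)}\cap\mathrm{LGR}_{[\mathbb C];Q(z)}$, then $W_{\lambda;Q(z)}$, with these operators, is a (strongly graded) generalized $V$-module. If $\lambda\in\mathrm{COMP}_{Q(z)}\cap\mathrm{LGR}_{(\mathbb C);Q(z)}$, then $W_{\lambda;Q(z)}$ is a (strongly graded) $V$-module. 3. Suppose that for every $\lambda\in\mathrm{COMP}_{Q(z)}\cap\mathrm{LGR}_{[\mathbb C];Q(z)}$ the generalized module $W_{\lambda;Q(z)}$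 is a generalized submodule of some object of $\mathcal C$ (up to isomorphism) included in $(W_1\otimes W_2)^*$. (This holds in particular if $\mathcal C=\mathcal{GM}_{sg}$.) Then $$W_1\,\diamond_{Q(z)}W_2=\mathrm{COMP}_{Q(z)}\cap\mathrm{LGR}_{[\mathbb C];Q(z)}.$$ 4. Suppose that $\mathcal C\subseteq\mathcal M_{sg}$ and that for every $\lambda\in\mathrm{COMP}_{Q(z)}\cap\mathrm{LGR}_{(\mathbb C);Q(z)}$ the module $W_{\lambda;Q(z)}$ is a submodule of some object of $\mathcal C$ (up to isomorphism) included in $(W_1\otimes W_2)^*$. (This holds in particular if $\mathcal C=\mathcal M_{sg}$.) Then $$W_1\,\diamond_{Q(z)}W_2=\mathrm{COMP}_{Q(z)}\cap\mathrm{LGR}_{(\mathbb C);Q(z)}.$$ -/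

import Mathlib

universe u v w

open scoped TensorProduct
open Module (Dual End)

namespace HLZ

noncomputable section

section Actions

variable {V W X : Type*} [AddCommGroup V] [Module ℂ V] [AddCommGroup W] [Module ℂ W]
  [AddCommGroup X] [Module ℂ X]

/-- A vertex operator map `Y(v,x) = ∑ₙ vₙ x^{-n-1}` on a space `W` (with `mode n v w = vₙ w`),
together with three operators `L(-1)`, `L(0)`, `L(1)`. No axioms are imposed. -/
structure VertexAction (V W : Type*) [AddCommGroup V] [Module ℂ V]
    [AddCommGroup W] [Module ℂ W] where
  mode : ℤ → V →ₗ[ℂ] W →ₗ[ℂ] W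
  Lneg : End ℂ W
  Lzero : End ℂ W
  Lone : End ℂ W

/-- The subspace `S` is stable under all the operators. -/
structure VertexAction.Stable (D : VertexAction V W) (S : Submodule ℂ W) : Prop where
  mode_mem : ∀ n v, ∀ w ∈ S, D.mode n v w ∈ S
  neg_mem : ∀ w ∈ S, D.Lneg w ∈ S
  zero_mem : ∀ w ∈ S, D.Lzero w ∈ S
  one_mem : ∀ w ∈ S, D.Lone w ∈ S

/-- The restriction of the operators to a stable subspace. -/
def VertexAction.restrict (D : VertexAction V W) (S : Submodule ℂ W) (h : D.Stable S) :
    VertexAction V S where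
  mode n := LinearMap.mk₂ ℂ (fun v w => ⟨D.mode n v w, h.mode_mem n v w w.2⟩)
    (fun _ _ _ => by ext; simp) (fun _ _ _ => by ext; simp)
    (fun _ _ _ => by ext; simp) (fun _ _ _ => by ext; simp)
  Lneg := D.Lneg.restrict h.neg_mem
  Lzero := D.Lzero.restrict h.zero_mem
  Lone := D.Lone.restrict h.one_mem

/-- The axioms of a weak module, over a vertex algebra with adjoint action `adj`, vacuum `one` and
conformal vector `omega` (`none` when only an `𝔰𝔩(2)`-action is given).

The Jacobi identity is written as the equality of the coefficients of
`x₀^{-l-1} x₁^{-m-1} x₂^{-n-1}` in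
`x₀⁻¹ δ((x₁-x₂)/x₀) Y(u,x₁)Y(v,x₂) - x₀⁻¹ δ((x₂-x₁)/(-x₀)) Y(v,x₂)Y(u,x₁)
  = x₂⁻¹ δ((x₁-x₀)/x₂) Y(Y(u,x₀)v,x₂)`. -/
structure IsWeakModule (adj : VertexAction V V) (one : V) (omega : Option V)
    (D : VertexAction V W) : Prop where
  truncation : ∀ v w, ∃ N : ℤ, ∀ n ≥ N, D.mode n v w = 0
  vacuum : ∀ n w, D.mode n one w = if n = -1 then w else 0
  jacobi : ∀ (u v : V) (w : W) (l m n : ℤ),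
    (∑ᶠ k : ℕ, ((-1 : ℂ) ^ k * (Ring.choose l k : ℂ)) •
        D.mode (m + l - k) u (D.mode (n + k) v w))
      - (-1 : ℂ) ^ l • (∑ᶠ k : ℕ, ((-1 : ℂ) ^ k * (Ring.choose l k : ℂ)) •
        D.mode (n + l - k) v (D.mode (m + k) u w))
      = ∑ᶠ k : ℕ, (Ring.choose m k : ℂ) • D.mode (m + n - k) (adj.mode (l + k) u v) w
  -- `d/dx Y(v,x) = Y(L(-1)v,x)`
  derivative : ∀ n v w, D.mode n (adj.Lneg v) w = (-(n : ℂ)) • D.mode (n - 1) v w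
  -- the brackets of `𝔰𝔩(2)`
  bracket_zero_neg : ∀ w, D.Lzero (D.Lneg w) - D.Lneg (D.Lzero w) = D.Lneg w
  bracket_zero_one : ∀ w, D.Lzero (D.Lone w) - D.Lone (D.Lzero w) = -D.Lone w
  bracket_neg_one : ∀ w, D.Lneg (D.Lone w) - D.Lone (D.Lneg w) = (-2 : ℂ) • D.Lzero w
  -- `[L(-1), Y(v,x)] = Y(L(-1)v,x)`
  comm_neg : ∀ n v w, D.Lneg (D.mode n v w) - D.mode n v (D.Lneg w) = D.mode n (adj.Lneg v) w
  -- `[L(0), Y(v,x)] = Y(L(0)v,x) + x Y(L(-1)v,x)`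
  comm_zero : ∀ n v w, D.Lzero (D.mode n v w) - D.mode n v (D.Lzero w) =
    D.mode n (adj.Lzero v) w + D.mode (n + 1) (adj.Lneg v) w
  -- `[L(1), Y(v,x)] = Y(L(1)v,x) + 2x Y(L(0)v,x) + x² Y(L(-1)v,x)`
  comm_one : ∀ n v w, D.Lone (D.mode n v w) - D.mode n v (D.Lone w) =
    D.mode n (adj.Lone v) w + (2 : ℂ) • D.mode (n + 1) (adj.Lzero v) w +
      D.mode (n + 2) (adj.Lneg v) w
  -- in the conformal case `Y(ω,x) = ∑ L(n) x^{-n-2}`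
  conformal : ∀ ω ∈ omega, ∀ w,
    D.Lneg w = D.mode 0 ω w ∧ D.Lzero w = D.mode 1 ω w ∧ D.Lone w = D.mode 2 ω w

/-- The pointwise finite sum of a family of bilinear maps. -/
def sumBilin {ι : Type*} (B : ι → V →ₗ[ℂ] W →ₗ[ℂ] X)
    (h : ∀ v w, (Function.support fun i => B i v w).Finite) : V →ₗ[ℂ] W →ₗ[ℂ] X :=
  LinearMap.mk₂ ℂ (fun v w => ∑ᶠ i, B i v w)
    (fun v v' w => by
      simp only [map_add, LinearMap.add_apply]
      exact finsum_add_distrib (h v w) (h v' w))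
    (fun c v w => by
      simp only [map_smul, LinearMap.smul_apply]
      exact (smul_finsum' c (h v w)).symm)
    (fun v w w' => by
      simp only [map_add]
      exact finsum_add_distrib (h v w) (h v w'))
    (fun c v w => by
      simp only [map_smul]
      exact (smul_finsum' c (h v w)).symm)

end Actions

variable {Γ : Type v} [AddCommGroup Γ]

/-- A strongly `A`-graded Möbius or conformal vertex algebra: `omega = none` means that only the
Möbius structure is given, `omega = some ω` that `ω` is the conformal vector. The weight space
`V_(n)` is the eigenspace of `L(0)` with eigenvalue `n`. -/
structure VertexAlg (A : AddSubgroup Γ) (V : Type*) [AddCommGroup V] [Module ℂ V] where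
  adj : VertexAction V V
  one : V
  omega : Option V
  isWeak : IsWeakModule adj one omega adj
  creation : ∀ v, adj.mode (-1) v one = v ∧ ∀ n : ℤ, 0 ≤ n → adj.mode n v one = 0
  weight_iSup : ⨆ n : ℤ, adj.Lzero.eigenspace (n : ℂ) = ⊤
  -- the second grading, by `A`
  gr : A → Submodule ℂ V
  gr_indep : iSupIndep gr
  gr_iSup : ⨆ α, gr α = ⊤
  gr_compat : ∀ α, gr α = ⨆ n : ℤ, gr α ⊓ adj.Lzero.eigenspace (n : ℂ)
  gr_lower : ∀ α, ∃ N : ℤ, ∀ n ≤ N, gr α ⊓ adj.Lzero.eigenspace (n : ℂ) = ⊥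
  gr_finite : ∀ α (n : ℤ), FiniteDimensional ℂ ↥(gr α ⊓ adj.Lzero.eigenspace (n : ℂ))
  one_mem : one ∈ gr 0 ⊓ adj.Lzero.eigenspace 0
  gr_mode : ∀ α β n, ∀ u ∈ gr α, ∀ v ∈ gr β, adj.mode n u v ∈ gr (α + β)
  gr_neg : ∀ α, ∀ v ∈ gr α, adj.Lneg v ∈ gr α
  gr_zero : ∀ α, ∀ v ∈ gr α, adj.Lzero v ∈ gr α
  gr_one : ∀ α, ∀ v ∈ gr α, adj.Lone v ∈ gr α
  omega_mem : ∀ ω ∈ omega, ω ∈ gr 0 ⊓ adj.Lzero.eigenspace 2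
  -- the Virasoro relations for `L(m) = ω_{m+1}`, with some central charge `c`
  virasoro : ∀ ω ∈ omega, ∃ c : ℂ, ∀ (m n : ℤ) (v : V),
    adj.mode (m + 1) ω (adj.mode (n + 1) ω v) - adj.mode (n + 1) ω (adj.mode (m + 1) ω v) =
      ((m : ℂ) - n) • adj.mode (m + n + 1) ω v +
        (if m + n = 0 then ((m : ℂ) ^ 3 - m) / 12 * c else 0) • v

/-- A vertex action together with a family of subspaces indexed by `Γ` (the group `Ã`). -/
structure GradedAction (Γ V W : Type*) [AddCommGroup V] [Module ℂ V]
    [AddCommGroup W] [Module ℂ W] extends VertexAction V W where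
  gr : Γ → Submodule ℂ W

section

variable {V W : Type*} [AddCommGroup V] [Module ℂ V] [AddCommGroup W] [Module ℂ W]

/-- The doubly homogeneous subspace `W_[n]^(β)`, for generalized `L(0)`-eigenspaces. -/
def GradedAction.genWt (D : GradedAction Γ V W) (n : ℂ) (β : Γ) : Submodule ℂ W :=
  D.gr β ⊓ D.Lzero.maxGenEigenspace n

/-- The doubly homogeneous subspace `W_(n)^(β)`, for ordinary `L(0)`-eigenspaces. -/
def GradedAction.ordWt (D : GradedAction Γ V W) (n : ℂ) (β : Γ) : Submodule ℂ W :=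
  D.gr β ⊓ D.Lzero.eigenspace n

/-- The restriction to a stable subspace `S`, with `S^(β) = S ∩ W^(β)`. -/
def GradedAction.restrict (D : GradedAction Γ V W) (S : Submodule ℂ W)
    (h : D.toVertexAction.Stable S) : GradedAction Γ V S where
  toVertexAction := D.toVertexAction.restrict S h
  gr β := (D.gr β).comap S.subtype

/-- `D` is a (strongly `Γ`-graded) generalized `V`-module. -/
structure IsGenModule {A : AddSubgroup Γ} (𝒱 : VertexAlg A V) (D : GradedAction Γ V W) :
    Prop where
  isWeak : IsWeakModule 𝒱.adj 𝒱.one 𝒱.omega D.toVertexAction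
  weight_iSup : ⨆ n : ℂ, D.Lzero.maxGenEigenspace n = ⊤
  gr_indep : iSupIndep D.gr
  gr_iSup : ⨆ β, D.gr β = ⊤
  gr_compat : ∀ β, D.gr β = ⨆ n : ℂ, D.genWt n β
  gr_lower : ∀ (n : ℂ) β, ∃ N : ℤ, ∀ k ≤ N, D.genWt (n + k) β = ⊥
  gr_finite : ∀ (n : ℂ) β, FiniteDimensional ℂ ↥(D.genWt n β)
  gr_mode : ∀ (α : A) β n, ∀ v ∈ 𝒱.gr α, ∀ w ∈ D.gr β, D.mode n v w ∈ D.gr ((α : Γ) + β)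
  gr_neg : ∀ β, ∀ w ∈ D.gr β, D.Lneg w ∈ D.gr β
  gr_zero : ∀ β, ∀ w ∈ D.gr β, D.Lzero w ∈ D.gr β
  gr_one : ∀ β, ∀ w ∈ D.gr β, D.Lone w ∈ D.gr β

/-- `W` is a direct sum of ordinary `L(0)`-eigenspaces; a generalized module with this property is
an (ordinary) module. -/
def GradedAction.IsOrdinary (D : GradedAction Γ V W) : Prop :=
  ⨆ n : ℂ, D.Lzero.eigenspace n = ⊤

end

/-! ### Opposite vertex operators -/

namespace VertexAlg

variable {A : AddSubgroup Γ} {V : Type*} [AddCommGroup V] [Module ℂ V] (𝒱 : VertexAlg A V)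

/-- The weight space `V_(n)`. -/
def wt (n : ℤ) : Submodule ℂ V := 𝒱.adj.Lzero.eigenspace (n : ℂ)

lemma wt_isInternal : DirectSum.IsInternal 𝒱.wt :=
  DirectSum.isInternal_submodule_of_iSupIndep_of_iSup_eq_top
    ((Module.End.eigenspaces_iSupIndep 𝒱.adj.Lzero).comp Int.cast_injective) 𝒱.weight_iSup

/-- The projection of `V` onto the weight space `V_(h)`. -/
def proj (h : ℤ) : V →ₗ[ℂ] V :=
  (𝒱.wt h).subtype ∘ₗ DirectSum.component ℂ ℤ (fun n => 𝒱.wt n) h ∘ₗ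
    (LinearEquiv.ofBijective (DirectSum.coeLinearMap 𝒱.wt) 𝒱.wt_isInternal).symm.toLinearMap

lemma proj_support (v : V) : (Function.support fun h => 𝒱.proj h v).Finite := by
  classical
  refine Set.Finite.subset (DFinsupp.support
    ((LinearEquiv.ofBijective (DirectSum.coeLinearMap 𝒱.wt) 𝒱.wt_isInternal).symm v)).finite_toSet
    ?_
  intro h hh
  simp only [Function.mem_support, proj, LinearMap.comp_apply] at hh
  simp only [Finset.mem_coe, DFinsupp.mem_support_toFun]
  intro h0
  exact hh ((congrArg (𝒱.wt h).subtype h0).trans (map_zero _))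

/-- `L(1)` is locally nilpotent on `V`. -/
lemma Lone_nilp (v : V) : ∃ N : ℕ, ∀ m ≥ N, (𝒱.adj.Lone ^ m) v = 0 := by
  let S : Submodule ℂ V :=
    { carrier := {v | ∃ N : ℕ, ∀ m ≥ N, (𝒱.adj.Lone ^ m) v = 0}
      zero_mem' := ⟨0, fun m _ => map_zero _⟩
      add_mem' := by
        rintro a b ⟨N, hN⟩ ⟨M, hM⟩
        refine ⟨max N M, fun m hm => ?_⟩
        rw [map_add, hN m (le_trans (le_max_left _ _) hm),
          hM m (le_trans (le_max_right _ _) hm), add_zero]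
      smul_mem' := by
        rintro c a ⟨N, hN⟩
        exact ⟨N, fun m hm => by rw [map_smul, hN m hm, smul_zero]⟩ }
  have key : ∀ α, 𝒱.gr α ≤ S := by
    intro α
    rw [𝒱.gr_compat α]
    refine iSup_le fun n => ?_
    intro v hv
    obtain ⟨N, hN⟩ := 𝒱.gr_lower α
    have step : ∀ m : ℕ, (𝒱.adj.Lone ^ m) v ∈
        𝒱.gr α ⊓ 𝒱.adj.Lzero.eigenspace ((n - m : ℤ) : ℂ) := by
      intro m
      induction m with
      | zero => simpa using hv
      | succ m ih =>
        rw [pow_succ']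
        refine ⟨𝒱.gr_one α _ ih.1, ?_⟩
        have h2 := Module.End.mem_eigenspace_iff.1 ih.2
        have h3 := 𝒱.isWeak.bracket_zero_one ((𝒱.adj.Lone ^ m) v)
        rw [h2, map_smul, sub_eq_iff_eq_add] at h3
        refine Module.End.mem_eigenspace_iff.2 ?_
        rw [Module.End.mul_apply, h3]
        push_cast
        module
    refine ⟨(n - N).toNat, fun m hm => ?_⟩
    have h4 := step m
    rw [hN (n - m) (by omega)] at h4
    simpa using h4
  have htop : (⊤ : Submodule ℂ V) ≤ S := by
    rw [← 𝒱.gr_iSup]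
    exact iSup_le key
  exact htop (Submodule.mem_top (x := v))

lemma opp_support (v : V) :
    {p : ℤ × ℕ | (𝒱.adj.Lone ^ p.2) (𝒱.proj p.1 v) ≠ 0}.Finite := by
  choose N hN using 𝒱.Lone_nilp
  refine Set.Finite.subset
    ((𝒱.proj_support v).biUnion (t := fun h => (fun m : ℕ => (h, m)) '' Set.Iio (N (𝒱.proj h v)))
      fun h _ => (Set.finite_Iio _).image _) ?_
  rintro ⟨h, m⟩ hp
  simp only [Set.mem_ofPred_eq] at hp
  simp only [Set.mem_iUnion, Function.mem_support]
  refine ⟨h, fun h0 => hp (by rw [h0, map_zero]), m, ?_, rfl⟩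
  by_contra hm
  exact hp (hN _ _ (not_lt.1 hm))

variable {W : Type*} [AddCommGroup W] [Module ℂ W]

/-- The components `vᵒₙ` of the opposite vertex operator
`Yᵒ(v,x) = Y(e^{xL(1)} (-x⁻²)^{L(0)} v, x⁻¹) = ∑ₙ vᵒₙ x^{-n-1}`: for `v` of weight `h`,
`vᵒₙ = (-1)^h ∑ₘ (1/m!) (L(1)^m v)_{-n-m-2+2h}`. -/
def oppMode (D : VertexAction V W) (n : ℤ) : V →ₗ[ℂ] W →ₗ[ℂ] W :=
  sumBilin
    (fun p : ℤ × ℕ => ((-1 : ℂ) ^ p.1 * ((p.2.factorial : ℂ))⁻¹) •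
      (D.mode (-n - p.2 - 2 + 2 * p.1) ∘ₗ (𝒱.adj.Lone ^ p.2) ∘ₗ 𝒱.proj p.1))
    (fun v w => (𝒱.opp_support v).subset fun p hp h0 => hp (by
      simp only [LinearMap.smul_apply, LinearMap.comp_apply]
      rw [h0]; simp))

lemma oppMode_truncation {D : VertexAction V W}
    (hD : ∀ v w, ∃ N : ℤ, ∀ n ≥ N, D.mode n v w = 0) (v : V) (w : W) :
    ∃ N : ℤ, ∀ n ≤ N, 𝒱.oppMode D n v w = 0 := by
  choose M hM using fun p : ℤ × ℕ => hD ((𝒱.adj.Lone ^ p.2) (𝒱.proj p.1 v)) w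
  obtain ⟨B, hB⟩ := ((𝒱.opp_support v).image
    (fun p : ℤ × ℕ => -(M p) - p.2 - 2 + 2 * p.1)).bddBelow
  refine ⟨B, fun n hn => ?_⟩
  change ∑ᶠ p : ℤ × ℕ, _ = _
  rw [finsum_eq_zero_of_forall_eq_zero]
  intro p
  simp only [LinearMap.smul_apply, LinearMap.comp_apply]
  by_cases hp : (𝒱.adj.Lone ^ p.2) (𝒱.proj p.1 v) = 0
  · rw [hp]; simp
  · have h1 : B ≤ -(M p) - p.2 - 2 + 2 * p.1 := hB ⟨p, hp, rfl⟩
    rw [hM p _ (by omega), smul_zero]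

/-- The action `τ_W(v ⊗ ι₊ ((a+t)^m t^n)) = ∑_k C(m,k) a^{m-k} v_{n+k}`, where
`τ_W(v ⊗ t^n) = vₙ` and `ι₊` expands in nonnegative powers of `t`. -/
def tauPlus (D : VertexAction V W) (hD : ∀ v w, ∃ N : ℤ, ∀ n ≥ N, D.mode n v w = 0)
    (a : ℂ) (m n : ℤ) : V →ₗ[ℂ] W →ₗ[ℂ] W :=
  sumBilin (fun k : ℕ => ((Ring.choose m k : ℂ) * a ^ (m - (k : ℤ))) • D.mode (n + k))
    (fun v w => by
      obtain ⟨N, hN⟩ := hD v w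
      refine (Set.finite_lt_nat (N - n).toNat).subset fun k hk => ?_
      by_contra hlt
      simp only [Set.mem_ofPred_eq, not_lt] at hlt
      exact hk (by simp [hN (n + k) (by omega)]))

/-- The action `τ_W(o(v ⊗ ι₋ ((t+a)^m t^n))) = ∑_k C(m,k) a^k vᵒ_{m+n-k}`, where `o` is the
opposite-operator map, `τ_W(o(v ⊗ t^n)) = vᵒₙ`, and `ι₋` expands in nonpositive powers of `t`. -/
def tauOpp (D : VertexAction V W) (hD : ∀ v w, ∃ N : ℤ, ∀ n ≥ N, D.mode n v w = 0)
    (a : ℂ) (m n : ℤ) : V →ₗ[ℂ] W →ₗ[ℂ] W :=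
  sumBilin (fun k : ℕ => ((Ring.choose m k : ℂ) * a ^ k) • 𝒱.oppMode D (m + n - k))
    (fun v w => by
      obtain ⟨N, hN⟩ := 𝒱.oppMode_truncation hD v w
      refine (Set.finite_lt_nat (m + n - N).toNat).subset fun k hk => ?_
      by_contra hlt
      simp only [Set.mem_ofPred_eq, not_lt] at hlt
      exact hk (by simp [hN (m + n - k) (by omega)]))

end VertexAlg

/-! ### The category of generalized modules -/

variable {A : AddSubgroup Γ} {V : Type w} [AddCommGroup V] [Module ℂ V]

/-- A (strongly graded) generalized `V`-module: an object of `𝒢ℳ_sg`. -/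
structure GenMod (𝒱 : VertexAlg A V) where
  carrier : Type u
  [instGroup : AddCommGroup carrier]
  [instModule : Module ℂ carrier]
  act : GradedAction Γ V carrier
  isGenModule : IsGenModule 𝒱 act

attribute [instance] GenMod.instGroup GenMod.instModule

variable {𝒱 : VertexAlg A V}

/-- The objects of `ℳ_sg`, inside those of `𝒢ℳ_sg`. -/
def ordinaryModules (𝒱 : VertexAlg A V) : Set (GenMod.{u} 𝒱) := {W | W.act.IsOrdinary}

/-- `W` and `X` are isomorphic as generalized modules. -/
def GenMod.IsIso (W X : GenMod.{u} 𝒱) : Prop :=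
  ∃ e : W.carrier ≃ₗ[ℂ] X.carrier,
    (∀ n v w, e (W.act.mode n v w) = X.act.mode n v (e w)) ∧
    (∀ w, e (W.act.Lneg w) = X.act.Lneg (e w)) ∧
    (∀ w, e (W.act.Lzero w) = X.act.Lzero (e w)) ∧
    (∀ w, e (W.act.Lone w) = X.act.Lone (e w)) ∧
    ∀ β w, w ∈ W.act.gr β ↔ e w ∈ X.act.gr β

/-- `X` is a contragredient module `W'` of `W`: it is identified with the graded dual
`⨁_{n,β} (W_[n]^(β))^* ⊆ W^*`, with `⟨vₙ w', w⟩ = ⟨w', vᵒₙ w⟩`,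
`⟨L(j) w', w⟩ = ⟨w', L(-j) w⟩`, and `(W')^(β)` the functionals vanishing on `W^(γ)`, `γ ≠ -β`. -/
def IsContragredient (W X : GenMod.{u} 𝒱) : Prop :=
  ∃ e : X.carrier →ₗ[ℂ] Dual ℂ W.carrier, Function.Injective e ∧
    Set.range e = {f | {p : ℂ × Γ | ∃ w ∈ W.act.genWt p.1 p.2, f w ≠ 0}.Finite} ∧
    (∀ n v x w, e (X.act.mode n v x) w = e x (𝒱.oppMode W.act.toVertexAction n v w)) ∧
    (∀ x w, e (X.act.Lneg x) w = e x (W.act.Lone w)) ∧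
    (∀ x w, e (X.act.Lzero x) w = e x (W.act.Lzero w)) ∧
    (∀ x w, e (X.act.Lone x) w = e x (W.act.Lneg w)) ∧
    ∀ β x, x ∈ X.act.gr β ↔ ∀ γ, γ ≠ -β → ∀ w ∈ W.act.gr γ, e x w = 0

/-- The full subcategory with objects `C` is closed under the contragredient functor. -/
def ClosedUnderContragredients (C : Set (GenMod.{u} 𝒱)) : Prop :=
  ∀ W ∈ C, ∃ X ∈ C, IsContragredient W X

/-! ### The `Q(z)`-action on `(W₁ ⊗ W₂)^*` -/

variable (z : ℂ) (W₁ W₂ : GenMod.{u} 𝒱)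

/-- The space `(W₁ ⊗ W₂)^*`. -/
abbrev TDual : Type u := Dual ℂ (W₁.carrier ⊗[ℂ] W₂.carrier)

/-- The operator `τ_{Q(z)}(v ⊗ ι₊((z+t)^m t^n))` on `(W₁ ⊗ W₂)^*`, that is, the coefficient of
`x₀^{-n-1} x₁^{-m-1}` in `τ_{Q(z)}(z⁻¹ δ((x₁-x₀)/z) Y_t(v,x₀))`: it sends `λ` to
`w₁ ⊗ w₂ ↦ λ(τ(o(v ⊗ ι₋(t^m (t-z)^n))) w₁ ⊗ w₂) - λ(w₁ ⊗ τ(v ⊗ ι₊(t^m (-z+t)^n)) w₂)`.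
The elements `(z+t)^m t^n`, `m, n ∈ ℤ`, span `ℂ[t, t⁻¹, (z+t)⁻¹]`. -/
def tauQ (m n : ℤ) : V →ₗ[ℂ] TDual W₁ W₂ →ₗ[ℂ] TDual W₁ W₂ :=
  LinearMap.mk₂ ℂ
    (fun v l => l ∘ₗ
      (TensorProduct.map (𝒱.tauOpp W₁.act.toVertexAction W₁.isGenModule.isWeak.truncation
          (-z) n m v) LinearMap.id
        - TensorProduct.map LinearMap.id
          (VertexAlg.tauPlus W₂.act.toVertexAction W₂.isGenModule.isWeak.truncation
            (-z) n m v)))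
    (fun v v' l => by
      simp only [map_add, TensorProduct.map_add_left, TensorProduct.map_add_right,
        LinearMap.comp_sub, LinearMap.comp_add]
      abel)
    (fun c v l => by
      simp only [map_smul, TensorProduct.map_smul_left, TensorProduct.map_smul_right,
        LinearMap.comp_sub, LinearMap.comp_smul, smul_sub])
    (fun v l l' => LinearMap.add_comp _ _ _)
    (fun c v l => LinearMap.smul_comp _ _ _)

/-- The transpose of `S ⊗ 1 - 1 ⊗ T` on `(W₁ ⊗ W₂)^*`. -/
def dualDiff (S : End ℂ W₁.carrier) (T : End ℂ W₂.carrier) : End ℂ (TDual W₁ W₂) :=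
  (TensorProduct.map S LinearMap.id - TensorProduct.map LinearMap.id T).dualMap

/-- `(W₁ ⊗ W₂)^*` with `Y'_{Q(z)}(v,x) = ∑ₙ τ_{Q(z)}(v ⊗ t^n) x^{-n-1}`, the operators
`(L'_{Q(z)}(j)λ)(w₁ ⊗ w₂) = ∑ᵢ C(j+1,i) (-z)^i (λ(L(i-j)w₁ ⊗ w₂) - λ(w₁ ⊗ L(j-i)w₂))`,
`j = -1, 0, 1`, and the homogeneous subspaces `((W₁ ⊗ W₂)^*)^(β)`. -/
def dualAct : GradedAction Γ V (TDual W₁ W₂) where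
  mode n := tauQ z W₁ W₂ 0 n
  Lneg := dualDiff W₁ W₂ W₁.act.Lone W₂.act.Lneg
  Lzero := dualDiff W₁ W₂ (W₁.act.Lzero - z • W₁.act.Lone) (W₂.act.Lzero - z • W₂.act.Lneg)
  Lone := dualDiff W₁ W₂
    (W₁.act.Lneg - (2 * z) • W₁.act.Lzero + z ^ 2 • W₁.act.Lone)
    (W₂.act.Lone - (2 * z) • W₂.act.Lzero + z ^ 2 • W₂.act.Lneg)
  gr β :=
    { carrier := {l | ∀ γ₁ γ₂, γ₁ + γ₂ ≠ -β → ∀ w₁ ∈ W₁.act.gr γ₁, ∀ w₂ ∈ W₂.act.gr γ₂,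
        l (w₁ ⊗ₜ[ℂ] w₂) = 0}
      zero_mem' := fun _ _ _ _ _ _ _ => rfl
      add_mem' := fun {a b} ha hb γ₁ γ₂ h w₁ h₁ w₂ h₂ => by
        rw [LinearMap.add_apply, ha γ₁ γ₂ h w₁ h₁ w₂ h₂, hb γ₁ γ₂ h w₁ h₁ w₂ h₂, add_zero]
      smul_mem' := fun c a ha γ₁ γ₂ h w₁ h₁ w₂ h₂ => by
        rw [LinearMap.smul_apply, ha γ₁ γ₂ h w₁ h₁ w₂ h₂, smul_zero] }

/-- The linear maps `J : X → (W₁ ⊗ W₂)^*` (for `X = W'`, the space `𝒩[Q(z)]`) which are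
`Ã`-compatible and intertwine the actions of `V ⊗ ι₊ ℂ[t, t⁻¹, (z+t)⁻¹]` and of `𝔰𝔩(2)`. -/
structure IsQMap (X : GenMod.{u} 𝒱) (J : X.carrier →ₗ[ℂ] TDual W₁ W₂) : Prop where
  gr_compat : ∀ β, ∀ x ∈ X.act.gr β, J x ∈ (dualAct z W₁ W₂).gr β
  intertwine : ∀ (m n : ℤ) v x,
    J (VertexAlg.tauPlus X.act.toVertexAction X.isGenModule.isWeak.truncation z m n v x) =
      tauQ z W₁ W₂ m n v (J x)
  neg : ∀ x, J (X.act.Lneg x) = (dualAct z W₁ W₂).Lneg (J x)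
  zero : ∀ x, J (X.act.Lzero x) = (dualAct z W₁ W₂).Lzero (J x)
  one : ∀ x, J (X.act.Lone x) = (dualAct z W₁ W₂).Lone (J x)

/-- The set `W₁ ⊠-backslash_{Q(z)} W₂`, relative to `C`: the union of the images `I'(W')`, for `W`
in `C` with contragredient module `W'` and `I' : W' → (W₁ ⊗ W₂)^*` in `𝒩[Q(z)]`. -/
def hboxtr (C : Set (GenMod.{u} 𝒱)) : Set (TDual W₁ W₂) :=
  {l | ∃ W ∈ C, ∃ W' : GenMod.{u} 𝒱, IsContragredient W W' ∧
    ∃ J : W'.carrier →ₗ[ℂ] TDual W₁ W₂, IsQMap z W₁ W₂ W' J ∧ l ∈ Set.range J}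

/-- The elements of `(W₁ ⊗ W₂)^*` satisfying the `Q(z)`-compatibility condition: lower truncation
of `Y'_{Q(z)}(v,x)λ`, and the equality of the coefficients of `x₀^{-n-1} x₁^{-m-1}` in
`τ_{Q(z)}(z⁻¹ δ((x₁-x₀)/z) Y_t(v,x₀)) λ = z⁻¹ δ((x₁-x₀)/z) Y'_{Q(z)}(v,x₀) λ`. -/
def COMP : Set (TDual W₁ W₂) :=
  {l | (∀ v, ∃ N : ℤ, ∀ n ≥ N, (dualAct z W₁ W₂).mode n v l = 0) ∧
    ∀ (v : V) (m n : ℤ), tauQ z W₁ W₂ m n v l =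
      ∑ᶠ k : ℕ, ((Ring.choose m k : ℂ) * z ^ (m - (k : ℤ))) • (dualAct z W₁ W₂).mode (n + k) v l}

/-- `W_{λ;Q(z)}`: the smallest doubly graded subspace containing `λ` and stable under the
components of `Y'_{Q(z)}` and under `L'_{Q(z)}(j)`, `j = -1, 0, 1`. (There is one as soon as `λ`
satisfies the `Q(z)`-grading condition.) -/
def Wlam (l : TDual W₁ W₂) : Submodule ℂ (TDual W₁ W₂) :=
  sInf {S | l ∈ S ∧ (dualAct z W₁ W₂).toVertexAction.Stable S ∧
    S = ⨆ p : ℂ × Γ, S ⊓ (dualAct z W₁ W₂).genWt p.1 p.2}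

/-- The elements satisfying the `Q(z)`-local grading restriction condition. -/
def LGRgen : Set (TDual W₁ W₂) :=
  {l | l ∈ (⨆ p : ℂ × Γ, (dualAct z W₁ W₂).genWt p.1 p.2) ∧
    ∀ (n : ℂ) (β : Γ),
      FiniteDimensional ℂ ↥(Wlam z W₁ W₂ l ⊓ (dualAct z W₁ W₂).genWt n β) ∧
      ∃ N : ℤ, ∀ k ≤ N, Wlam z W₁ W₂ l ⊓ (dualAct z W₁ W₂).genWt (n + k) β = ⊥}

/-- The elements satisfying the `L(0)`-semisimple `Q(z)`-local grading restriction condition. -/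
def LGRss : Set (TDual W₁ W₂) :=
  {l | l ∈ (⨆ p : ℂ × Γ, (dualAct z W₁ W₂).ordWt p.1 p.2) ∧
    ∀ (n : ℂ) (β : Γ),
      FiniteDimensional ℂ ↥(Wlam z W₁ W₂ l ⊓ (dualAct z W₁ W₂).ordWt n β) ∧
      ∃ N : ℤ, ∀ k ≤ N, Wlam z W₁ W₂ l ⊓ (dualAct z W₁ W₂).ordWt (n + k) β = ⊥}

/-- The set `T` is a linear subspace of `(W₁ ⊗ W₂)^*`, stable under the components of `Y'_{Q(z)}`
and under `L'_{Q(z)}(j)`, and a weak `V`-module under these operators. -/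
def FormsWeakModule (T : Set (TDual W₁ W₂)) : Prop :=
  ∃ S : Submodule ℂ (TDual W₁ W₂), (S : Set (TDual W₁ W₂)) = T ∧
    ∃ h : (dualAct z W₁ W₂).toVertexAction.Stable S,
      IsWeakModule 𝒱.adj 𝒱.one 𝒱.omega ((dualAct z W₁ W₂).toVertexAction.restrict S h)

/-- The subspace `S` is stable under the operators and, with the restricted operators and the
grading `S^(β) = S ∩ ((W₁ ⊗ W₂)^*)^(β)`, a generalized `V`-module. -/
structure FormsGenModule (S : Submodule ℂ (TDual W₁ W₂)) : Prop where
  stable : (dualAct z W₁ W₂).toVertexAction.Stable S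
  isGenModule : IsGenModule 𝒱 ((dualAct z W₁ W₂).restrict S stable)

/-- A subspace that is a generalized module, as an object of `𝒢ℳ_sg`. -/
def FormsGenModule.toGenMod {z : ℂ} {W₁ W₂ : GenMod.{u} 𝒱} {S : Submodule ℂ (TDual W₁ W₂)}
    (h : FormsGenModule z W₁ W₂ S) : GenMod.{u} 𝒱 where
  carrier := S
  act := (dualAct z W₁ W₂).restrict S h.stable
  isGenModule := h.isGenModule

/-- `W_{λ;Q(z)}` is a generalized submodule of some object `U` of `C` (up to isomorphism) included
in `(W₁ ⊗ W₂)^*`; that `U` is included in `(W₁ ⊗ W₂)^*` means that it is a subspace carrying the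
restricted structure, and that the inclusion map intertwines the actions of
`V ⊗ ι₊ ℂ[t, t⁻¹, (z+t)⁻¹]` and of `𝔰𝔩(2)`. -/
def WlamInObject (C : Set (GenMod.{u} 𝒱)) (l : TDual W₁ W₂) : Prop :=
  ∃ (U : Submodule ℂ (TDual W₁ W₂)) (h : FormsGenModule z W₁ W₂ U),
    (∃ X ∈ C, X.IsIso h.toGenMod) ∧ IsQMap z W₁ W₂ h.toGenMod U.subtype ∧ Wlam z W₁ W₂ l ≤ U

end

end HLZ

open HLZ

set_option linter.unusedSectionVars false

/-! Put s = z + t. The element v ⊗ s^m t^n acts on (W₁ ⊗ W₂)^* as a transpose: on W₁ through the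
opposite operators, with t^n = (s - z)^n expanded at s = ∞, and on W₂ through the operators
themselves, expanded at s = 0. All these actions, and the Q(z)-action too, satisfy a recurrence
X(m+1, n) = X(m, n+1) + c X(m, n) that expresses the linear relation between s and t. A solution
that vanishes on the row m = 0 and is truncated in n in one direction is zero
(`eq_zero_of_recurrence`). Hence identities known for modes extend to all expansions: the brackets
with L(j), the derivative property and locality. For the opposite operators these identities are
first derived from the 𝔰𝔩(2) relations in V. The weak module axioms other than truncation and Jacobi
then hold on all of (W₁ ⊗ W₂)^*.

The same uniqueness turns compatibility into a uniform truncation: for each v a single N makes τ(v ⊗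
s^m t^n)λ vanish for all m and all n ≥ N (`mem_COMP_iff`). This form is visibly linear. It is stable
under the modes, because locality holds on the whole dual space and spreads the vanishing of a
commutator from a quadrant of exponents to every fixed exponent, uniformly in m
(`exists_bound_of_iterate_diffOp`, `tauQ_mem_COMP`).

The Jacobi identity (`dualDefect_eq_zero`) is proved by descending induction on the exponent l of x₁
- x₂. For large l it is locality. If it holds for l + 1, then the defect for l depends on the
exponents n₁, n₂ of t only through their sum, so n₁ can be moved to where u acts trivially on a
given w₁. If moreover m + n₂ is very negative, everything acts trivially on w₁, and the defect
becomes the Jacobi defect on W₂, which is zero (`dualDefect_tmul_eq_zero`). If n₂ is large, the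
defect vanishes by compatibility. These two regions fill a whole row in m, and the recurrence in m
does the rest.

For the gradings, λ satisfies the local grading restriction exactly when it lies in some stable
graded subspace with finite-dimensional, lower truncated weight spaces (`mem_LGRgen_iff`). Such
subspaces are closed under finite sums, which gives linearity and stability. Compatibility can be
tested on doubly homogeneous components, so it passes from λ to W_λ, which is therefore a
generalized module (`GradingRestricted.formsGenModule`).

In the last two parts, the image of an intertwining map is a subspace of this kind and is
compatible, since it inherits truncation from its source. Conversely, an object X of C included in
the dual has a contragredient W in C, and X is in turn a contragredient of W
(`IsContragredient.symm`), so the inclusion of X is one of the maps I'. In the semisimple case the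
contragredient of an ordinary module is again ordinary. -/

namespace HLZ

/-! ### Binomial sums and powers of x₁ - x₂ -/

section BinomialSums

variable {M N : Type*} [AddCommGroup M] [Module ℂ M] [AddCommGroup N] [Module ℂ N]

/-- The sum `∑ₖ C(m,k) gₖ`, for an eventually vanishing sequence `g`. -/
noncomputable def binSum (m : ℤ) (g : ℕ → M) : M := ∑ᶠ k : ℕ, (Ring.choose m k : ℂ) • g k

lemma finsum_eq_sum_range {g : ℕ → M} {K : ℕ} (h : ∀ k ≥ K, g k = 0) :
    ∑ᶠ k, g k = ∑ k ∈ Finset.range K, g k :=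
  finsum_eq_sum_of_support_subset _ fun k hk => by
    simp only [Finset.coe_range, Set.mem_Iio]
    by_contra hlt
    exact hk (h k (not_lt.1 hlt))

lemma binSum_eq_sum (m : ℤ) {g : ℕ → M} {K : ℕ} (h : ∀ k ≥ K, g k = 0) :
    binSum m g = ∑ k ∈ Finset.range K, (Ring.choose m k : ℂ) • g k :=
  finsum_eq_sum_range fun k hk => by rw [h k hk, smul_zero]

lemma binSum_zero_left (g : ℕ → M) : binSum 0 g = g 0 := by
  rw [binSum, finsum_eq_single _ 0]
  · simp
  · intro k hk
    rw [Int.cast_zero, Ring.choose_zero_pos ℂ (Nat.pos_of_ne_zero hk), zero_smul]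

lemma binSum_eq_zero (m : ℤ) {g : ℕ → M} (h : ∀ k, g k = 0) : binSum m g = 0 := by
  rw [binSum, finsum_eq_zero_of_forall_eq_zero]
  intro k
  rw [h k, smul_zero]

/-- Pascal's rule; the recurrences of `expSum`, `altSum` and `iterSum` all come from it. -/
lemma binSum_succ (m : ℤ) {g : ℕ → M} (h : ∃ K, ∀ k ≥ K, g k = 0) :
    binSum (m + 1) g = binSum m g + binSum m (fun k => g (k + 1)) := by
  obtain ⟨K, hK⟩ := h
  rw [binSum_eq_sum (K := K + 1) _ fun k hk => hK k (by omega),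
    binSum_eq_sum (K := K + 1) _ fun k hk => hK k (by omega),
    binSum_eq_sum (K := K) _ fun k hk => hK (k + 1) (by omega),
    Finset.sum_range_succ', Finset.sum_range_succ' _ K]
  simp only [Int.cast_add, Int.cast_one, Ring.choose_succ_succ, Ring.choose_zero_right, add_smul,
    Finset.sum_add_distrib]
  abel

lemma map_binSum (f : M →ₗ[ℂ] N) (m : ℤ) {g : ℕ → M} (h : ∃ K, ∀ k ≥ K, g k = 0) :
    f (binSum m g) = binSum m fun k => f (g k) := by
  obtain ⟨K, hK⟩ := h
  rw [binSum_eq_sum _ hK, binSum_eq_sum (K := K) _ fun k hk => by rw [hK k hk, map_zero], map_sum]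
  simp only [map_smul]

lemma binSum_add (m : ℤ) {g g' : ℕ → M} (h : ∃ K, ∀ k ≥ K, g k = 0)
    (h' : ∃ K, ∀ k ≥ K, g' k = 0) :
    binSum m (fun k => g k + g' k) = binSum m g + binSum m g' := by
  obtain ⟨K, hK⟩ := h
  obtain ⟨K', hK'⟩ := h'
  rw [binSum_eq_sum (K := max K K') _ fun k hk => hK k (by omega),
    binSum_eq_sum (K := max K K') _ fun k hk => hK' k (by omega),
    binSum_eq_sum (K := max K K') _ fun k hk => by
      rw [hK k (by omega), hK' k (by omega), add_zero]]
  simp only [smul_add, Finset.sum_add_distrib]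

lemma binSum_smul (c : ℂ) (m : ℤ) {g : ℕ → M} (h : ∃ K, ∀ k ≥ K, g k = 0) :
    binSum m (fun k => c • g k) = c • binSum m g :=
  (map_binSum (c • LinearMap.id) m h).symm

/-- The sum `∑ₖ C(m,k) c^{m-k} g(n+k)`: the action of `(c+t)^m t^n`, expanded in nonnegative powers
of `t`, when `t^n` acts as `g n`. -/
noncomputable def expSum (c : ℂ) (g : ℤ → M) (m n : ℤ) : M :=
  binSum m fun k => c ^ (m - (k : ℤ)) • g (n + k)

lemma expSum_zero_left (c : ℂ) (g : ℤ → M) (n : ℤ) : expSum c g 0 n = g n := by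
  simp [expSum, binSum_zero_left]

lemma expSum_eq_zero (c : ℂ) {g : ℤ → M} (m : ℤ) {n : ℤ} (h : ∀ k ≥ n, g k = 0) :
    expSum c g m n = 0 :=
  binSum_eq_zero _ fun k => by rw [h _ (by omega), smul_zero]

/-- This is (c+t)^{m+1} = t(c+t)^m + c(c+t)^m. The condition c ≠ 0 enters because the exponents m -
k may be negative. -/
lemma expSum_succ {c : ℂ} (hc : c ≠ 0) {g : ℤ → M} (hg : ∃ K : ℤ, ∀ n ≥ K, g n = 0) (m n : ℤ) :
    expSum c g (m + 1) n = expSum c g m (n + 1) + c • expSum c g m n := by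
  obtain ⟨N, hN⟩ := hg
  have hf : ∀ (r : ℕ → ℂ), ∃ K, ∀ k ≥ K, r k • g (n + (k : ℕ)) = 0 := fun r =>
    ⟨(N - n).toNat, fun k hk => by rw [hN _ (by omega), smul_zero]⟩
  rw [expSum, expSum, expSum, binSum_succ _ (hf _), add_comm, ← binSum_smul _ _ (hf _)]
  congr 2
  · ext k
    push_cast
    ring_nf
  · ext k
    rw [smul_smul, ← zpow_one_add₀ hc]
    ring_nf

lemma map_expSum (f : M →ₗ[ℂ] N) (c : ℂ) {g : ℤ → M} (hg : ∃ K : ℤ, ∀ n ≥ K, g n = 0) (m n : ℤ) :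
    f (expSum c g m n) = expSum c (fun k => f (g k)) m n := by
  obtain ⟨K, hK⟩ := hg
  rw [expSum, map_binSum f m ⟨(K - n).toNat, fun k hk => by rw [hK _ (by omega), smul_zero]⟩]
  simp only [map_smul, expSum]

lemma finsum_eq_expSum (c : ℂ) (g : ℤ → M) (m n : ℤ) :
    ∑ᶠ k : ℕ, ((Ring.choose m k : ℂ) * c ^ (m - (k : ℤ))) • g (n + k) = expSum c g m n := by
  simp only [expSum, binSum, mul_smul]

/-- The sum `∑ₖ (-1)^k C(l,k) y(p+l-k, q+k)`: the coefficient of a product with `(x₁-x₂)^l`. -/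
noncomputable def altSum (l : ℤ) (y : ℤ → ℤ → M) (p q : ℤ) : M :=
  binSum l fun k => (-1 : ℂ) ^ k • y (p + l - k) (q + k)

/-- The family `y(a, b)` vanishes for large `b`, uniformly in `a`. -/
def TruncRight (y : ℤ → ℤ → M) : Prop := ∃ K : ℤ, ∀ a, ∀ b ≥ K, y a b = 0

lemma TruncRight.exists_nat {y : ℤ → ℤ → M} (h : TruncRight y) (c : ℕ → ℂ) (p : ℕ → ℤ) (q : ℤ) :
    ∃ K, ∀ k ≥ K, c k • y (p k) (q + (k : ℕ)) = 0 := by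
  obtain ⟨K, hK⟩ := h
  exact ⟨(K - q).toNat, fun k hk => by rw [hK _ _ (by omega), smul_zero]⟩

/-- One more factor x₁ - x₂ raises l by one. -/
lemma altSum_succ (l : ℤ) {y : ℤ → ℤ → M} (h : TruncRight y) (p q : ℤ) :
    altSum (l + 1) y p q = altSum l y (p + 1) q - altSum l y p (q + 1) := by
  rw [altSum, binSum_succ _ (h.exists_nat _ _ _), sub_eq_add_neg]
  congr 1
  · simp only [altSum]
    congr 1
    ext k
    ring_nf
  · rw [altSum, ← neg_one_smul ℂ (binSum _ _), ← binSum_smul _ _ (h.exists_nat _ _ _)]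
    congr 1
    ext k
    rw [smul_smul, pow_succ']
    congr 2 <;> push_cast <;> ring

lemma altSum_zero_left (y : ℤ → ℤ → M) (p q : ℤ) : altSum 0 y p q = y p q := by
  simp [altSum, binSum_zero_left]

lemma altSum_add (l : ℤ) {y y' : ℤ → ℤ → M} (h : TruncRight y) (h' : TruncRight y') (p q : ℤ) :
    altSum l (fun a b => y a b + y' a b) p q = altSum l y p q + altSum l y' p q := by
  simp only [altSum, smul_add]
  exact binSum_add _ (h.exists_nat _ _ _) (h'.exists_nat _ _ _)

lemma altSum_smul (c : ℂ) (l : ℤ) {y : ℤ → ℤ → M} (h : TruncRight y) (p q : ℤ) :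
    altSum l (fun a b => c • y a b) p q = c • altSum l y p q := by
  simp only [altSum]
  rw [← binSum_smul _ _ (h.exists_nat _ _ _)]
  simp only [smul_comm c]

lemma map_altSum (f : M →ₗ[ℂ] N) (l : ℤ) {y : ℤ → ℤ → M} (h : TruncRight y) (p q : ℤ) :
    f (altSum l y p q) = altSum l (fun a b => f (y a b)) p q := by
  rw [altSum, map_binSum _ _ (h.exists_nat _ _ _)]
  simp only [altSum, map_smul]

lemma altSum_eq_zero (l : ℤ) {y : ℤ → ℤ → M} {p q : ℤ}
    (h : ∀ k : ℕ, y (p + l - k) (q + k) = 0) : altSum l y p q = 0 :=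
  binSum_eq_zero _ fun k => by rw [h k, smul_zero]

lemma altSum_eq_finsum (l : ℤ) (y : ℤ → ℤ → M) (p q : ℤ) :
    altSum l y p q =
      ∑ᶠ k : ℕ, ((-1 : ℂ) ^ k * (Ring.choose l k : ℂ)) • y (p + l - k) (q + k) := by
  simp only [altSum, binSum, smul_smul, mul_comm]

lemma altSum_shift (l : ℤ) (y : ℤ → ℤ → M) (p q c d : ℤ) :
    altSum l (fun a b => y (a + c) (b + d)) p q = altSum l y (p + c) (q + d) := by
  simp only [altSum]
  congr 1
  ext k
  ring_nf

/-- The product of `y` with `x₁ - x₂`. -/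
def diffOp (c : ℤ → ℤ → M) (p q : ℤ) : M := c (p + 1) q - c p (q + 1)

lemma iterate_diffOp_zero (L : ℕ) : diffOp^[L] (0 : ℤ → ℤ → M) = 0 := by
  induction L with
  | zero => rfl
  | succ L ih =>
    rw [Function.iterate_succ_apply]
    convert ih using 2
    ext p q
    simp [diffOp]

lemma iterate_diffOp_mono {L L' : ℕ} (h : L ≤ L') {c : ℤ → ℤ → M} (hc : diffOp^[L] c = 0) :
    diffOp^[L'] c = 0 := by
  obtain ⟨k, rfl⟩ := Nat.exists_eq_add_of_le' h
  rw [Function.iterate_add_apply, hc, iterate_diffOp_zero]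

lemma diffOp_add (c c' : ℤ → ℤ → M) : diffOp (c + c') = diffOp c + diffOp c' := by
  ext p q
  simp only [diffOp, Pi.add_apply]
  abel

lemma diffOp_smul (r : ℂ) (c : ℤ → ℤ → M) : diffOp (r • c) = r • diffOp c := by
  ext p q
  simp only [diffOp, Pi.smul_apply, smul_sub]

lemma iterate_diffOp_add (L : ℕ) (c c' : ℤ → ℤ → M) :
    diffOp^[L] (c + c') = diffOp^[L] c + diffOp^[L] c' := by
  induction L generalizing c c' with
  | zero => rfl
  | succ L ih => simp only [Function.iterate_succ_apply, diffOp_add, ih]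

lemma iterate_diffOp_smul (L : ℕ) (r : ℂ) (c : ℤ → ℤ → M) :
    diffOp^[L] (r • c) = r • diffOp^[L] c := by
  induction L generalizing c with
  | zero => rfl
  | succ L ih => simp only [Function.iterate_succ_apply, diffOp_smul, ih]

lemma iterate_diffOp_sum {ι : Type*} (L : ℕ) (s : Finset ι) (c : ι → ℤ → ℤ → M) :
    diffOp^[L] (∑ i ∈ s, c i) = ∑ i ∈ s, diffOp^[L] (c i) := by
  classical
  induction s using Finset.induction_on with
  | empty => simpa using iterate_diffOp_zero L
  | insert i s hi ih => rw [Finset.sum_insert hi, Finset.sum_insert hi, iterate_diffOp_add, ih]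

lemma iterate_diffOp_map (f : M →ₗ[ℂ] N) (L : ℕ) (c : ℤ → ℤ → M) (p q : ℤ) :
    diffOp^[L] (fun a b => f (c a b)) p q = f (diffOp^[L] c p q) := by
  induction L generalizing c with
  | zero => rfl
  | succ L ih =>
    have h2 : diffOp (fun a b => f (c a b)) = fun a b => f (diffOp c a b) := by
      funext a b
      simp [diffOp]
    rw [Function.iterate_succ_apply, Function.iterate_succ_apply, h2, ih]

/-- Reflecting both indices turns the difference operator into its negative, up to a shift. Opposite
modes are sums of modes at reflected indices, so this carries locality over to them. -/
lemma iterate_diffOp_reflect (L : ℕ) (c : ℤ → ℤ → M) (hc : diffOp^[L] c = 0) (r s : ℤ) :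
    diffOp^[L] (fun p q => c (r - p) (s - q)) = 0 := by
  induction L generalizing c r s with
  | zero =>
    simp only [Function.iterate_zero, id_eq] at hc ⊢
    rw [hc]
    rfl
  | succ L ih =>
    rw [Function.iterate_succ_apply] at hc ⊢
    have := ih _ hc (r - 1) (s - 1)
    have h2 : diffOp (fun p q => c (r - p) (s - q)) =
        (-1 : ℂ) • fun p q => diffOp c (r - 1 - p) (s - 1 - q) := by
      ext p q
      simp only [diffOp, Pi.smul_apply, neg_smul, one_smul, neg_sub]
      ring_nf
    rw [h2, iterate_diffOp_smul, this, smul_zero]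

/-- For `l ≥ 0`, the commutator expressed by alternating sums is an iterated difference. -/
lemma altSum_sub_altSum_natCast {y y' : ℤ → ℤ → M} (h : TruncRight y) (h' : TruncRight y')
    (L : ℕ) (p q : ℤ) :
    altSum L y p q - (-1 : ℂ) ^ L • altSum L y' q p =
      diffOp^[L] (fun a b => y a b - y' b a) p q := by
  induction L generalizing p q with
  | zero => simp [altSum_zero_left]
  | succ L ih =>
    rw [Function.iterate_succ_apply', diffOp, ← ih, ← ih]
    push_cast
    rw [altSum_succ _ h, altSum_succ _ h', pow_succ]
    module

/-- A family killed by a power of `x₁ - x₂` and vanishing on a quadrant vanishes, for each value of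
the second index, once the first index is large. -/
lemma exists_bound_of_iterate_diffOp {ι : Type*} (L : ℕ) (c : ι → ℤ → ℤ → M)
    (hc : ∀ i, diffOp^[L] (c i) = 0) (K K' : ℤ)
    (h : ∀ i, ∀ p ≥ K, ∀ q ≥ K', c i p q = 0) (q : ℤ) :
    ∃ B : ℤ, ∀ i, ∀ p ≥ B, c i p q = 0 := by
  induction L generalizing c K K' q with
  | zero => exact ⟨0, fun i p _ => by simpa using congrFun (congrFun (hc i) p) q⟩
  | succ L ihL =>
    -- Downward induction on the second index: c(p, q) = c(p-1, q+1) + (difference of c)(p-1, q),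
    -- where the last term is controlled by the induction on L. None of the bounds depends on i.
    have key : ∀ d : ℕ, ∀ q : ℤ, K' ≤ q + d → ∃ B : ℤ, ∀ i, ∀ p ≥ B, c i p q = 0 := by
      intro d
      induction d with
      | zero => exact fun q hq => ⟨K, fun i p hp => h i p hp q (by simpa using hq)⟩
      | succ d ihd =>
        intro q hq
        obtain ⟨B₁, hB₁⟩ := ihd (q + 1) (by push_cast at hq; omega)
        obtain ⟨B₂, hB₂⟩ := ihL (fun i => diffOp (c i))
          (fun i => by rw [← Function.iterate_succ_apply]; exact hc i) K K'
          (fun i p hp r hr => by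
            rw [diffOp, h i _ (by omega) r hr, h i p hp _ (by omega), sub_zero]) q
        refine ⟨max B₁ B₂ + 1, fun i p hp => ?_⟩
        have := hB₂ i (p - 1) (by omega)
        rw [diffOp, sub_add_cancel, hB₁ i (p - 1) (by omega), sub_zero] at this
        exact this
    exact key (K' - q).toNat q (by omega)

end BinomialSums

/-! ### Uniqueness for the recurrence X(a+1, n) = X(a, n+1) + c X(a, n) -/

section Recurrence

open Filter

variable {M : Type*} [AddCommGroup M] [Module ℂ M]

/-- A solution of `X(a+1,n) = X(a,n+1) + c X(a,n)` that vanishes for `a = 0` and, for each `a`, for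
large `n` (or for very negative `n`), is zero. -/
lemma eq_zero_of_recurrence {F : Filter ℤ} (hF : F = atTop ∨ F = atBot) {c : ℂ} (hc : c ≠ 0)
    {X : ℤ → ℤ → M} (h0 : ∀ n, X 0 n = 0) (hX : ∀ a n, X (a + 1) n = X a (n + 1) + c • X a n)
    (ht : ∀ a, ∀ᶠ n in F, X a n = 0) (a n : ℤ) : X a n = 0 := by
  induction a using Int.induction_on generalizing n with
  | zero => exact h0 n
  | succ a ih => rw [hX, ih, ih, smul_zero, add_zero]
  | pred a ih =>
    -- The preceding row is a geometric sequence with ratio -c ≠ 0, so its vanishing at one end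
    -- spreads to all n.
    have h1 : ∀ n, X (-a - 1) (n + 1) + c • X (-a - 1) n = 0 := fun n => by
      rw [← hX, sub_add_cancel, ih]
    have ha := ht (-a - 1)
    rcases hF with rfl | rfl
    · obtain ⟨K, hK⟩ := eventually_atTop.1 ha
      have key : ∀ d : ℕ, ∀ n : ℤ, K ≤ n + d → X (-a - 1) n = 0 := by
        intro d
        induction d with
        | zero => exact fun n hn => hK n (by simpa using hn)
        | succ d ihd =>
          intro n hn
          have h2 := h1 n
          rw [ihd (n + 1) (by push_cast at hn; omega), zero_add] at h2
          exact (smul_eq_zero.1 h2).resolve_left hc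
      exact key (K - n).toNat n (by omega)
    · obtain ⟨K, hK⟩ := eventually_atBot.1 ha
      have key : ∀ d : ℕ, ∀ n : ℤ, n ≤ K + d → X (-a - 1) n = 0 := by
        intro d
        induction d with
        | zero => exact fun n hn => hK n (by simpa using hn)
        | succ d ihd =>
          intro n hn
          have h2 := h1 (n - 1)
          rwa [sub_add_cancel, ihd (n - 1) (by push_cast at hn; omega), smul_zero, add_zero] at h2
      exact key (n - K).toNat n (by omega)

/-- A family satisfying `X(a+1,n) = X(a,n+1) + c X(a,n)` and vanishing for large `n` is determined
by its values at `a = 0`. -/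
lemma eq_expSum_of_recurrence {c : ℂ} (hc : c ≠ 0) {X : ℤ → ℤ → M}
    (hX : ∀ a n, X (a + 1) n = X a (n + 1) + c • X a n)
    (ht : ∀ a, ∃ K : ℤ, ∀ n ≥ K, X a n = 0) (a b n : ℤ) :
    X (b + a) n = expSum c (X b) a n := by
  rw [← sub_eq_zero]
  refine eq_zero_of_recurrence (Or.inl rfl) hc
    (X := fun a n => X (b + a) n - expSum c (X b) a n) (fun n => ?_) (fun a n => ?_) (fun a => ?_) a n
  · simp [expSum_zero_left]
  · rw [← add_assoc, hX, expSum_succ hc (ht b)]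
    module
  · obtain ⟨K, hK⟩ := ht (b + a)
    obtain ⟨K', hK'⟩ := ht b
    filter_upwards [eventually_ge_atTop K, eventually_ge_atTop K'] with n h1 h2
    rw [hK n h1, expSum_eq_zero c a fun k hk => hK' k (le_trans h2 hk), sub_zero]

lemma tendsto_add_int {F : Filter ℤ} (hF : F = atTop ∨ F = atBot) (c : ℤ) :
    Tendsto (fun n => n + c) F F := by
  rcases hF with rfl | rfl
  · exact tendsto_atTop_add_const_right _ _ tendsto_id
  · exact tendsto_atBot_add_const_right _ _ tendsto_id

lemma iterate_diffOp_eventually_right {F : Filter ℤ} (hF : F = atTop ∨ F = atBot) (L : ℕ)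
    {c : ℤ → ℤ → M} (h : ∀ p, ∀ᶠ q in F, c p q = 0) (p : ℤ) :
    ∀ᶠ q in F, diffOp^[L] c p q = 0 := by
  induction L generalizing c p with
  | zero => exact h p
  | succ L ih =>
    refine ih (fun p => ?_) p
    filter_upwards [h (p + 1), (tendsto_add_int hF 1).eventually (h p)] with q h1 h2
    rw [diffOp, h1, h2, sub_zero]

lemma iterate_diffOp_eventually_left {F : Filter ℤ} (hF : F = atTop ∨ F = atBot) (L : ℕ)
    {c : ℤ → ℤ → M} (h : ∀ q, ∀ᶠ p in F, c p q = 0) (q : ℤ) :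
    ∀ᶠ p in F, diffOp^[L] c p q = 0 := by
  induction L generalizing c q with
  | zero => exact h q
  | succ L ih =>
    refine ih (fun q => ?_) q
    filter_upwards [h (q + 1), (tendsto_add_int hF 1).eventually (h q)] with p h1 h2
    rw [diffOp, h1, h2, sub_zero]

lemma iterate_diffOp_shift (L : ℕ) (c : ℤ → ℤ → M) (r s p q : ℤ) :
    diffOp^[L] (fun a b => c (a + r) (b + s)) p q = diffOp^[L] c (p + r) (q + s) := by
  induction L generalizing c with
  | zero => rfl
  | succ L ih =>
    rw [Function.iterate_succ_apply, Function.iterate_succ_apply, ← ih]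
    have h2 : diffOp (fun a b => c (a + r) (b + s)) = fun a b => diffOp c (a + r) (b + s) := by
      funext a b
      simp only [diffOp]
      ring_nf
    rw [h2]

/-- The coefficients of `c` multiplied by powers of `t₁ = s₁ + r` and `t₂ = s₂ + r`: a power of
`s₁ - s₂` that kills `c` kills all of them. -/
lemma iterate_diffOp_right_of_recurrence {F : Filter ℤ} (hF : F = atTop ∨ F = atBot) {r : ℂ} (hr : r ≠ 0)
    {c : ℤ → ℤ → ℤ → ℤ → M}
    (h1 : ∀ a p b q, c (a + 1) p b q = c a (p + 1) b q + r • c a p b q)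
    (h2 : ∀ a p b q, c a p (b + 1) q = c a p b (q + 1) + r • c a p b q)
    (t1 : ∀ a b q, ∀ᶠ p in F, c a p b q = 0) (t2 : ∀ a p b, ∀ᶠ q in F, c a p b q = 0)
    (L : ℕ) (h0 : diffOp^[L] (fun p q => c 0 p 0 q) = 0) (a b : ℤ) :
    diffOp^[L] (fun p q => c a p b q) = 0 := by
  -- The exponent b is moved first, with a = 0, and a afterwards; eventual vanishing survives
  -- finitely many differences.
  have s1 : ∀ b p q, diffOp^[L] (fun p q => c 0 p b q) p q = 0 := by
    intro b p q
    refine eq_zero_of_recurrence hF hr (X := fun b q => diffOp^[L] (fun p q => c 0 p b q) p q)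
      (fun n => congrFun (congrFun h0 p) n) (fun b q => ?_)
      (fun b => iterate_diffOp_eventually_right hF L (fun p => t2 0 p b) p) b q
    have : (fun p q => c 0 p (b + 1) q) =
        (fun p q => c 0 (p + 0) b (q + 1)) + r • fun p q => c 0 p b q := by
      funext p q
      simp only [h2, add_zero, Pi.add_apply, Pi.smul_apply]
    rw [this, iterate_diffOp_add, iterate_diffOp_smul, Pi.add_apply, Pi.add_apply,
      iterate_diffOp_shift L (fun p q => c 0 p b q), add_zero]
    rfl
  funext p q
  refine eq_zero_of_recurrence hF hr (X := fun a p => diffOp^[L] (fun p q => c a p b q) p q)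
    (fun n => s1 b n q) (fun a p => ?_)
    (fun a => iterate_diffOp_eventually_left hF L (fun q => t1 a b q) q) a p
  have : (fun p q => c (a + 1) p b q) =
      (fun p q => c a (p + 1) b (q + 0)) + r • fun p q => c a p b q := by
    funext p q
    simp only [h1, add_zero, Pi.add_apply, Pi.smul_apply]
  rw [this, iterate_diffOp_add, iterate_diffOp_smul, Pi.add_apply, Pi.add_apply,
    iterate_diffOp_shift L (fun p q => c a p b q), add_zero]
  rfl

/-- The analogue of `iterate_diffOp_right_of_recurrence` for `t₁ - t₂ = s₁ - s₂`. -/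
lemma iterate_diffOp_left_of_recurrence {F : Filter ℤ} (hF : F = atTop ∨ F = atBot) {r : ℂ} (hr : r ≠ 0)
    {c : ℤ → ℤ → ℤ → ℤ → M}
    (h1 : ∀ a p b q, c (a + 1) p b q = c a (p + 1) b q + r • c a p b q)
    (h2 : ∀ a p b q, c a p (b + 1) q = c a p b (q + 1) + r • c a p b q)
    (t1 : ∀ a b q, ∀ᶠ p in F, c a p b q = 0) (t2 : ∀ a p b, ∀ᶠ q in F, c a p b q = 0)
    (L : ℕ) (h0 : diffOp^[L] (fun p q => c 0 p 0 q) = 0) (p q : ℤ) :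
    diffOp^[L] (fun a b => c a p b q) = 0 := by
  -- The two terms with factor r cancel in t₁ - t₂ = s₁ - s₂, so differences in (a, b) agree with
  -- differences in (p, q).
  have s3 : ∀ (L : ℕ) (c : ℤ → ℤ → ℤ → ℤ → M),
      (∀ a p b q, c (a + 1) p b q = c a (p + 1) b q + r • c a p b q) →
      (∀ a p b q, c a p (b + 1) q = c a p b (q + 1) + r • c a p b q) → ∀ a p b q,
      diffOp^[L] (fun a b => c a p b q) a b = diffOp^[L] (fun p q => c a p b q) p q := by
    intro L
    induction L with
    | zero => exact fun c _ _ a p b q => rfl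
    | succ L ih =>
      intro c h1 h2 a p b q
      have h3 : ∀ p q, diffOp (fun a b => c a p b q) =
          fun a b => diffOp (fun p q => c a p b q) p q := by
        intro p q
        funext a b
        simp only [diffOp, h1, h2]
        abel
      rw [Function.iterate_succ_apply, Function.iterate_succ_apply, h3]
      rw [ih (fun a p b q => diffOp (fun p q => c a p b q) p q)]
      · intro a p b q
        simp only [diffOp, h1, smul_sub]
        abel
      · intro a p b q
        simp only [diffOp, h2, smul_sub]
        abel
  funext a b
  rw [s3 L c h1 h2, iterate_diffOp_right_of_recurrence hF hr h1 h2 t1 t2 L h0]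
  rfl

end Recurrence

/-! ### Expansions of v ⊗ t^a s^n with t = s + c, and locality -/

section Expansion

open Filter

variable {V W : Type*} [AddCommGroup V] [Module ℂ V] [AddCommGroup W] [Module ℂ W]

/-- The operators `T a n v` behave as the action of `v ⊗ t^a s^n` with `t = s + c`, expanded
in a direction determined by `F`. -/
structure IsExpansion (F : Filter ℤ) (c : ℂ) (T : ℤ → ℤ → V →ₗ[ℂ] W →ₗ[ℂ] W) : Prop where
  dir : F = atTop ∨ F = atBot
  ne_zero : c ≠ 0
  succ : ∀ a n v w, T (a + 1) n v w = T a (n + 1) v w + c • T a n v w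
  trunc : ∀ v w a, ∀ᶠ n in F, T a n v w = 0

namespace IsExpansion

variable {F : Filter ℤ} {c : ℂ} {T : ℤ → ℤ → V →ₗ[ℂ] W →ₗ[ℂ] W}

lemma trunc_add (h : IsExpansion F c T) (v : V) (w : W) (a r : ℤ) :
    ∀ᶠ n in F, T a (n + r) v w = 0 :=
  (tendsto_add_int h.dir r).eventually (h.trunc v w a)

lemma one_zero (h : IsExpansion F c T) (v : V) (w : W) : T 1 0 v w = T 0 1 v w + c • T 0 0 v w := by
  simpa using h.succ 0 0 v w

lemma two_zero (h : IsExpansion F c T) (v : V) (w : W) :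
    T 2 0 v w = T 0 2 v w + (2 * c) • T 0 1 v w + c ^ 2 • T 0 0 v w := by
  have h1 : T 2 0 v w = T 1 1 v w + c • T 1 0 v w := h.succ 1 0 v w
  have h2 : T 1 1 v w = T 0 2 v w + c • T 0 1 v w := by simpa using h.succ 0 1 v w
  rw [h1, h2, h.one_zero]
  module

/-- A commutation relation with an operator extends from the modes to all expansions. -/
lemma comm (h : IsExpansion F c T) (S : End ℂ W) (A B C : End ℂ V)
    (h0 : ∀ n v w, S (T 0 n v w) - T 0 n v (S w) =
      T 0 n (A v) w + T 0 (n + 1) (B v) w + T 0 (n + 2) (C v) w) (a n : ℤ) (v : V) (w : W) :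
    S (T a n v w) - T a n v (S w) =
      T a n (A v) w + T a (n + 1) (B v) w + T a (n + 2) (C v) w := by
  rw [← sub_eq_zero]
  refine eq_zero_of_recurrence h.dir h.ne_zero
    (X := fun a n => S (T a n v w) - T a n v (S w) -
      (T a n (A v) w + T a (n + 1) (B v) w + T a (n + 2) (C v) w))
    (fun n => sub_eq_zero.2 (h0 n v w)) (fun a n => ?_) (fun a => ?_) a n
  · simp only [h.succ, map_add, map_smul]
    rw [add_right_comm n 1 1, add_right_comm n 1 2]
    module
  · filter_upwards [h.trunc v w a, h.trunc v (S w) a, h.trunc (A v) w a,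
      h.trunc_add (B v) w a 1, h.trunc_add (C v) w a 2] with n h1 h2 h3 h4 h5
    rw [h1, h2, h3, h4, h5]
    simp

/-- The relation `(L(-1)v)(f) = -v(f')`. -/
lemma derivative (h : IsExpansion F c T) (A : End ℂ V)
    (h0 : ∀ n v w, T 0 n (A v) w = (-(n : ℂ)) • T 0 (n - 1) v w) (a n : ℤ) (v : V) (w : W) :
    T a n (A v) w = (-(n : ℂ)) • T a (n - 1) v w - (a : ℂ) • T (a - 1) n v w := by
  rw [← sub_eq_zero]
  refine eq_zero_of_recurrence h.dir h.ne_zero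
    (X := fun a n => T a n (A v) w - ((-(n : ℂ)) • T a (n - 1) v w - (a : ℂ) • T (a - 1) n v w))
    (fun n => by simp [h0]) (fun a n => ?_) (fun a => ?_) a n
  · have h1 := h.succ a (n - 1) v w
    have h2 := h.succ (a - 1) n v w
    simp only [sub_add_cancel] at h1 h2
    simp only [h.succ a n, add_sub_cancel_right, h1, h2, Int.cast_add, Int.cast_one]
    have h3 : T (a - 1) (n + 1) v w = T a n v w - c • T (a - 1) n v w := by rw [h2]; abel
    rw [h3]
    module
  · filter_upwards [h.trunc (A v) w a, h.trunc_add v w a (-1), h.trunc v w (a - 1)] with n h1 h2 h3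
    rw [sub_eq_add_neg n 1, h1, h2, h3]
    simp

/-- With u, v and w fixed, the commutator is a family in four exponents. This lemma and the next
three are the hypotheses that the recurrence lemmas need. -/
lemma bracket_succ_left (h : IsExpansion F c T) (u v : V) (w : W) (a p b q : ℤ) :
    T (a + 1) p u (T b q v w) - T b q v (T (a + 1) p u w) =
      T a (p + 1) u (T b q v w) - T b q v (T a (p + 1) u w) +
        c • (T a p u (T b q v w) - T b q v (T a p u w)) := by
  simp only [h.succ a, map_add, map_smul]
  module

lemma bracket_succ_right (h : IsExpansion F c T) (u v : V) (w : W) (a p b q : ℤ) :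
    T a p u (T (b + 1) q v w) - T (b + 1) q v (T a p u w) =
      T a p u (T b (q + 1) v w) - T b (q + 1) v (T a p u w) +
        c • (T a p u (T b q v w) - T b q v (T a p u w)) := by
  simp only [h.succ b, map_add, map_smul]
  module

lemma bracket_trunc_left (h : IsExpansion F c T) (u v : V) (w : W) (a b q : ℤ) :
    ∀ᶠ p in F, T a p u (T b q v w) - T b q v (T a p u w) = 0 := by
  filter_upwards [h.trunc u (T b q v w) a, h.trunc u w a] with p h1 h2
  rw [h1, h2, map_zero, sub_zero]

lemma bracket_trunc_right (h : IsExpansion F c T) (u v : V) (w : W) (a p b : ℤ) :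
    ∀ᶠ q in F, T a p u (T b q v w) - T b q v (T a p u w) = 0 := by
  filter_upwards [h.trunc v w b, h.trunc v (T a p u w) b] with q h1 h2
  rw [h1, h2, map_zero, sub_zero]

/-- Locality extends from the modes to all expansions. -/
lemma locality (h : IsExpansion F c T) (u v : V) (w : W) (L : ℕ)
    (h0 : diffOp^[L] (fun p q => T 0 p u (T 0 q v w) - T 0 q v (T 0 p u w)) = 0) (p q : ℤ) :
    diffOp^[L] (fun a b => T a p u (T b q v w) - T b q v (T a p u w)) = 0 := by
  refine iterate_diffOp_left_of_recurrence h.dir h.ne_zero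
    (c := fun a p b q => T a p u (T b q v w) - T b q v (T a p u w)) (h.bracket_succ_left u v w)
    (h.bracket_succ_right u v w) (h.bracket_trunc_left u v w) (h.bracket_trunc_right u v w) L h0 p q

/-- Locality extends from the modes to all expansions, in terms of the second indices. -/
lemma locality_right (h : IsExpansion F c T) (u v : V) (w : W) (L : ℕ)
    (h0 : diffOp^[L] (fun p q => T 0 p u (T 0 q v w) - T 0 q v (T 0 p u w)) = 0) (a b : ℤ) :
    diffOp^[L] (fun p q => T a p u (T b q v w) - T b q v (T a p u w)) = 0 := by
  refine iterate_diffOp_right_of_recurrence h.dir h.ne_zero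
    (c := fun a p b q => T a p u (T b q v w) - T b q v (T a p u w)) (h.bracket_succ_left u v w)
    (h.bracket_succ_right u v w) (h.bracket_trunc_left u v w) (h.bracket_trunc_right u v w) L h0 a b

end IsExpansion

namespace VertexAlg

lemma tauPlus_apply (D : VertexAction V W) (hD) (a : ℂ) (m n : ℤ) (v : V) (w : W) :
    tauPlus D hD a m n v w = expSum a (fun n => D.mode n v w) m n := by
  rw [← finsum_eq_expSum]
  rfl

lemma tauPlus_zero (D : VertexAction V W) (hD) (a : ℂ) (n : ℤ) (v : V) (w : W) :
    tauPlus D hD a 0 n v w = D.mode n v w := by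
  rw [tauPlus_apply, expSum_zero_left]

lemma tauPlus_eq_zero {D : VertexAction V W} (hD) (a : ℂ) (m : ℤ) {n : ℤ} {v : V} {w : W}
    (h : ∀ k ≥ n, D.mode k v w = 0) : tauPlus D hD a m n v w = 0 := by
  rw [tauPlus_apply]
  exact expSum_eq_zero a m h

/-- The expansion at s = 0: truncation holds for large exponents of s. -/
lemma tauPlus_isExpansion (D : VertexAction V W) (hD) {a : ℂ} (ha : a ≠ 0) :
    IsExpansion atTop a (tauPlus D hD a) where
  dir := Or.inl rfl
  ne_zero := ha
  succ m n v w := by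
    simp only [tauPlus_apply]
    exact expSum_succ ha (hD v w) m n
  trunc v w m := by
    obtain ⟨N, hN⟩ := hD v w
    filter_upwards [eventually_ge_atTop N] with n hn
    exact tauPlus_eq_zero hD a m fun k hk => hN k (le_trans hn hk)

end VertexAlg

/-- Locality of the vertex operators of a weak module. -/
lemma IsWeakModule.locality {adj : VertexAction V V} {one : V} {omega : Option V}
    {D : VertexAction V W} (h : IsWeakModule adj one omega D) {u v : V} {L : ℕ}
    (hL : ∀ k : ℕ, adj.mode (L + k) u v = 0) (w : W) :
    diffOp^[L] (fun p q => D.mode p u (D.mode q v w) - D.mode q v (D.mode p u w)) = 0 := by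
  obtain ⟨K, hK⟩ := h.truncation v w
  obtain ⟨K', hK'⟩ := h.truncation u w
  funext p q
  -- With l = L every term on the iterate side contains a vanishing mode of u on v.
  have h1 := (h.jacobi u v w L p q).trans
    (finsum_eq_zero_of_forall_eq_zero fun k => by rw [hL k]; simp)
  rw [← altSum_sub_altSum_natCast (y := fun p q => D.mode p u (D.mode q v w))
    (y' := fun q p => D.mode q v (D.mode p u w)) ⟨K, fun a b hb => by simp only [hK b hb, map_zero]⟩
    ⟨K', fun a b hb => by simp only [hK' b hb, map_zero]⟩, altSum_eq_finsum, altSum_eq_finsum]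
  simpa using h1

end Expansion

/-! ### Opposite vertex operators: expansion and locality -/

section Opposite

open Filter

variable {Γ : Type v} [AddCommGroup Γ] {A : AddSubgroup Γ} {V : Type*} [AddCommGroup V]
  [Module ℂ V] (𝒱 : VertexAlg A V) {W : Type*} [AddCommGroup W] [Module ℂ W]

namespace VertexAlg

lemma exists_mode_eq_zero (u v : V) : ∃ L : ℕ, ∀ k : ℕ, 𝒱.adj.mode (L + k) u v = 0 := by
  obtain ⟨N, hN⟩ := 𝒱.isWeak.truncation u v
  exact ⟨N.toNat, fun k => hN _ (by omega)⟩

/-- The index set depends on v alone, not on n or w; this makes the order of locality of opposite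
operators uniform. -/
lemma oppMode_eq_sum (D : VertexAction V W) (n : ℤ) (v : V) (w : W) :
    𝒱.oppMode D n v w = ∑ p ∈ (𝒱.opp_support v).toFinset,
      ((-1 : ℂ) ^ p.1 * ((p.2.factorial : ℂ))⁻¹) •
        D.mode (-n - p.2 - 2 + 2 * p.1) ((𝒱.adj.Lone ^ p.2) (𝒱.proj p.1 v)) w := by
  change ∑ᶠ p : ℤ × ℕ, _ = _
  rw [finsum_eq_sum_of_support_subset (s := (𝒱.opp_support v).toFinset)]
  · rfl
  · intro p hp
    simp only [Set.Finite.coe_toFinset, Set.mem_ofPred_eq]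
    intro h0
    exact hp (by simp [h0])

lemma proj_of_mem {h : ℤ} {v : V} (hv : v ∈ 𝒱.wt h) : 𝒱.proj h v = v := by
  have h1 : (LinearEquiv.ofBijective (DirectSum.coeLinearMap 𝒱.wt) 𝒱.wt_isInternal).symm v =
      DirectSum.lof ℂ ℤ (fun n => 𝒱.wt n) h ⟨v, hv⟩ := by
    rw [LinearEquiv.symm_apply_eq]
    exact (DirectSum.coeLinearMap_lof 𝒱.wt h ⟨v, hv⟩).symm
  simp [proj, h1]

lemma proj_of_mem_ne {h h' : ℤ} (hne : h' ≠ h) {v : V} (hv : v ∈ 𝒱.wt h) : 𝒱.proj h' v = 0 := by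
  have h1 : (LinearEquiv.ofBijective (DirectSum.coeLinearMap 𝒱.wt) 𝒱.wt_isInternal).symm v =
      DirectSum.lof ℂ ℤ (fun n => 𝒱.wt n) h ⟨v, hv⟩ := by
    rw [LinearEquiv.symm_apply_eq]
    exact (DirectSum.coeLinearMap_lof 𝒱.wt h ⟨v, hv⟩).symm
  simp [proj, h1, DirectSum.component.of, hne.symm]

/-- A property of vectors that is closed under addition holds when it holds for the homogeneous
ones. -/
lemma wt_induction {p : V → Prop} (v : V) (hp : ∀ h, ∀ v ∈ 𝒱.wt h, p v)
    (add : ∀ v v', p v → p v' → p (v + v')) : p v := by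
  have hv : v ∈ ⨆ n, 𝒱.wt n := by
    change v ∈ ⨆ n : ℤ, 𝒱.adj.Lzero.eigenspace (n : ℂ)
    rw [𝒱.weight_iSup]
    trivial
  exact Submodule.iSup_induction (p := 𝒱.wt) (motive := p) hv hp (hp 0 0 (zero_mem _)) add

/-- The terms of the opposite vertex operator of a homogeneous vector. -/
noncomputable def oppTerm (D : VertexAction V W) (h n : ℤ) (v : V) (w : W) (p : ℕ) : W :=
  ((p.factorial : ℂ))⁻¹ • D.mode (-n - p - 2 + 2 * h) ((𝒱.adj.Lone ^ p) v) w

lemma oppMode_of_mem (D : VertexAction V W) (n : ℤ) {h : ℤ} {v : V} (hv : v ∈ 𝒱.wt h) (w : W)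
    {K : ℕ} (hK : ∀ p ≥ K, (𝒱.adj.Lone ^ p) v = 0) :
    𝒱.oppMode D n v w = (-1 : ℂ) ^ h • ∑ p ∈ Finset.range K, 𝒱.oppTerm D h n v w p := by
  change ∑ᶠ p : ℤ × ℕ, _ = _
  rw [finsum_eq_sum_of_support_subset (s := ({h} : Finset ℤ) ×ˢ Finset.range K)]
  · rw [Finset.sum_product, Finset.sum_singleton, Finset.smul_sum]
    refine Finset.sum_congr rfl fun p _ => ?_
    simp only [LinearMap.smul_apply, LinearMap.comp_apply, 𝒱.proj_of_mem hv, oppTerm, smul_smul]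
  · rintro ⟨h', p⟩ hp
    simp only [Finset.coe_product, Finset.coe_singleton, Finset.coe_range, Set.mem_prod,
      Set.mem_singleton_iff, Set.mem_Iio]
    simp only [Function.mem_support, LinearMap.smul_apply, LinearMap.comp_apply] at hp
    have h1 : h' = h := by
      by_contra hne
      exact hp (by simp [𝒱.proj_of_mem_ne hne hv])
    refine ⟨h1, ?_⟩
    by_contra hlt
    rw [h1, 𝒱.proj_of_mem hv, hK p (not_lt.1 hlt)] at hp
    simp at hp

lemma tauOpp_apply (D : VertexAction V W) (hD) (a : ℂ) (m n : ℤ) (v : V) (w : W) :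
    𝒱.tauOpp D hD a m n v w = binSum m fun k : ℕ => a ^ k • 𝒱.oppMode D (m + n - k) v w := by
  change ∑ᶠ k : ℕ, _ = ∑ᶠ k : ℕ, _
  simp only [LinearMap.smul_apply, mul_smul]

lemma tauOpp_zero (D : VertexAction V W) (hD) (a : ℂ) (n : ℤ) (v : V) (w : W) :
    𝒱.tauOpp D hD a 0 n v w = 𝒱.oppMode D n v w := by
  rw [tauOpp_apply, binSum_zero_left]
  simp

lemma tauOpp_eq_zero {D : VertexAction V W} (hD) (a : ℂ) {m n : ℤ} {v : V} {w : W}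
    (h : ∀ k ≤ m + n, 𝒱.oppMode D k v w = 0) : 𝒱.tauOpp D hD a m n v w = 0 := by
  rw [tauOpp_apply]
  exact binSum_eq_zero _ fun k => by rw [h _ (by omega), smul_zero]

/-- The expansion at s = ∞: truncation now holds for very negative exponents of s. -/
lemma tauOpp_isExpansion (D : VertexAction V W) (hD) {a : ℂ} (ha : a ≠ 0) :
    IsExpansion atBot a (𝒱.tauOpp D hD a) where
  dir := Or.inr rfl
  ne_zero := ha
  succ m n v w := by
    obtain ⟨N, hN⟩ := 𝒱.oppMode_truncation hD v w
    have hf : ∀ (c : ℕ → ℂ) (r : ℤ), ∃ K, ∀ k ≥ K, c k • 𝒱.oppMode D (r - (k : ℕ)) v w = 0 :=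
      fun c r => ⟨(r - N).toNat, fun k hk => by rw [hN _ (by omega), smul_zero]⟩
    rw [tauOpp_apply, tauOpp_apply, tauOpp_apply, binSum_succ _ (hf _ _), ← binSum_smul _ _ (hf _ _)]
    congr 2
    · ext k
      ring_nf
    · ext k
      rw [smul_smul, ← pow_succ']
      push_cast
      ring_nf
  trunc v w m := by
    obtain ⟨N, hN⟩ := 𝒱.oppMode_truncation hD v w
    filter_upwards [eventually_le_atBot (N - m)] with n hn
    exact 𝒱.tauOpp_eq_zero hD a fun k hk => hN k (by omega)

/-- Locality of the opposite vertex operators. -/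
lemma oppMode_locality {D : VertexAction V W}
    (h : IsWeakModule 𝒱.adj 𝒱.one 𝒱.omega D) (u v : V) :
    ∃ L : ℕ, ∀ w, diffOp^[L] (fun p q => 𝒱.oppMode D p u (𝒱.oppMode D q v w) -
      𝒱.oppMode D q v (𝒱.oppMode D p u w)) = 0 := by
  choose L hL using fun p q : ℤ × ℕ => 𝒱.exists_mode_eq_zero ((𝒱.adj.Lone ^ p.2) (𝒱.proj p.1 u))
    ((𝒱.adj.Lone ^ q.2) (𝒱.proj q.1 v))
  -- The largest of the finitely many orders of locality of the vectors L(1)^p u_(h) and L(1)^q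
  -- v_(h') serves for all terms.
  refine ⟨(𝒱.opp_support u).toFinset.sup fun p => (𝒱.opp_support v).toFinset.sup (L p),
    fun w => ?_⟩
  have h1 : (fun a b => 𝒱.oppMode D a u (𝒱.oppMode D b v w) -
      𝒱.oppMode D b v (𝒱.oppMode D a u w)) =
      ∑ p ∈ (𝒱.opp_support u).toFinset, ∑ q ∈ (𝒱.opp_support v).toFinset,
        (((-1 : ℂ) ^ p.1 * ((p.2.factorial : ℂ))⁻¹) * ((-1 : ℂ) ^ q.1 * ((q.2.factorial : ℂ))⁻¹)) •
        fun a b : ℤ => (fun r s =>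
          D.mode r ((𝒱.adj.Lone ^ p.2) (𝒱.proj p.1 u))
            (D.mode s ((𝒱.adj.Lone ^ q.2) (𝒱.proj q.1 v)) w) -
          D.mode s ((𝒱.adj.Lone ^ q.2) (𝒱.proj q.1 v))
            (D.mode r ((𝒱.adj.Lone ^ p.2) (𝒱.proj p.1 u)) w))
          (-p.2 - 2 + 2 * p.1 - a) (-q.2 - 2 + 2 * q.1 - b) := by
    funext a b
    simp only [oppMode_eq_sum, Finset.sum_apply, Pi.smul_apply, map_sum, map_smul, smul_sub,
      Finset.sum_sub_distrib, Finset.smul_sum, smul_smul]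
    congr 1
    · rw [Finset.sum_comm]
      refine Finset.sum_congr rfl fun p _ => Finset.sum_congr rfl fun q _ => ?_
      rw [mul_comm]
      congr 3 <;> ring_nf
    · refine Finset.sum_congr rfl fun p _ => Finset.sum_congr rfl fun q _ => ?_
      congr 3 <;> ring_nf
  rw [h1, iterate_diffOp_sum]
  refine Finset.sum_eq_zero fun p hp => ?_
  rw [iterate_diffOp_sum]
  refine Finset.sum_eq_zero fun q hq => ?_
  have hle : L p q ≤ (𝒱.opp_support u).toFinset.sup
      fun p => (𝒱.opp_support v).toFinset.sup (L p) :=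
    (Finset.le_sup (f := L p) hq).trans
      (Finset.le_sup (f := fun p => (𝒱.opp_support v).toFinset.sup (L p)) hp)
  rw [iterate_diffOp_smul, iterate_diffOp_reflect _ _
    (iterate_diffOp_mono hle (h.locality (hL p q) w)), smul_zero]

end VertexAlg

end Opposite

/-! ### Opposite vertex operators: 𝔰𝔩(2) relations, vacuum, conformal vector, involutivity -/

section Opposite

open Filter

variable {Γ : Type v} [AddCommGroup Γ] {A : AddSubgroup Γ} {V : Type*} [AddCommGroup V]
  [Module ℂ V] (𝒱 : VertexAlg A V) {W : Type*} [AddCommGroup W] [Module ℂ W]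

namespace VertexAlg

lemma mem_wt {h : ℤ} {v : V} : v ∈ 𝒱.wt h ↔ 𝒱.adj.Lzero v = (h : ℂ) • v :=
  Module.End.mem_eigenspace_iff

lemma Lneg_mem_wt {h : ℤ} {v : V} (hv : v ∈ 𝒱.wt h) : 𝒱.adj.Lneg v ∈ 𝒱.wt (h + 1) := by
  rw [mem_wt] at hv ⊢
  have := 𝒱.isWeak.bracket_zero_neg v
  rw [hv, map_smul, sub_eq_iff_eq_add] at this
  rw [this]
  push_cast
  module

lemma Lone_mem_wt {h : ℤ} {v : V} (hv : v ∈ 𝒱.wt h) : 𝒱.adj.Lone v ∈ 𝒱.wt (h - 1) := by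
  rw [mem_wt] at hv ⊢
  have := 𝒱.isWeak.bracket_zero_one v
  rw [hv, map_smul, sub_eq_iff_eq_add] at this
  rw [this]
  push_cast
  module

lemma Lone_pow_mem_wt {h : ℤ} {v : V} (hv : v ∈ 𝒱.wt h) (p : ℕ) :
    (𝒱.adj.Lone ^ p) v ∈ 𝒱.wt (h - p) := by
  induction p with
  | zero => simpa using hv
  | succ p ih =>
    rw [pow_succ', Module.End.mul_apply]
    convert 𝒱.Lone_mem_wt ih using 2
    push_cast
    ring

/-- Moving L(-1) past each factor L(1) contributes twice a weight; the weights h, h-1, …, h-p add up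
to the coefficient. -/
lemma Lone_pow_Lneg {h : ℤ} {v : V} (hv : v ∈ 𝒱.wt h) (p : ℕ) :
    (𝒱.adj.Lone ^ (p + 1)) (𝒱.adj.Lneg v) = 𝒱.adj.Lneg ((𝒱.adj.Lone ^ (p + 1)) v) +
      (((p : ℂ) + 1) * (2 * h - p)) • (𝒱.adj.Lone ^ p) v := by
  have hb : ∀ p : ℕ, 𝒱.adj.Lone (𝒱.adj.Lneg ((𝒱.adj.Lone ^ p) v)) =
      𝒱.adj.Lneg ((𝒱.adj.Lone ^ (p + 1)) v) + (2 * ((h : ℂ) - p)) • (𝒱.adj.Lone ^ p) v := by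
    intro p
    have h1 := 𝒱.isWeak.bracket_neg_one ((𝒱.adj.Lone ^ p) v)
    rw [𝒱.mem_wt.1 (𝒱.Lone_pow_mem_wt hv p), sub_eq_iff_eq_add] at h1
    rw [pow_succ', Module.End.mul_apply, h1]
    push_cast
    module
  induction p with
  | zero =>
    have := hb 0
    simp only [pow_zero, Module.End.one_apply, zero_add, pow_one, Nat.cast_zero] at this ⊢
    rw [this]
    module
  | succ p ih =>
    have h1 : 𝒱.adj.Lone ((𝒱.adj.Lone ^ p) v) = (𝒱.adj.Lone ^ (p + 1)) v := by
      rw [pow_succ', Module.End.mul_apply]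
    conv_lhs => rw [pow_succ', Module.End.mul_apply, ih, map_add, map_smul, hb, h1]
    push_cast
    module

variable {D : VertexAction V W}

lemma oppTerm_eq_zero {h n : ℤ} {v : V} {w : W} {p : ℕ} (hp : (𝒱.adj.Lone ^ p) v = 0) :
    𝒱.oppTerm D h n v w p = 0 := by
  simp [oppTerm, hp]

lemma factorial_inv_succ_mul (p : ℕ) :
    (((p + 1).factorial : ℕ) : ℂ)⁻¹ * ((p : ℂ) + 1) = ((p.factorial : ℕ) : ℂ)⁻¹ := by
  have h1 : ((p.factorial : ℕ) : ℂ) ≠ 0 := by exact_mod_cast p.factorial_ne_zero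
  have h2 : ((p : ℂ) + 1) ≠ 0 := by exact_mod_cast p.succ_ne_zero
  rw [Nat.factorial_succ]
  push_cast
  field_simp

lemma factorial_inv_smul_succ (p : ℕ) (w : W) :
    ((p.factorial : ℕ) : ℂ)⁻¹ • w = ((p : ℂ) + 1) • (((p + 1).factorial : ℕ) : ℂ)⁻¹ • w := by
  rw [smul_smul, mul_comm, factorial_inv_succ_mul]

/-- In generating functions, Yᵒ(L(-1)v, x) = d/dx Yᵒ(v, x). -/
lemma oppMode_Lneg (hD : IsWeakModule 𝒱.adj 𝒱.one 𝒱.omega D) (n : ℤ) (v : V) (w : W) :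
    𝒱.oppMode D n (𝒱.adj.Lneg v) w = (-(n : ℂ)) • 𝒱.oppMode D (n - 1) v w := by
  induction v using 𝒱.wt_induction with
  | add v v' h h' => simp only [map_add, LinearMap.add_apply, h, h', smul_add]
  | hp h v hv =>
    obtain ⟨K, hK⟩ := 𝒱.Lone_nilp v
    have hK' : ∀ p ≥ K + 1, (𝒱.adj.Lone ^ p) (𝒱.adj.Lneg v) = 0 := by
      intro p hp
      obtain ⟨q, rfl⟩ : ∃ q, p = q + 1 := ⟨p - 1, by omega⟩
      rw [𝒱.Lone_pow_Lneg hv, hK _ (by omega), hK _ (by omega)]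
      simp
    have t0 : 𝒱.oppTerm D (h + 1) n (𝒱.adj.Lneg v) w 0 =
        ((n : ℂ) + (0 : ℕ) - 2 * h) • 𝒱.oppTerm D h (n - 1) v w 0 := by
      simp only [oppTerm, pow_zero, Module.End.one_apply, hD.derivative]
      rw [show -n - ((0 : ℕ) : ℤ) - 2 + 2 * (h + 1) - 1 = -(n - 1) - ((0 : ℕ) : ℤ) - 2 + 2 * h by ring]
      push_cast
      module
    have t1 : ∀ p : ℕ, 𝒱.oppTerm D (h + 1) n (𝒱.adj.Lneg v) w (p + 1) =
        ((n : ℂ) + ((p + 1 : ℕ) : ℂ) - 2 * h) • 𝒱.oppTerm D h (n - 1) v w (p + 1) +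
          (2 * (h : ℂ) - p) • 𝒱.oppTerm D h (n - 1) v w p := by
      intro p
      simp only [oppTerm, 𝒱.Lone_pow_Lneg hv, map_add, LinearMap.add_apply, map_smul,
        LinearMap.smul_apply, hD.derivative]
      rw [show -n - ((p + 1 : ℕ) : ℤ) - 2 + 2 * (h + 1) - 1 =
          -(n - 1) - ((p + 1 : ℕ) : ℤ) - 2 + 2 * h by ring,
        show -n - ((p + 1 : ℕ) : ℤ) - 2 + 2 * (h + 1) = -(n - 1) - (p : ℤ) - 2 + 2 * h by
          push_cast; ring, factorial_inv_smul_succ p (D.mode _ ((𝒱.adj.Lone ^ p) v) w)]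
      push_cast
      module
    -- The p-th term of Yᵒ(v, x) occurs twice, with coefficients n + p - 2h and 2h - p, whose sum
    -- depends on neither p nor h.
    have hsum : ∑ p ∈ Finset.range K, ((n : ℂ) + (p : ℂ) - 2 * h) • 𝒱.oppTerm D h (n - 1) v w p +
        ∑ p ∈ Finset.range K, (2 * (h : ℂ) - p) • 𝒱.oppTerm D h (n - 1) v w p =
        (n : ℂ) • ∑ p ∈ Finset.range K, 𝒱.oppTerm D h (n - 1) v w p := by
      rw [← Finset.sum_add_distrib, Finset.smul_sum]
      refine Finset.sum_congr rfl fun p _ => ?_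
      module
    rw [𝒱.oppMode_of_mem D n (𝒱.Lneg_mem_wt hv) w hK', 𝒱.oppMode_of_mem D (n - 1) hv w hK,
      Finset.sum_range_succ', t0, Finset.sum_congr rfl fun p _ => t1 p, Finset.sum_add_distrib,
      add_right_comm, ← Finset.sum_range_succ' (fun p : ℕ => ((n : ℂ) + (p : ℂ) - 2 * h) •
        𝒱.oppTerm D h (n - 1) v w p), Finset.sum_range_succ, 𝒱.oppTerm_eq_zero (hK K le_rfl),
      smul_zero, add_zero, hsum, zpow_add_one₀ (by norm_num)]
    module

/-- Passing to opposite operators exchanges L(1) with L(-1) and changes signs: [L(1), Yᵒ(v,x)] =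
-Yᵒ(L(-1)v, x). The next two lemmas are the analogues for L(0) and L(-1). -/
lemma comm_Lone_oppMode (hD : IsWeakModule 𝒱.adj 𝒱.one 𝒱.omega D) (n : ℤ) (v : V) (w : W) :
    D.Lone (𝒱.oppMode D n v w) - 𝒱.oppMode D n v (D.Lone w) =
      (n : ℂ) • 𝒱.oppMode D (n - 1) v w := by
  induction v using 𝒱.wt_induction with
  | add v v' h h' => 
    simp only [map_add, LinearMap.add_apply, smul_add, ← h, ← h']
    abel
  | hp h v hv =>
    obtain ⟨K, hK⟩ := 𝒱.Lone_nilp v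
    have t : ∀ p : ℕ, D.Lone (𝒱.oppTerm D h n v w p) - 𝒱.oppTerm D h n v (D.Lone w) p =
        ((p + 1 : ℕ) : ℂ) • 𝒱.oppTerm D h (n - 1) v w (p + 1) +
          ((n : ℂ) - p) • 𝒱.oppTerm D h (n - 1) v w p := by
      intro p
      simp only [oppTerm, map_smul, ← smul_sub, hD.comm_one, hD.derivative,
        𝒱.mem_wt.1 (𝒱.Lone_pow_mem_wt hv p), LinearMap.smul_apply]
      rw [← Module.End.mul_apply, ← pow_succ',
        show -n - (p : ℤ) - 2 + 2 * h + 2 - 1 = -(n - 1) - (p : ℤ) - 2 + 2 * h by ring,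
        show -n - (p : ℤ) - 2 + 2 * h + 1 = -(n - 1) - (p : ℤ) - 2 + 2 * h by ring,
        show -n - (p : ℤ) - 2 + 2 * h = -(n - 1) - ((p + 1 : ℕ) : ℤ) - 2 + 2 * h by
          push_cast; ring, smul_add, smul_add,
        factorial_inv_smul_succ p (D.mode _ ((𝒱.adj.Lone ^ (p + 1)) v) w)]
      push_cast
      module
    rw [𝒱.oppMode_of_mem D n hv _ hK, 𝒱.oppMode_of_mem D n hv _ hK,
      𝒱.oppMode_of_mem D (n - 1) hv w hK, map_smul, ← smul_sub, map_sum, ← Finset.sum_sub_distrib,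
      Finset.sum_congr rfl fun p _ => t p, Finset.sum_add_distrib, smul_comm (n : ℂ)]
    congr 1
    -- Reindexing p + 1 to p costs nothing: the term p = 0 has the factor p, and the term p = K
    -- contains L(1)^K v = 0.
    have h1 := Finset.sum_range_succ' (fun p : ℕ => (p : ℂ) • 𝒱.oppTerm D h (n - 1) v w p) K
    rw [Finset.sum_range_succ, 𝒱.oppTerm_eq_zero (hK K le_rfl), smul_zero, add_zero, Nat.cast_zero,
      zero_smul, add_zero] at h1
    rw [← h1, ← Finset.sum_add_distrib, Finset.smul_sum]
    refine Finset.sum_congr rfl fun p _ => ?_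
    module

lemma comm_Lzero_oppMode (hD : IsWeakModule 𝒱.adj 𝒱.one 𝒱.omega D) (n : ℤ) (v : V) (w : W) :
    D.Lzero (𝒱.oppMode D n v w) - 𝒱.oppMode D n v (D.Lzero w) =
      ((n : ℂ) + 1) • 𝒱.oppMode D n v w - 𝒱.oppMode D n (𝒱.adj.Lzero v) w := by
  induction v using 𝒱.wt_induction with
  | add v v' h h' => 
    rw [← sub_eq_zero] at h h' ⊢
    simp only [map_add, LinearMap.add_apply, smul_add] at h h' ⊢
    rw [← add_zero (0 : W)]
    nth_rw 1 [← h]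
    rw [← h']
    abel
  | hp h v hv =>
    obtain ⟨K, hK⟩ := 𝒱.Lone_nilp v
    have t : ∀ p : ℕ, D.Lzero (𝒱.oppTerm D h n v w p) - 𝒱.oppTerm D h n v (D.Lzero w) p =
        ((n : ℂ) + 1 - h) • 𝒱.oppTerm D h n v w p := by
      intro p
      simp only [oppTerm, map_smul, ← smul_sub, hD.comm_zero, hD.derivative,
        𝒱.mem_wt.1 (𝒱.Lone_pow_mem_wt hv p), LinearMap.smul_apply, add_sub_cancel_right]
      push_cast
      module
    rw [𝒱.mem_wt.1 hv, map_smul, LinearMap.smul_apply, ← sub_smul, 𝒱.oppMode_of_mem D n hv _ hK,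
      𝒱.oppMode_of_mem D n hv _ hK, map_smul, ← smul_sub, map_sum, ← Finset.sum_sub_distrib,
      Finset.sum_congr rfl fun p _ => t p, ← Finset.smul_sum, smul_comm]

lemma comm_Lneg_oppMode (hD : IsWeakModule 𝒱.adj 𝒱.one 𝒱.omega D) (n : ℤ) (v : V) (w : W) :
    D.Lneg (𝒱.oppMode D n v w) - 𝒱.oppMode D n v (D.Lneg w) =
      ((n : ℂ) + 2) • 𝒱.oppMode D (n + 1) v w - (2 : ℂ) • 𝒱.oppMode D (n + 1) (𝒱.adj.Lzero v) w -
        𝒱.oppMode D n (𝒱.adj.Lone v) w := by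
  induction v using 𝒱.wt_induction with
  | add v v' h h' => 
    rw [← sub_eq_zero] at h h' ⊢
    simp only [map_add, LinearMap.add_apply, smul_add] at h h' ⊢
    rw [← add_zero (0 : W)]
    nth_rw 1 [← h]
    rw [← h']
    abel
  | hp h v hv =>
    obtain ⟨K, hK⟩ := 𝒱.Lone_nilp v
    have t : ∀ p : ℕ, D.Lneg (𝒱.oppTerm D h n v w p) - 𝒱.oppTerm D h n v (D.Lneg w) p =
        ((n : ℂ) + p + 2 - 2 * h) • 𝒱.oppTerm D h (n + 1) v w p := by
      intro p
      simp only [oppTerm, map_smul, ← smul_sub, hD.comm_neg, hD.derivative]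
      rw [show -n - (p : ℤ) - 2 + 2 * h - 1 = -(n + 1) - (p : ℤ) - 2 + 2 * h by ring]
      push_cast
      module
    -- As L(1)v has weight h - 1, its p-th term is a multiple of the (p+1)-st term of v.
    have t' : ∀ p : ℕ, 𝒱.oppTerm D (h - 1) n (𝒱.adj.Lone v) w p =
        ((p + 1 : ℕ) : ℂ) • 𝒱.oppTerm D h (n + 1) v w (p + 1) := by
      intro p
      simp only [oppTerm]
      rw [← Module.End.mul_apply, ← pow_succ, factorial_inv_smul_succ,
        show -n - (p : ℤ) - 2 + 2 * (h - 1) = -(n + 1) - ((p + 1 : ℕ) : ℤ) - 2 + 2 * h by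
          push_cast; ring]
      push_cast
      rfl
    rw [𝒱.mem_wt.1 hv, map_smul, LinearMap.smul_apply, 𝒱.oppMode_of_mem D n hv _ hK,
      𝒱.oppMode_of_mem D n hv _ hK, 𝒱.oppMode_of_mem D (n + 1) hv _ hK,
      𝒱.oppMode_of_mem D n (𝒱.Lone_mem_wt hv) w (K := K) fun p hp => by
        rw [← Module.End.mul_apply, ← pow_succ, hK _ (by omega)],
      map_smul, ← smul_sub, map_sum, ← Finset.sum_sub_distrib,
      Finset.sum_congr rfl fun p _ => t p, Finset.sum_congr rfl fun p _ => t' p,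
      zpow_sub_one₀ (by norm_num)]
    have h1 := Finset.sum_range_succ' (fun p : ℕ => (p : ℂ) • 𝒱.oppTerm D h (n + 1) v w p) K
    rw [Finset.sum_range_succ, 𝒱.oppTerm_eq_zero (hK K le_rfl), smul_zero, add_zero, Nat.cast_zero,
      zero_smul, add_zero] at h1
    have h2 : ∑ p ∈ Finset.range K, ((n : ℂ) + p + 2 - 2 * h) • 𝒱.oppTerm D h (n + 1) v w p =
        ((n : ℂ) + 2 - 2 * h) • ∑ p ∈ Finset.range K, 𝒱.oppTerm D h (n + 1) v w p +
        ∑ p ∈ Finset.range K, (p : ℂ) • 𝒱.oppTerm D h (n + 1) v w p := by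
      rw [Finset.smul_sum, ← Finset.sum_add_distrib]
      refine Finset.sum_congr rfl fun p _ => ?_
      module
    rw [← h1, h2]
    have h3 : ((-1 : ℂ))⁻¹ = -1 := by norm_num
    rw [h3]
    module

lemma Lneg_one : 𝒱.adj.Lneg 𝒱.one = 0 := by
  have h1 := 𝒱.isWeak.derivative (-1) 𝒱.one 𝒱.one
  rw [𝒱.isWeak.vacuum] at h1
  rw [← (𝒱.creation (𝒱.adj.Lneg 𝒱.one)).1, h1]
  simp

lemma one_mem_wt : 𝒱.one ∈ 𝒱.wt 0 := by
  have := 𝒱.one_mem.2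
  rwa [wt, Int.cast_zero]

/-- Since Y(1, x) is the identity, its commutator with L(1) vanishes; the creation property then
reads off L(1)1. -/
lemma Lone_one : 𝒱.adj.Lone 𝒱.one = 0 := by
  have h1 := 𝒱.isWeak.comm_one (-1) 𝒱.one 𝒱.one
  have h0 := 𝒱.mem_wt.1 𝒱.one_mem_wt
  rw [Int.cast_zero, zero_smul] at h0
  simpa [h0, 𝒱.Lneg_one, (𝒱.creation _).1, 𝒱.isWeak.vacuum] using h1.symm

lemma oppMode_of_Lone_eq_zero (D : VertexAction V W) (n : ℤ) {h : ℤ} {v : V} (hv : v ∈ 𝒱.wt h)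
    (h1 : 𝒱.adj.Lone v = 0) (w : W) :
    𝒱.oppMode D n v w = (-1 : ℂ) ^ h • D.mode (-n - 2 + 2 * h) v w := by
  rw [𝒱.oppMode_of_mem D n hv w (K := 1) fun p hp => by
    obtain ⟨q, rfl⟩ : ∃ q, p = q + 1 := ⟨p - 1, by omega⟩
    rw [pow_succ, Module.End.mul_apply, h1, map_zero]]
  simp [oppTerm]

lemma oppMode_one (hD : IsWeakModule 𝒱.adj 𝒱.one 𝒱.omega D) (n : ℤ) (w : W) :
    𝒱.oppMode D n 𝒱.one w = if n = -1 then w else 0 := by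
  rw [𝒱.oppMode_of_Lone_eq_zero D n 𝒱.one_mem_wt 𝒱.Lone_one, hD.vacuum]
  simp only [zpow_zero, one_smul]
  congr 1
  rw [eq_iff_iff]
  omega

/-- The Virasoro relation for L(1) and L(-2), applied to the vacuum: L(-2)1 = ω, while L(1) and
L(-1) annihilate 1, and there is no central term. -/
lemma Lone_omega {ω : V} (hω : ω ∈ 𝒱.omega) : 𝒱.adj.Lone ω = 0 := by
  rw [(𝒱.isWeak.conformal ω hω ω).2.2]
  obtain ⟨c, hc⟩ := 𝒱.virasoro ω hω
  have h1 := hc 1 (-2) 𝒱.one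
  simp only [Int.reduceAdd, Int.reduceNeg, (𝒱.creation ω).1] at h1
  rw [(𝒱.creation ω).2 2 (by norm_num), (𝒱.creation ω).2 0 le_rfl] at h1
  simpa using h1

/-- In terms of L(n) = ω_{n+1}, passing to the opposite replaces L(n) by L(-n), as ω has weight 2
and is annihilated by L(1). -/
lemma oppMode_omega (D : VertexAction V W) {ω : V} (hω : ω ∈ 𝒱.omega) (n : ℤ) (w : W) :
    𝒱.oppMode D n ω w = D.mode (2 - n) ω w := by
  have h2 : ω ∈ 𝒱.wt 2 := by
    have := (𝒱.omega_mem ω hω).2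
    rwa [wt, Int.cast_ofNat]
  rw [𝒱.oppMode_of_Lone_eq_zero D n h2 (𝒱.Lone_omega hω)]
  norm_num
  congr 3
  ring

/-- The opposite of the opposite vertex operator is the vertex operator. -/
lemma sum_oppMode_Lone_pow (D : VertexAction V W) (n : ℤ) {h : ℤ} {v : V} (hv : v ∈ 𝒱.wt h) (w : W)
    {K : ℕ} (hK : ∀ p ≥ K, (𝒱.adj.Lone ^ p) v = 0) :
    (-1 : ℂ) ^ h • ∑ p ∈ Finset.range K, ((p.factorial : ℕ) : ℂ)⁻¹ •
      𝒱.oppMode D (-n - p - 2 + 2 * h) ((𝒱.adj.Lone ^ p) v) w = D.mode n v w := by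
  have h1 : ∀ p ∈ Finset.range K, ((p.factorial : ℕ) : ℂ)⁻¹ •
      𝒱.oppMode D (-n - p - 2 + 2 * h) ((𝒱.adj.Lone ^ p) v) w = (-1 : ℂ) ^ h •
      ∑ q ∈ Finset.range (K - p), (((-1 : ℂ) ^ p * ((p.factorial : ℕ) : ℂ)⁻¹ *
        ((q.factorial : ℕ) : ℂ)⁻¹)) • D.mode (n - (p + q : ℕ)) ((𝒱.adj.Lone ^ (p + q)) v) w := by
    intro p hp
    rw [𝒱.oppMode_of_mem D _ (𝒱.Lone_pow_mem_wt hv p) w (K := K - p) fun q hq => by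
      rw [← Module.End.mul_apply, ← pow_add, hK _ (by omega)]]
    have h2 : ((-1 : ℂ)) ^ (h - (p : ℤ)) = (-1) ^ h * (-1) ^ p := by
      rw [zpow_sub₀ (by norm_num), zpow_natCast, div_eq_mul_inv, ← inv_pow]
      norm_num
    rw [h2, mul_smul, smul_comm, Finset.smul_sum, Finset.smul_sum]
    congr 1
    refine Finset.sum_congr rfl fun q _ => ?_
    simp only [oppTerm]
    rw [← Module.End.mul_apply, ← pow_add, add_comm q p, smul_smul, smul_smul,
      show -(-n - (p : ℤ) - 2 + 2 * h) - (q : ℤ) - 2 + 2 * (h - p) = n - ((p + q : ℕ) : ℤ) by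
        push_cast; ring]
    congr 1
    ring
  rw [Finset.sum_congr rfl h1, ← Finset.smul_sum, smul_smul, ← mul_zpow,
    ← Finset.sum_range_diag_flip K fun p q => (((-1 : ℂ) ^ p * ((p.factorial : ℕ) : ℂ)⁻¹ *
        ((q.factorial : ℕ) : ℂ)⁻¹)) • D.mode (n - (p + q : ℕ)) ((𝒱.adj.Lone ^ (p + q)) v) w]
  -- The terms with p + q = r add up to (1-1)^r / r! times a single mode, so only r = 0 survives.
  have h3 : ∀ r : ℕ, ∑ p ∈ Finset.range (r + 1), (((-1 : ℂ) ^ p * ((p.factorial : ℕ) : ℂ)⁻¹ *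
        (((r - p).factorial : ℕ) : ℂ)⁻¹)) • D.mode (n - (p + (r - p) : ℕ))
        ((𝒱.adj.Lone ^ (p + (r - p))) v) w = if r = 0 then D.mode n v w else 0 := by
    intro r
    have h4 : ∀ p ∈ Finset.range (r + 1), (((-1 : ℂ) ^ p * ((p.factorial : ℕ) : ℂ)⁻¹ *
        (((r - p).factorial : ℕ) : ℂ)⁻¹)) • D.mode (n - (p + (r - p) : ℕ))
        ((𝒱.adj.Lone ^ (p + (r - p))) v) w = (((-1 : ℂ) ^ p * (r.choose p : ℂ))) •
        ((r.factorial : ℕ) : ℂ)⁻¹ • D.mode (n - r) ((𝒱.adj.Lone ^ r) v) w := by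
      intro p hp
      have hp' : p ≤ r := Nat.lt_succ_iff.1 (Finset.mem_range.1 hp)
      rw [Nat.add_sub_cancel' hp', smul_smul, Nat.cast_choose ℂ hp']
      congr 1
      have : ((r.factorial : ℕ) : ℂ) ≠ 0 := by exact_mod_cast r.factorial_ne_zero
      field_simp
    rw [Finset.sum_congr rfl h4, ← Finset.sum_smul]
    have h5 := add_pow (-1 : ℂ) 1 r
    simp only [one_pow, mul_one] at h5
    rw [← h5, neg_add_cancel]
    split_ifs with hr
    · subst hr
      simp
    · rw [zero_pow hr, zero_smul]
  rw [Finset.sum_congr rfl fun r _ => h3 r, Finset.sum_ite_eq' (Finset.range K) 0]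
  norm_num
  -- An empty range is possible only for v = 0.
  intro hK0
  have := hK 0 (by omega)
  rw [pow_zero, Module.End.one_apply] at this
  rw [this]
  simp

end VertexAlg

end Opposite

open Filter

variable {Γ : Type v} [AddCommGroup Γ] {A : AddSubgroup Γ} {V : Type w} [AddCommGroup V]
  [Module ℂ V] {𝒱 : VertexAlg A V}

/-! ### The actions on W₁ and W₂, expanded at s = ∞ and s = 0 -/

section Expansions

variable (z : ℂ) (W : GenMod.{u} 𝒱)

/-- The action of `v ⊗ (s-z)^a s^n` on a module, expanded at `s = 0`. -/
noncomputable abbrev zeroExp : ℤ → ℤ → V →ₗ[ℂ] W.carrier →ₗ[ℂ] W.carrier :=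
  VertexAlg.tauPlus W.act.toVertexAction W.isGenModule.isWeak.truncation (-z)

/-- The opposite action of `v ⊗ (s-z)^a s^n` on a module, expanded at `s = ∞`. -/
noncomputable abbrev inftyExp : ℤ → ℤ → V →ₗ[ℂ] W.carrier →ₗ[ℂ] W.carrier :=
  𝒱.tauOpp W.act.toVertexAction W.isGenModule.isWeak.truncation (-z)

variable {z}

lemma zeroExp_isExpansion (hz : z ≠ 0) : IsExpansion atTop (-z) (zeroExp z W) :=
  VertexAlg.tauPlus_isExpansion _ _ (neg_ne_zero.2 hz)

lemma inftyExp_isExpansion (hz : z ≠ 0) : IsExpansion atBot (-z) (inftyExp z W) :=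
  𝒱.tauOpp_isExpansion _ _ (neg_ne_zero.2 hz)

variable (z)

lemma zeroExp_zero (n : ℤ) (v : V) (w : W.carrier) :
    zeroExp z W 0 n v w = W.act.mode n v w := VertexAlg.tauPlus_zero _ _ _ _ _ _

lemma inftyExp_zero (n : ℤ) (v : V) (w : W.carrier) :
    inftyExp z W 0 n v w = 𝒱.oppMode W.act.toVertexAction n v w := 𝒱.tauOpp_zero _ _ _ _ _ _

/-- `v ⊗ f` acts as zero on `w` when `f` vanishes to a high order at `0`. -/
lemma exists_zeroExp_eq_zero (v : V) (w : W.carrier) :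
    ∃ N : ℤ, ∀ a, ∀ n ≥ N, zeroExp z W a n v w = 0 := by
  obtain ⟨N, hN⟩ := W.isGenModule.isWeak.truncation v w
  exact ⟨N, fun a n hn => VertexAlg.tauPlus_eq_zero _ _ a fun k hk => hN k (le_trans hn hk)⟩

/-- `v ⊗ f` acts as zero on `w` when `f` vanishes to a high order at `∞`. -/
lemma exists_inftyExp_eq_zero (v : V) (w : W.carrier) :
    ∃ N : ℤ, ∀ a n, a + n ≤ N → inftyExp z W a n v w = 0 := by
  obtain ⟨N, hN⟩ := 𝒱.oppMode_truncation W.isGenModule.isWeak.truncation v w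
  exact ⟨N, fun a n hn => 𝒱.tauOpp_eq_zero _ _ fun k hk => hN k (le_trans hk hn)⟩

variable {z}

lemma zeroExp_comm_neg (hz : z ≠ 0) (a n : ℤ) (v : V) (w : W.carrier) :
    W.act.Lneg (zeroExp z W a n v w) - zeroExp z W a n v (W.act.Lneg w) =
      zeroExp z W a n (𝒱.adj.Lneg v) w := by
  simpa using (zeroExp_isExpansion W hz).comm W.act.Lneg 𝒱.adj.Lneg 0 0 (fun n v w => by
    simp [zeroExp_zero, W.isGenModule.isWeak.comm_neg]) a n v w

lemma zeroExp_comm_zero (hz : z ≠ 0) (a n : ℤ) (v : V) (w : W.carrier) :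
    W.act.Lzero (zeroExp z W a n v w) - zeroExp z W a n v (W.act.Lzero w) =
      zeroExp z W a n (𝒱.adj.Lzero v) w + zeroExp z W a (n + 1) (𝒱.adj.Lneg v) w := by
  simpa using (zeroExp_isExpansion W hz).comm W.act.Lzero 𝒱.adj.Lzero 𝒱.adj.Lneg 0 (fun n v w => by
    simp [zeroExp_zero, W.isGenModule.isWeak.comm_zero]) a n v w

lemma zeroExp_comm_one (hz : z ≠ 0) (a n : ℤ) (v : V) (w : W.carrier) :
    W.act.Lone (zeroExp z W a n v w) - zeroExp z W a n v (W.act.Lone w) =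
      zeroExp z W a n (𝒱.adj.Lone v) w + (2 : ℂ) • zeroExp z W a (n + 1) (𝒱.adj.Lzero v) w +
        zeroExp z W a (n + 2) (𝒱.adj.Lneg v) w := by
  simpa using (zeroExp_isExpansion W hz).comm W.act.Lone 𝒱.adj.Lone ((2 : ℂ) • 𝒱.adj.Lzero)
    𝒱.adj.Lneg (fun n v w => by
    simp [zeroExp_zero, W.isGenModule.isWeak.comm_one]) a n v w

/-- Factors depending on n are absorbed into L(-1)v. The relation then has constant coefficients, as
`IsExpansion.comm` requires. -/
lemma inftyExp_comm_one (hz : z ≠ 0) (a n : ℤ) (v : V) (w : W.carrier) :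
    W.act.Lone (inftyExp z W a n v w) - inftyExp z W a n v (W.act.Lone w) =
      -inftyExp z W a n (𝒱.adj.Lneg v) w := by
  simpa using (inftyExp_isExpansion W hz).comm W.act.Lone (-𝒱.adj.Lneg) 0 0 (fun n v w => by
    simp [inftyExp_zero, 𝒱.comm_Lone_oppMode W.isGenModule.isWeak,
      𝒱.oppMode_Lneg W.isGenModule.isWeak]) a n v w

lemma inftyExp_comm_zero (hz : z ≠ 0) (a n : ℤ) (v : V) (w : W.carrier) :
    W.act.Lzero (inftyExp z W a n v w) - inftyExp z W a n v (W.act.Lzero w) =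
      -(inftyExp z W a n (𝒱.adj.Lzero v) w + inftyExp z W a (n + 1) (𝒱.adj.Lneg v) w) := by
  rw [neg_add]
  simpa using (inftyExp_isExpansion W hz).comm W.act.Lzero (-𝒱.adj.Lzero) (-𝒱.adj.Lneg) 0
    (fun n v w => by
      simp only [inftyExp_zero, 𝒱.comm_Lzero_oppMode W.isGenModule.isWeak, LinearMap.neg_apply,
        LinearMap.zero_apply, map_neg, map_zero, 𝒱.oppMode_Lneg W.isGenModule.isWeak,
        add_sub_cancel_right]
      push_cast
      module) a n v w

lemma inftyExp_comm_neg (hz : z ≠ 0) (a n : ℤ) (v : V) (w : W.carrier) :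
    W.act.Lneg (inftyExp z W a n v w) - inftyExp z W a n v (W.act.Lneg w) =
      -(inftyExp z W a n (𝒱.adj.Lone v) w + (2 : ℂ) • inftyExp z W a (n + 1) (𝒱.adj.Lzero v) w +
        inftyExp z W a (n + 2) (𝒱.adj.Lneg v) w) := by
  rw [neg_add, neg_add, ← neg_smul]
  simpa using (inftyExp_isExpansion W hz).comm W.act.Lneg (-𝒱.adj.Lone) ((-2 : ℂ) • 𝒱.adj.Lzero)
    (-𝒱.adj.Lneg) (fun n v w => by
      simp only [inftyExp_zero, 𝒱.comm_Lneg_oppMode W.isGenModule.isWeak, LinearMap.neg_apply,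
        LinearMap.smul_apply, map_neg, map_smul, 𝒱.oppMode_Lneg W.isGenModule.isWeak]
      rw [show n + 2 - 1 = n + 1 by ring]
      push_cast
      module) a n v w

end Expansions

/-! ### Identities of the Q(z)-action on the whole of (W₁ ⊗ W₂)^* -/

section Dual

variable {z : ℂ} {W₁ W₂ : GenMod.{u} 𝒱}

lemma tdual_ext {l l' : TDual W₁ W₂} (h : ∀ w₁ w₂, l (w₁ ⊗ₜ w₂) = l' (w₁ ⊗ₜ w₂)) : l = l' :=
  TensorProduct.ext' h

/-- The indices change places: m is the exponent of s and n that of t = s - z, while the expansions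
on modules list the exponent of t first. -/
lemma tauQ_tmul (m n : ℤ) (v : V) (l : TDual W₁ W₂) (w₁ : W₁.carrier) (w₂ : W₂.carrier) :
    tauQ z W₁ W₂ m n v l (w₁ ⊗ₜ w₂) =
      l (inftyExp z W₁ n m v w₁ ⊗ₜ w₂) - l (w₁ ⊗ₜ zeroExp z W₂ n m v w₂) := by
  simp [tauQ]

lemma dualDiff_tmul (S : End ℂ W₁.carrier) (T : End ℂ W₂.carrier) (l : TDual W₁ W₂)
    (w₁ : W₁.carrier) (w₂ : W₂.carrier) :
    dualDiff W₁ W₂ S T l (w₁ ⊗ₜ w₂) = l (S w₁ ⊗ₜ w₂) - l (w₁ ⊗ₜ T w₂) := by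
  simp [dualDiff]

lemma tauQ_succ (hz : z ≠ 0) (m n : ℤ) (v : V) (l : TDual W₁ W₂) :
    tauQ z W₁ W₂ (m + 1) n v l = tauQ z W₁ W₂ m (n + 1) v l + z • tauQ z W₁ W₂ m n v l := by
  refine tdual_ext fun w₁ w₂ => ?_
  rw [LinearMap.add_apply, LinearMap.smul_apply, tauQ_tmul, tauQ_tmul, tauQ_tmul,
    (inftyExp_isExpansion W₁ hz).succ, (zeroExp_isExpansion W₂ hz).succ, TensorProduct.add_tmul,
    TensorProduct.tmul_add, ← TensorProduct.smul_tmul', TensorProduct.tmul_smul, map_add, map_add,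
    map_smul, map_smul]
  module

/-- Both operators are transposes of differences S ⊗ 1 - 1 ⊗ T. The mixed terms cancel in the
commutator, and only the commutators on the two factors survive, with opposite orders. -/
lemma dualDiff_comm_tauQ {S : End ℂ W₁.carrier} {T : End ℂ W₂.carrier} {m n : ℤ} {v : V}
    {l μ : TDual W₁ W₂}
    (h : ∀ w₁ w₂, l ((inftyExp z W₁ n m v (S w₁) - S (inftyExp z W₁ n m v w₁)) ⊗ₜ w₂) -
      l (w₁ ⊗ₜ (T (zeroExp z W₂ n m v w₂) - zeroExp z W₂ n m v (T w₂))) = μ (w₁ ⊗ₜ w₂)) :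
    dualDiff W₁ W₂ S T (tauQ z W₁ W₂ m n v l) - tauQ z W₁ W₂ m n v (dualDiff W₁ W₂ S T l) = μ := by
  refine tdual_ext fun w₁ w₂ => ?_
  rw [← h, LinearMap.sub_apply, dualDiff_tmul, tauQ_tmul, tauQ_tmul, tauQ_tmul, dualDiff_tmul,
    dualDiff_tmul, TensorProduct.sub_tmul, TensorProduct.tmul_sub, map_sub, map_sub]
  ring

lemma dual_comm_neg (hz : z ≠ 0) (m n : ℤ) (v : V) (l : TDual W₁ W₂) :
    (dualAct z W₁ W₂).Lneg (tauQ z W₁ W₂ m n v l) - tauQ z W₁ W₂ m n v ((dualAct z W₁ W₂).Lneg l) =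
      tauQ z W₁ W₂ m n (𝒱.adj.Lneg v) l := by
  refine dualDiff_comm_tauQ fun w₁ w₂ => ?_
  rw [← neg_sub (W₁.act.Lone _), inftyExp_comm_one W₁ hz, zeroExp_comm_neg W₂ hz, neg_neg,
    tauQ_tmul]

/-- The corrections by z times L(1) on W₁ and z times L(-1) on W₂ replace the factor s in the
commutator by s - z = t. -/
lemma dual_comm_zero (hz : z ≠ 0) (m n : ℤ) (v : V) (l : TDual W₁ W₂) :
    (dualAct z W₁ W₂).Lzero (tauQ z W₁ W₂ m n v l) -
      tauQ z W₁ W₂ m n v ((dualAct z W₁ W₂).Lzero l) =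
      tauQ z W₁ W₂ m n (𝒱.adj.Lzero v) l + tauQ z W₁ W₂ m (n + 1) (𝒱.adj.Lneg v) l := by
  refine dualDiff_comm_tauQ fun w₁ w₂ => ?_
  have h1 : inftyExp z W₁ n m v ((W₁.act.Lzero - z • W₁.act.Lone) w₁) -
      (W₁.act.Lzero - z • W₁.act.Lone) (inftyExp z W₁ n m v w₁) =
      inftyExp z W₁ n m (𝒱.adj.Lzero v) w₁ + inftyExp z W₁ (n + 1) m (𝒱.adj.Lneg v) w₁ := by
    have e1 := inftyExp_comm_zero W₁ hz n m v w₁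
    have e2 := inftyExp_comm_one W₁ hz n m v w₁
    rw [sub_eq_iff_eq_add] at e1 e2
    simp only [LinearMap.sub_apply, LinearMap.smul_apply, map_sub, map_smul, e1, e2,
      (inftyExp_isExpansion W₁ hz).succ]
    module
  have h2 : (W₂.act.Lzero - z • W₂.act.Lneg) (zeroExp z W₂ n m v w₂) -
      zeroExp z W₂ n m v ((W₂.act.Lzero - z • W₂.act.Lneg) w₂) =
      zeroExp z W₂ n m (𝒱.adj.Lzero v) w₂ + zeroExp z W₂ (n + 1) m (𝒱.adj.Lneg v) w₂ := by
    have e1 := zeroExp_comm_zero W₂ hz n m v w₂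
    have e2 := zeroExp_comm_neg W₂ hz n m v w₂
    rw [sub_eq_iff_eq_add] at e1 e2
    simp only [LinearMap.sub_apply, LinearMap.smul_apply, map_sub, map_smul, e1, e2,
      (zeroExp_isExpansion W₂ hz).succ]
    module
  rw [h1, h2, LinearMap.add_apply, tauQ_tmul, tauQ_tmul, TensorProduct.add_tmul,
    TensorProduct.tmul_add, map_add, map_add]
  ring

/-- As for L(0), with s² - 2zs + z² = t² in the L(-1) term and s - z = t in the L(0) term. -/
lemma dual_comm_one (hz : z ≠ 0) (m n : ℤ) (v : V) (l : TDual W₁ W₂) :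
    (dualAct z W₁ W₂).Lone (tauQ z W₁ W₂ m n v l) -
      tauQ z W₁ W₂ m n v ((dualAct z W₁ W₂).Lone l) =
      tauQ z W₁ W₂ m n (𝒱.adj.Lone v) l + (2 : ℂ) • tauQ z W₁ W₂ m (n + 1) (𝒱.adj.Lzero v) l +
        tauQ z W₁ W₂ m (n + 2) (𝒱.adj.Lneg v) l := by
  refine dualDiff_comm_tauQ fun w₁ w₂ => ?_
  have h1 : inftyExp z W₁ n m v
        ((W₁.act.Lneg - (2 * z) • W₁.act.Lzero + z ^ 2 • W₁.act.Lone) w₁) -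
      (W₁.act.Lneg - (2 * z) • W₁.act.Lzero + z ^ 2 • W₁.act.Lone) (inftyExp z W₁ n m v w₁) =
      inftyExp z W₁ n m (𝒱.adj.Lone v) w₁ +
        (2 : ℂ) • inftyExp z W₁ (n + 1) m (𝒱.adj.Lzero v) w₁ +
        inftyExp z W₁ (n + 2) m (𝒱.adj.Lneg v) w₁ := by
    have e0 := inftyExp_comm_neg W₁ hz n m v w₁
    have e1 := inftyExp_comm_zero W₁ hz n m v w₁
    have e2 := inftyExp_comm_one W₁ hz n m v w₁
    rw [sub_eq_iff_eq_add] at e0 e1 e2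
    rw [show n + 2 = n + 1 + 1 by ring]
    simp only [LinearMap.sub_apply, LinearMap.add_apply, LinearMap.smul_apply, map_sub, map_add,
      map_smul, e0, e1, e2, (inftyExp_isExpansion W₁ hz).succ]
    rw [show m + 2 = m + 1 + 1 by ring]
    module
  have h2 : (W₂.act.Lone - (2 * z) • W₂.act.Lzero + z ^ 2 • W₂.act.Lneg) (zeroExp z W₂ n m v w₂) -
      zeroExp z W₂ n m v ((W₂.act.Lone - (2 * z) • W₂.act.Lzero + z ^ 2 • W₂.act.Lneg) w₂) =
      zeroExp z W₂ n m (𝒱.adj.Lone v) w₂ +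
        (2 : ℂ) • zeroExp z W₂ (n + 1) m (𝒱.adj.Lzero v) w₂ +
        zeroExp z W₂ (n + 2) m (𝒱.adj.Lneg v) w₂ := by
    have e0 := zeroExp_comm_one W₂ hz n m v w₂
    have e1 := zeroExp_comm_zero W₂ hz n m v w₂
    have e2 := zeroExp_comm_neg W₂ hz n m v w₂
    rw [sub_eq_iff_eq_add] at e0 e1 e2
    rw [show n + 2 = n + 1 + 1 by ring]
    simp only [LinearMap.sub_apply, LinearMap.add_apply, LinearMap.smul_apply, map_sub, map_add,
      map_smul, e0, e1, e2, (zeroExp_isExpansion W₂ hz).succ]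
    rw [show m + 2 = m + 1 + 1 by ring]
    module
  rw [h1, h2, LinearMap.add_apply, LinearMap.add_apply, LinearMap.smul_apply, tauQ_tmul, tauQ_tmul,
    tauQ_tmul, TensorProduct.add_tmul, TensorProduct.add_tmul, TensorProduct.tmul_add,
    TensorProduct.tmul_add, map_add, map_add, map_add, map_add, ← TensorProduct.smul_tmul',
    TensorProduct.tmul_smul, map_smul, map_smul]
  module

/-- The derivative of t^n s^0 with respect to s is the same as with respect to t: the exponent of s
is zero, so only the power of t contributes. -/
lemma dual_derivative (hz : z ≠ 0) (n : ℤ) (v : V) (l : TDual W₁ W₂) :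
    tauQ z W₁ W₂ 0 n (𝒱.adj.Lneg v) l = (-(n : ℂ)) • tauQ z W₁ W₂ 0 (n - 1) v l := by
  refine tdual_ext fun w₁ w₂ => ?_
  have h1 := (inftyExp_isExpansion W₁ hz).derivative 𝒱.adj.Lneg (fun n v w => by
    simp only [inftyExp_zero, 𝒱.oppMode_Lneg W₁.isGenModule.isWeak]) n 0 v w₁
  have h2 := (zeroExp_isExpansion W₂ hz).derivative 𝒱.adj.Lneg (fun n v w => by
    simp only [zeroExp_zero, W₂.isGenModule.isWeak.derivative]) n 0 v w₂
  rw [LinearMap.smul_apply, tauQ_tmul, tauQ_tmul, h1, h2, Int.cast_zero, neg_zero, zero_smul,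
    zero_smul, zero_sub, zero_sub, ← neg_smul, ← neg_smul, ← TensorProduct.smul_tmul',
    TensorProduct.tmul_smul, map_smul, map_smul, smul_sub]

/-- On W₂ the expansion of t^n at s = 0 has no negative powers, so the vacuum gives zero. On W₁ it
picks the coefficient of s⁻¹ in the expansion of t^n at infinity, which is 1 for n = -1 and 0
otherwise. -/
lemma dual_vacuum (n : ℤ) (l : TDual W₁ W₂) :
    tauQ z W₁ W₂ 0 n 𝒱.one l = if n = -1 then l else 0 := by
  refine tdual_ext fun w₁ w₂ => ?_
  have h2 : zeroExp z W₂ n 0 𝒱.one w₂ = 0 := VertexAlg.tauPlus_eq_zero _ _ _ fun k hk => by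
    rw [W₂.isGenModule.isWeak.vacuum, if_neg (by omega)]
  have h1 : inftyExp z W₁ n 0 𝒱.one w₁ = if n = -1 then w₁ else 0 := by
    rw [inftyExp, 𝒱.tauOpp_apply]
    simp only [𝒱.oppMode_one W₁.isGenModule.isWeak, add_zero]
    split_ifs with hn
    · subst hn
      rw [binSum, finsum_eq_single _ 0]
      · simp
      · intro k hk
        rw [if_neg (by omega), smul_zero, smul_zero]
    · rw [binSum, finsum_eq_zero_of_forall_eq_zero]
      intro k
      split_ifs with hk
      -- The only candidate is k = n + 1, but C(n, n+1) = 0 for n ≥ 0.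
      · have hn0 : 0 ≤ n := by omega
        obtain ⟨m, rfl⟩ := Int.eq_ofNat_of_zero_le hn0
        obtain rfl : k = m + 1 := by omega
        rw [Int.cast_natCast, Ring.choose_natCast, Nat.choose_succ_self]
        simp
      · rw [smul_zero, smul_zero]
  rw [tauQ_tmul, h1, h2, TensorProduct.tmul_zero, map_zero, sub_zero]
  split_ifs <;> simp

lemma dualDiff_comm (S S' : End ℂ W₁.carrier) (T T' : End ℂ W₂.carrier) (l : TDual W₁ W₂) :
    dualDiff W₁ W₂ S T (dualDiff W₁ W₂ S' T' l) - dualDiff W₁ W₂ S' T' (dualDiff W₁ W₂ S T l) =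
      dualDiff W₁ W₂ (S' * S - S * S') (T * T' - T' * T) l := by
  refine tdual_ext fun w₁ w₂ => ?_
  simp only [LinearMap.sub_apply, dualDiff_tmul, Module.End.mul_apply, TensorProduct.sub_tmul,
    TensorProduct.tmul_sub, map_sub]
  ring

lemma dual_bracket_zero_neg (l : TDual W₁ W₂) :
    (dualAct z W₁ W₂).Lzero ((dualAct z W₁ W₂).Lneg l) -
      (dualAct z W₁ W₂).Lneg ((dualAct z W₁ W₂).Lzero l) = (dualAct z W₁ W₂).Lneg l := by
  simp only [dualAct, dualDiff_comm]
  congr 2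
  · ext w
    have h := W₁.isGenModule.isWeak.bracket_zero_one w
    rw [sub_eq_iff_eq_add] at h
    simp [h]
  · ext w
    have h := W₂.isGenModule.isWeak.bracket_zero_neg w
    rw [sub_eq_iff_eq_add] at h
    simp [h]

lemma dual_bracket_zero_one (l : TDual W₁ W₂) :
    (dualAct z W₁ W₂).Lzero ((dualAct z W₁ W₂).Lone l) -
      (dualAct z W₁ W₂).Lone ((dualAct z W₁ W₂).Lzero l) = -(dualAct z W₁ W₂).Lone l := by
  rw [← LinearMap.neg_apply]
  have h0 : ∀ (S : End ℂ W₁.carrier) (T : End ℂ W₂.carrier),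
      -dualDiff W₁ W₂ S T = dualDiff W₁ W₂ (-S) (-T) := fun S T =>
    LinearMap.ext fun l => tdual_ext fun w₁ w₂ => by
      rw [LinearMap.neg_apply, LinearMap.neg_apply, dualDiff_tmul, dualDiff_tmul,
        LinearMap.neg_apply, LinearMap.neg_apply, TensorProduct.neg_tmul, TensorProduct.tmul_neg,
        map_neg, map_neg]
      ring
  simp only [dualAct, dualDiff_comm, h0]
  congr 2
  · ext w
    have h1 := W₁.isGenModule.isWeak.bracket_zero_neg w
    have h2 := W₁.isGenModule.isWeak.bracket_zero_one w
    have h3 := W₁.isGenModule.isWeak.bracket_neg_one w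
    rw [sub_eq_iff_eq_add] at h1 h2 h3
    simp [h1, h2, h3]
    module
  · ext w
    have h1 := W₂.isGenModule.isWeak.bracket_zero_neg w
    have h2 := W₂.isGenModule.isWeak.bracket_zero_one w
    have h3 := W₂.isGenModule.isWeak.bracket_neg_one w
    rw [sub_eq_iff_eq_add] at h1 h2 h3
    simp [h1, h2, h3]
    module

lemma dual_bracket_neg_one (l : TDual W₁ W₂) :
    (dualAct z W₁ W₂).Lneg ((dualAct z W₁ W₂).Lone l) -
      (dualAct z W₁ W₂).Lone ((dualAct z W₁ W₂).Lneg l) =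
        (-2 : ℂ) • (dualAct z W₁ W₂).Lzero l := by
  rw [← LinearMap.smul_apply]
  have h0 : ∀ (S : End ℂ W₁.carrier) (T : End ℂ W₂.carrier),
      (-2 : ℂ) • dualDiff W₁ W₂ S T = dualDiff W₁ W₂ ((-2 : ℂ) • S) ((-2 : ℂ) • T) := fun S T =>
    LinearMap.ext fun l => tdual_ext fun w₁ w₂ => by
      rw [LinearMap.smul_apply, LinearMap.smul_apply, dualDiff_tmul, dualDiff_tmul,
        LinearMap.smul_apply, LinearMap.smul_apply, ← TensorProduct.smul_tmul',
        TensorProduct.tmul_smul, map_smul, map_smul, smul_sub]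
  simp only [dualAct, dualDiff_comm, h0]
  congr 2
  · ext w
    have h2 := W₁.isGenModule.isWeak.bracket_zero_one w
    have h3 := W₁.isGenModule.isWeak.bracket_neg_one w
    rw [sub_eq_iff_eq_add] at h2 h3
    simp [h2, h3]
    module
  · ext w
    have h1 := W₂.isGenModule.isWeak.bracket_zero_neg w
    have h3 := W₂.isGenModule.isWeak.bracket_neg_one w
    rw [sub_eq_iff_eq_add] at h1 h3
    simp [h1, h3]
    module

/-- The modes 0, 1, 2 of ω belong to t^j = (s-z)^j with j ≤ 2, a polynomial in s. Its coefficients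
are those in the definition of L'(j-1). -/
lemma dual_conformal (hz : z ≠ 0) {ω : V} (hω : ω ∈ 𝒱.omega) (l : TDual W₁ W₂) :
    (dualAct z W₁ W₂).Lneg l = tauQ z W₁ W₂ 0 0 ω l ∧
      (dualAct z W₁ W₂).Lzero l = tauQ z W₁ W₂ 0 1 ω l ∧
      (dualAct z W₁ W₂).Lone l = tauQ z W₁ W₂ 0 2 ω l := by
  have c1 := W₁.isGenModule.isWeak.conformal ω hω
  have c2 := W₂.isGenModule.isWeak.conformal ω hω
  have i0 : ∀ n w, inftyExp z W₁ 0 n ω w = W₁.act.mode (2 - n) ω w := fun n w => by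
    rw [inftyExp_zero, 𝒱.oppMode_omega _ hω]
  have z0 : ∀ n w, zeroExp z W₂ 0 n ω w = W₂.act.mode n ω w := fun n w => zeroExp_zero z W₂ n ω w
  refine ⟨tdual_ext fun w₁ w₂ => ?_, tdual_ext fun w₁ w₂ => ?_, tdual_ext fun w₁ w₂ => ?_⟩
  · rw [tauQ_tmul, i0, z0]
    simp [dualAct, dualDiff_tmul, (c1 w₁).2.2, (c2 w₂).1]
  · rw [tauQ_tmul, (inftyExp_isExpansion W₁ hz).one_zero, (zeroExp_isExpansion W₂ hz).one_zero,
      i0, i0, z0, z0]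
    simp [dualAct, dualDiff_tmul, (c1 w₁).2, (c2 w₂).1, (c2 w₂).2.1, sub_eq_add_neg]
  · rw [tauQ_tmul, (inftyExp_isExpansion W₁ hz).two_zero, (zeroExp_isExpansion W₂ hz).two_zero,
      i0, i0, i0, z0, z0, z0]
    simp [dualAct, dualDiff_tmul, c1 w₁, c2 w₂, sub_eq_add_neg]

end Dual

/-! ### Compatibility as uniform truncation; stability -/

section Compatibility

variable {z : ℂ} {W₁ W₂ : GenMod.{u} 𝒱}

/-- The `Q(z)`-compatibility condition as a uniform truncation condition. -/
lemma mem_COMP_iff (hz : z ≠ 0) {l : TDual W₁ W₂} :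
    l ∈ COMP z W₁ W₂ ↔ ∀ v, ∃ N : ℤ, ∀ m, ∀ n ≥ N, tauQ z W₁ W₂ m n v l = 0 := by
  constructor
  · rintro ⟨h1, h2⟩ v
    obtain ⟨N, hN⟩ := h1 v
    refine ⟨N, fun m n hn => ?_⟩
    rw [h2, finsum_eq_expSum z (fun n => (dualAct z W₁ W₂).mode n v l)]
    exact expSum_eq_zero z m fun k hk => hN k (le_trans hn hk)
  · intro h
    refine ⟨fun v => ?_, fun v m n => ?_⟩
    · obtain ⟨N, hN⟩ := h v
      exact ⟨N, fun n hn => hN 0 n hn⟩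
    · obtain ⟨N, hN⟩ := h v
      rw [finsum_eq_expSum z (fun n => (dualAct z W₁ W₂).mode n v l)]
      -- The recurrence s = t + z, with truncation in n, determines every row from the row m = 0.
      have := eq_expSum_of_recurrence hz (X := fun m n => tauQ z W₁ W₂ m n v l)
        (fun m n => tauQ_succ hz m n v l) (fun m => ⟨N, hN m⟩) m 0 n
      rwa [zero_add] at this

lemma tauQ_add_eq_expSum (hz : z ≠ 0) {l : TDual W₁ W₂} (hl : l ∈ COMP z W₁ W₂) (v : V)
    (m b n : ℤ) :
    tauQ z W₁ W₂ (b + m) n v l = expSum z (fun n => tauQ z W₁ W₂ b n v l) m n := by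
  obtain ⟨N, hN⟩ := (mem_COMP_iff hz).1 hl v
  exact eq_expSum_of_recurrence hz (X := fun m n => tauQ z W₁ W₂ m n v l)
    (fun m n => tauQ_succ hz m n v l) (fun m => ⟨N, hN m⟩) m b n

/-- The elements satisfying the `Q(z)`-compatibility condition, as a subspace. -/
def compSubmodule (hz : z ≠ 0) : Submodule ℂ (TDual W₁ W₂) where
  carrier := COMP z W₁ W₂
  zero_mem' := (mem_COMP_iff hz).2 fun v => ⟨0, fun m n _ => map_zero _⟩
  add_mem' := by
    intro a b ha hb
    rw [mem_COMP_iff hz] at ha hb ⊢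
    intro v
    obtain ⟨N, hN⟩ := ha v
    obtain ⟨M, hM⟩ := hb v
    refine ⟨max N M, fun m n hn => ?_⟩
    rw [map_add, hN m n (le_trans (le_max_left _ _) hn), hM m n (le_trans (le_max_right _ _) hn),
      add_zero]
  smul_mem' := by
    intro c a ha
    rw [mem_COMP_iff hz] at ha ⊢
    intro v
    obtain ⟨N, hN⟩ := ha v
    exact ⟨N, fun m n hn => by rw [map_smul, hN m n hn, smul_zero]⟩

lemma mem_compSubmodule (hz : z ≠ 0) {l : TDual W₁ W₂} :
    l ∈ compSubmodule hz ↔ l ∈ COMP z W₁ W₂ := Iff.rfl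

/-- Locality of the `Q(z)`-action on the whole dual space. -/
lemma dual_locality (hz : z ≠ 0) (W₁ W₂ : GenMod.{u} 𝒱) (u v : V) : ∃ L₀ : ℕ, ∀ L ≥ L₀,
    ∀ (l : TDual W₁ W₂) (m₁ m₂ : ℤ), diffOp^[L] (fun p q => tauQ z W₁ W₂ m₁ p u
      (tauQ z W₁ W₂ m₂ q v l) - tauQ z W₁ W₂ m₂ q v (tauQ z W₁ W₂ m₁ p u l)) = 0 := by
  obtain ⟨L₁, hL₁⟩ := 𝒱.oppMode_locality W₁.isGenModule.isWeak u v
  obtain ⟨L₂, hL₂⟩ := 𝒱.exists_mode_eq_zero u v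
  refine ⟨max L₁ L₂, fun L hL l m₁ m₂ => ?_⟩
  -- The differences are taken in the exponents of t, which come first in the expansions on the
  -- modules; hence `locality` and not `locality_right`.
  have k1 : ∀ w, diffOp^[L] (fun p q => inftyExp z W₁ p m₁ u (inftyExp z W₁ q m₂ v w) -
      inftyExp z W₁ q m₂ v (inftyExp z W₁ p m₁ u w)) = 0 := fun w => by
    refine iterate_diffOp_mono (le_trans (le_max_left _ _) hL)
      ((inftyExp_isExpansion W₁ hz).locality u v w L₁ ?_ m₁ m₂)
    simp only [inftyExp_zero]
    exact hL₁ w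
  have k2 : ∀ w, diffOp^[L] (fun p q => zeroExp z W₂ p m₁ u (zeroExp z W₂ q m₂ v w) -
      zeroExp z W₂ q m₂ v (zeroExp z W₂ p m₁ u w)) = 0 := fun w => by
    refine iterate_diffOp_mono (le_trans (le_max_right _ _) hL)
      ((zeroExp_isExpansion W₂ hz).locality u v w L₂ ?_ m₁ m₂)
    simp only [zeroExp_zero]
    exact W₂.isGenModule.isWeak.locality hL₂ w
  funext p q
  refine tdual_ext fun w₁ w₂ => ?_
  have h1 := iterate_diffOp_map (LinearMap.applyₗ (R := ℂ) (M₂ := ℂ) (w₁ ⊗ₜ[ℂ] w₂)) L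
    (fun p q => tauQ z W₁ W₂ m₁ p u (tauQ z W₁ W₂ m₂ q v l) -
      tauQ z W₁ W₂ m₂ q v (tauQ z W₁ W₂ m₁ p u l)) p q
  simp only [LinearMap.applyₗ_apply_apply] at h1
  rw [← h1]
  -- The terms in which u and v act on different factors cancel; the signs come from the reversed
  -- order of transposed operators.
  have h2 : (fun a b : ℤ => (tauQ z W₁ W₂ m₁ a u (tauQ z W₁ W₂ m₂ b v l) -
      tauQ z W₁ W₂ m₂ b v (tauQ z W₁ W₂ m₁ a u l)) (w₁ ⊗ₜ w₂)) =
      (-1 : ℂ) • (fun a b => (l ∘ₗ (TensorProduct.mk ℂ _ _).flip w₂)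
        (inftyExp z W₁ a m₁ u (inftyExp z W₁ b m₂ v w₁) -
          inftyExp z W₁ b m₂ v (inftyExp z W₁ a m₁ u w₁))) +
      (-1 : ℂ) • (fun a b => (l ∘ₗ TensorProduct.mk ℂ _ _ w₁)
        (zeroExp z W₂ a m₁ u (zeroExp z W₂ b m₂ v w₂) -
          zeroExp z W₂ b m₂ v (zeroExp z W₂ a m₁ u w₂))) := by
    funext a b
    simp only [LinearMap.sub_apply, tauQ_tmul, Pi.add_apply, Pi.smul_apply, LinearMap.comp_apply,
      map_sub, LinearMap.flip_apply, TensorProduct.mk_apply]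
    module
  rw [h2, iterate_diffOp_add, iterate_diffOp_smul, iterate_diffOp_smul, Pi.add_apply, Pi.add_apply,
    Pi.smul_apply, Pi.smul_apply, Pi.smul_apply, Pi.smul_apply, iterate_diffOp_map,
    iterate_diffOp_map, k1, k2]
  simp

/-- The commutator of u and v on λ vanishes when both exponents of t are large, and locality extends
this to each fixed exponent for v, with a bound uniform in the exponent of s for u. Beyond this
bound the product in the other order vanishes as well. -/
lemma tauQ_mem_COMP (hz : z ≠ 0) {l : TDual W₁ W₂} (hl : l ∈ COMP z W₁ W₂) (m n : ℤ) (v : V) :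
    tauQ z W₁ W₂ m n v l ∈ COMP z W₁ W₂ := by
  rw [mem_COMP_iff hz] at hl ⊢
  intro u
  obtain ⟨N, hN⟩ := hl u
  obtain ⟨N', hN'⟩ := hl v
  obtain ⟨L, hL⟩ := dual_locality hz W₁ W₂ u v
  obtain ⟨B, hB⟩ := exists_bound_of_iterate_diffOp L
    (fun i p q => tauQ z W₁ W₂ i p u (tauQ z W₁ W₂ m q v l) -
      tauQ z W₁ W₂ m q v (tauQ z W₁ W₂ i p u l)) (fun i => hL L le_rfl l i m) N N'
    (fun i p hp q hq => by rw [hN i p hp, hN' m q hq, map_zero, map_zero, sub_zero]) n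
  refine ⟨max B N, fun i p hp => ?_⟩
  have := hB i p (le_trans (le_max_left _ _) hp)
  rwa [hN i p (le_trans (le_max_right _ _) hp), map_zero, sub_zero] at this

/-- Here and for L'(0) and L'(1), the commutator with τ(v ⊗ s^m t^n) involves finitely many vectors
obtained from v, with exponents of t at least n, so their bounds for λ suffice. -/
lemma Lneg_mem_COMP (hz : z ≠ 0) {l : TDual W₁ W₂} (hl : l ∈ COMP z W₁ W₂) :
    (dualAct z W₁ W₂).Lneg l ∈ COMP z W₁ W₂ := by
  rw [mem_COMP_iff hz] at hl ⊢
  intro v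
  obtain ⟨N, hN⟩ := hl v
  obtain ⟨N', hN'⟩ := hl (𝒱.adj.Lneg v)
  refine ⟨max N N', fun m n hn => ?_⟩
  have := dual_comm_neg hz m n v l
  rwa [hN m n (by omega), hN' m n (by omega), map_zero, zero_sub, neg_eq_zero] at this

lemma Lzero_mem_COMP (hz : z ≠ 0) {l : TDual W₁ W₂} (hl : l ∈ COMP z W₁ W₂) :
    (dualAct z W₁ W₂).Lzero l ∈ COMP z W₁ W₂ := by
  rw [mem_COMP_iff hz] at hl ⊢
  intro v
  obtain ⟨N, hN⟩ := hl v
  obtain ⟨N', hN'⟩ := hl (𝒱.adj.Lneg v)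
  obtain ⟨N₀, hN₀⟩ := hl (𝒱.adj.Lzero v)
  refine ⟨max N (max N' N₀), fun m n hn => ?_⟩
  have := dual_comm_zero hz m n v l
  rwa [hN m n (by omega), hN₀ m n (by omega), hN' m (n + 1) (by omega), map_zero, zero_sub,
    add_zero, neg_eq_zero] at this

lemma Lone_mem_COMP (hz : z ≠ 0) {l : TDual W₁ W₂} (hl : l ∈ COMP z W₁ W₂) :
    (dualAct z W₁ W₂).Lone l ∈ COMP z W₁ W₂ := by
  rw [mem_COMP_iff hz] at hl ⊢
  intro v
  obtain ⟨N, hN⟩ := hl v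
  obtain ⟨N', hN'⟩ := hl (𝒱.adj.Lneg v)
  obtain ⟨N₀, hN₀⟩ := hl (𝒱.adj.Lzero v)
  obtain ⟨N₁, hN₁⟩ := hl (𝒱.adj.Lone v)
  refine ⟨max (max N N₁) (max N' N₀), fun m n hn => ?_⟩
  have := dual_comm_one hz m n v l
  rwa [hN m n (by omega), hN₁ m n (by omega), hN₀ m (n + 1) (by omega), hN' m (n + 2) (by omega),
    map_zero, zero_sub, add_zero, smul_zero, add_zero, neg_eq_zero] at this

lemma compSubmodule_stable (hz : z ≠ 0) :
    (dualAct z W₁ W₂).toVertexAction.Stable (compSubmodule hz) where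
  mode_mem n v _ hl := tauQ_mem_COMP hz hl 0 n v
  neg_mem _ hl := Lneg_mem_COMP hz hl
  zero_mem _ hl := Lzero_mem_COMP hz hl
  one_mem _ hl := Lone_mem_COMP hz hl

end Compatibility

/-! ### The three sums of the Jacobi identity and their recurrences -/

section Defect

variable {M : Type*} [AddCommGroup M] [Module ℂ M]

/-- The sum `∑ᵢ C(n,i) T(l+i, r-i)`: the iterate side of the Jacobi identity. -/
noncomputable def iterSum (l n : ℤ) (T : ℤ → ℤ → M) (r : ℤ) : M :=
  binSum n fun i => T (l + i) (r - i)

/-- The family `T(j, r)` vanishes for large `j`, uniformly in `r`. -/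
def TruncLeft (T : ℤ → ℤ → M) : Prop := ∃ K : ℤ, ∀ j ≥ K, ∀ r, T j r = 0

lemma TruncLeft.exists_nat {T : ℤ → ℤ → M} (h : TruncLeft T) (l r : ℤ) :
    ∃ K : ℕ, ∀ i ≥ K, T (l + (i : ℕ)) (r - (i : ℕ)) = 0 := by
  obtain ⟨K, hK⟩ := h
  exact ⟨(K - l).toNat, fun i hi => hK _ (by omega) _⟩

lemma iterSum_succ (l n : ℤ) {T : ℤ → ℤ → M} (h : TruncLeft T) (r : ℤ) :
    iterSum l (n + 1) T (r + 1) = iterSum l n T (r + 1) + iterSum (l + 1) n T r := by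
  rw [iterSum, binSum_succ _ (h.exists_nat _ _)]
  simp only [iterSum]
  congr 2
  ext i
  push_cast
  ring_nf

lemma iterSum_recurrence (l n : ℤ) {T T' : ℤ → ℤ → M} (h : TruncLeft T) {c : ℂ}
    (hT : ∀ j r, T' j r = T j (r + 1) + c • T j r) (r : ℤ) :
    iterSum l n T' r = iterSum l n T (r + 1) + c • iterSum l n T r := by
  have e : (fun i : ℕ => T' (l + i) (r - i)) =
      fun i : ℕ => T (l + i) (r + 1 - i) + c • T (l + i) (r - i) := by
    ext i
    rw [hT]
    ring_nf
  obtain ⟨K, hK⟩ := h.exists_nat l r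
  simp only [iterSum]
  rw [e, binSum_add _ (h.exists_nat _ _) ⟨K, fun i hi => by rw [hK i hi, smul_zero]⟩,
    binSum_smul _ _ ⟨K, hK⟩]

lemma altSum_recurrence_left (l : ℤ) {y y' : ℤ → ℤ → M} (h : TruncRight y) {c : ℂ}
    (hy : ∀ a b, y' a b = y (a + 1) b + c • y a b) (p q : ℤ) :
    altSum l y' p q = altSum l y (p + 1) q + c • altSum l y p q := by
  obtain ⟨K, hK⟩ := h
  have e : y' = fun a b => y (a + 1) (b + 0) + c • y a b := by
    funext a b
    rw [hy, add_zero]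
  rw [e, altSum_add l ⟨K, fun a b hb => hK _ _ (by omega)⟩
    ⟨K, fun a b hb => by rw [hK a b hb, smul_zero]⟩, altSum_shift, add_zero,
    altSum_smul _ _ ⟨K, hK⟩]

lemma altSum_recurrence_right (l : ℤ) {y y' : ℤ → ℤ → M} (h : TruncRight y) {c : ℂ}
    (hy : ∀ a b, y' a b = y a (b + 1) + c • y a b) (p q : ℤ) :
    altSum l y' p q = altSum l y p (q + 1) + c • altSum l y p q := by
  obtain ⟨K, hK⟩ := h
  have e : y' = fun a b => y (a + 0) (b + 1) + c • y a b := by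
    funext a b
    rw [hy, add_zero]
  rw [e, altSum_add l ⟨K, fun a b hb => hK _ _ (by omega)⟩
    ⟨K, fun a b hb => by rw [hK a b hb, smul_zero]⟩, altSum_shift, add_zero,
    altSum_smul _ _ ⟨K, hK⟩]

/-- An alternating sum vanishes for large `p` if each of its terms does, uniformly in a parameter. -/
lemma altSum_eventually_left {ι : Type*} (l : ℤ) {y : ι → ℤ → ℤ → M}
    (h : ∃ K : ℤ, ∀ i a, ∀ b ≥ K, y i a b = 0) (h' : ∀ b, ∃ K : ℤ, ∀ i, ∀ a ≥ K, y i a b = 0)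
    (q : ℤ) : ∃ K : ℤ, ∀ i, ∀ p ≥ K, altSum l (y i) p q = 0 := by
  obtain ⟨K, hK⟩ := h
  choose B hB using h'
  obtain ⟨C, hC⟩ := ((Finset.range (K - q).toNat).image fun k : ℕ => B (q + k) - l + k).bddAbove
  refine ⟨C, fun i p hp => altSum_eq_zero l fun k => ?_⟩
  by_cases hk : k < (K - q).toNat
  · have := hC (Finset.mem_coe.2 (Finset.mem_image_of_mem _ (Finset.mem_range.2 hk)))
    exact hB _ _ _ (by omega)
  · exact hK _ _ _ (by omega)

/-- The difference of the two sides of the Jacobi identity. -/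
noncomputable def jacobiDefect (l : ℤ) (y y' T : ℤ → ℤ → M) (p q : ℤ) : M :=
  altSum l y p q - (-1 : ℂ) ^ l • altSum l y' q p - iterSum l p T (p + q)

/-- Multiplication by x₁ - x₂ on the products corresponds to multiplication by x₀ on the iterate,
where x₁ = x₂ + x₀. -/
lemma jacobiDefect_succ (l : ℤ) {y y' T : ℤ → ℤ → M} (hy : TruncRight y) (hy' : TruncRight y')
    (hT : TruncLeft T) (p q : ℤ) :
    jacobiDefect (l + 1) y y' T p q =
      jacobiDefect l y y' T (p + 1) q - jacobiDefect l y y' T p (q + 1) := by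
  have h := iterSum_succ l p hT (p + q)
  simp only [jacobiDefect]
  rw [altSum_succ l hy, altSum_succ l hy', zpow_add_one₀ (by norm_num),
    show p + 1 + q = p + q + 1 by ring, show p + (q + 1) = p + q + 1 by ring, h]
  module

lemma eq_of_shift {e : ℤ → ℤ → M} (h : ∀ a b, e (a + 1) b = e a (b + 1)) (a b c : ℤ) :
    e (a + c) b = e a (b + c) := by
  induction c using Int.induction_on generalizing b with
  | zero => simp
  | succ c ih =>
    rw [← add_assoc, h, ih]
    ring_nf
  | pred c ih =>
    have h1 := h (a + (-c - 1)) (b - 1)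
    rw [sub_add_cancel] at h1
    rw [← h1, show a + (-(c : ℤ) - 1) + 1 = a + -c by ring, ih]
    ring_nf

end Defect

/-! ### The Jacobi identity on a module for t^{n₁} and t^{n₂} s^m, expanded at s = 0 -/

section ModuleJacobi

variable {z : ℂ} (W : GenMod.{u} 𝒱)

/-- The products `u(t^a s^p) v(t^b s^q) w` are truncated in `q`. -/
lemma zeroExp_truncRight (u v : V) (w : W.carrier) (a b : ℤ) :
    TruncRight fun p q => zeroExp z W a p u (zeroExp z W b q v w) := by
  obtain ⟨N, hN⟩ := exists_zeroExp_eq_zero z W v w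
  exact ⟨N, fun p q hq => by simp only [hN b q hq, map_zero]⟩

lemma zeroExp_truncLeft (u v : V) (w : W.carrier) (m : ℤ) :
    TruncLeft fun j r => zeroExp z W r m (𝒱.adj.mode j u v) w := by
  obtain ⟨N, hN⟩ := 𝒱.isWeak.truncation u v
  exact ⟨N, fun j hj r => by simp only [hN j hj, map_zero, LinearMap.zero_apply]⟩

/-- The defect of the Jacobi identity for `u ⊗ t^{n₁}` and `v ⊗ t^{n₂} s^m`, expanded at `s = 0`. -/
noncomputable def expDefect (z : ℂ) (u v : V) (w : W.carrier) (l n₁ n₂ m : ℤ) : W.carrier :=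
  altSum l (fun p q => zeroExp z W n₁ p u (zeroExp z W n₂ q v w)) 0 m -
    (-1 : ℂ) ^ l • altSum l (fun q p => zeroExp z W n₂ q v (zeroExp z W n₁ p u w)) m 0 -
    iterSum l n₁ (fun j r => zeroExp z W r m (𝒱.adj.mode j u v) w) (n₁ + n₂)

/-- The factor s₁ - s₂ equals t₁ - t₂, and the constants -z cancel. -/
lemma expDefect_succ (hz : z ≠ 0) (u v : V) (w : W.carrier) (l n₁ n₂ m : ℤ) :
    expDefect W z u v w (l + 1) n₁ n₂ m =
      expDefect W z u v w l (n₁ + 1) n₂ m - expDefect W z u v w l n₁ (n₂ + 1) m := by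
  have E := zeroExp_isExpansion W hz
  have h1 := altSum_recurrence_left l (zeroExp_truncRight W u v w n₁ n₂)
    (y' := fun p q => zeroExp z W (n₁ + 1) p u (zeroExp z W n₂ q v w)) (c := -z)
    (fun p q => E.succ _ _ _ _) 0 m
  have h2 := altSum_recurrence_right l (zeroExp_truncRight W u v w n₁ n₂)
    (y' := fun p q => zeroExp z W n₁ p u (zeroExp z W (n₂ + 1) q v w)) (c := -z)
    (fun p q => by rw [E.succ, map_add, map_smul]) 0 m
  have h3 := altSum_recurrence_right l (zeroExp_truncRight W v u w n₂ n₁)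
    (y' := fun q p => zeroExp z W n₂ q v (zeroExp z W (n₁ + 1) p u w)) (c := -z)
    (fun p q => by rw [E.succ, map_add, map_smul]) m 0
  have h4 := altSum_recurrence_left l (zeroExp_truncRight W v u w n₂ n₁)
    (y' := fun q p => zeroExp z W (n₂ + 1) q v (zeroExp z W n₁ p u w)) (c := -z)
    (fun p q => E.succ _ _ _ _) m 0
  have h5 := iterSum_succ l n₁ (zeroExp_truncLeft (z := z) W u v w m) (n₁ + n₂)
  simp only [expDefect]
  rw [altSum_succ l (zeroExp_truncRight W u v w n₁ n₂),
    altSum_succ l (zeroExp_truncRight W v u w n₂ n₁), h1, h2, h3, h4, zpow_add_one₀ (by norm_num),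
    show n₁ + 1 + n₂ = n₁ + n₂ + 1 by ring, show n₁ + (n₂ + 1) = n₁ + n₂ + 1 by ring, h5]
  module

/-- For n₂ = 0 this is the module's Jacobi identity, with a single iterate term; the recurrence in
n₂ and truncation in m give the other n₂. -/
lemma expDefect_zero (hz : z ≠ 0) (u v : V) (w : W.carrier) (l n₂ m : ℤ) :
    expDefect W z u v w l 0 n₂ m = 0 := by
  have E := zeroExp_isExpansion W hz
  refine eq_zero_of_recurrence E.dir E.ne_zero (X := fun n m => expDefect W z u v w l 0 n m)
    (fun m => ?_) (fun n m => ?_) (fun n => ?_) n₂ m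
  · have h := W.isGenModule.isWeak.jacobi u v w l 0 m
    simp only [expDefect, zeroExp_zero, iterSum, binSum_zero_left, altSum_eq_finsum]
    rw [h]
    have := binSum_zero_left fun k : ℕ => W.act.mode (0 + m - k) (𝒱.adj.mode (l + k) u v) w
    rw [binSum] at this
    rw [this]
    simp [zeroExp_zero]
  · simp only [expDefect, iterSum, binSum_zero_left]
    rw [altSum_recurrence_right l (zeroExp_truncRight W u v w 0 n)
        (fun p q => by rw [E.succ, map_add, map_smul]),
      altSum_recurrence_left l (zeroExp_truncRight W v u w n 0) (fun p q => E.succ _ _ _ _)]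
    have h5 := E.succ n m (𝒱.adj.mode l u v) w
    simp only [Nat.cast_zero, add_zero, sub_zero, zero_add] at h5 ⊢
    rw [h5]
    module
  · obtain ⟨K₁, h₁⟩ := exists_zeroExp_eq_zero z W v w
    obtain ⟨K₂, h₂⟩ := zeroExp_truncRight (z := z) W v u w n 0
    obtain ⟨K₃, h₃⟩ := altSum_eventually_left (ι := Unit) l
      (y := fun _ q p => zeroExp z W n q v (zeroExp z W 0 p u w)) ⟨K₂, fun _ => h₂⟩
      (fun b => by
        obtain ⟨N, hN⟩ := exists_zeroExp_eq_zero z W v (zeroExp z W 0 b u w)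
        exact ⟨N, fun _ a ha => hN n a ha⟩) 0
    obtain ⟨K₄, h₄⟩ := exists_zeroExp_eq_zero z W (𝒱.adj.mode l u v) w
    filter_upwards [eventually_ge_atTop K₁, eventually_ge_atTop K₃, eventually_ge_atTop K₄]
      with m g1 g3 g4
    simp only [expDefect, iterSum, binSum_zero_left]
    rw [altSum_eq_zero l fun k => by rw [h₁ _ _ (by omega), map_zero], h₃ () m g3]
    simp [h₄ n m g4]

/-- For large l the iterate terms vanish and the remaining commutator is zero by locality. -/
lemma expDefect_of_large (hz : z ≠ 0) (u v : V) : ∃ L₀ : ℤ, ∀ l ≥ L₀, ∀ w n₁ n₂ m,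
    expDefect W z u v w l n₁ n₂ m = 0 := by
  obtain ⟨L, hL⟩ := 𝒱.exists_mode_eq_zero u v
  refine ⟨L, fun l hl w n₁ n₂ m => ?_⟩
  obtain ⟨d, rfl⟩ : ∃ d : ℕ, l = ((L + d : ℕ) : ℤ) := ⟨(l - L).toNat, by omega⟩
  have h1 := (zeroExp_isExpansion W hz).locality_right u v w L (by
    simp only [zeroExp_zero]
    exact W.isGenModule.isWeak.locality hL w) n₁ n₂
  simp only [expDefect]
  rw [zpow_natCast, altSum_sub_altSum_natCast (zeroExp_truncRight W u v w n₁ n₂)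
    (zeroExp_truncRight W v u w n₂ n₁), iterate_diffOp_mono (Nat.le_add_right L d) h1, iterSum,
    binSum_eq_zero _ fun i => by
      have := hL (d + i)
      push_cast at this ⊢
      rw [add_assoc, this, map_zero, LinearMap.zero_apply]]
  simp

/-- The Jacobi identity for `u ⊗ t^{n₁}` and `v ⊗ t^{n₂} s^m`, expanded at `s = 0`. -/
lemma expDefect_eq_zero (hz : z ≠ 0) (u v : V) (w : W.carrier) (l n₁ n₂ m : ℤ) :
    expDefect W z u v w l n₁ n₂ m = 0 := by
  induction n₁ using Int.induction_on generalizing l n₂ with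
  | zero => exact expDefect_zero W hz u v w l n₂ m
  | succ n ih =>
    have := expDefect_succ W hz u v w l n n₂ m
    rw [ih, ih, sub_zero] at this
    exact this.symm
  | pred n ih =>
    -- For negative n₁ the recurrence in l is used backwards: the value at l is determined by the
    -- value at l + 1 and by the row of n₁ + 1. The induction starts from locality.
    obtain ⟨L₀, hL₀⟩ := expDefect_of_large W hz u v
    have key : ∀ d : ℕ, ∀ l n₂, L₀ ≤ l + d → expDefect W z u v w l (-n - 1) n₂ m = 0 := by
      intro d
      induction d with
      | zero => exact fun l n₂ hl => hL₀ l (by simpa using hl) _ _ _ _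
      | succ d ihd =>
        intro l n₂ hl
        have := expDefect_succ W hz u v w l (-n - 1) (n₂ - 1) m
        rw [ihd (l + 1) _ (by push_cast at hl; omega), sub_add_cancel, sub_add_cancel, ih,
          zero_sub, eq_comm, neg_eq_zero] at this
        exact this
    exact key (L₀ - l).toNat l n₂ (by omega)

end ModuleJacobi

/-! ### The Jacobi identity on compatible elements -/

/-- Both sides are C(l, j+k) times the number of ways to split j + k into j and k. -/
lemma choose_mul_choose_comm (l : ℤ) (j k : ℕ) :
    Ring.choose (l : ℂ) k * Ring.choose ((l - k : ℤ) : ℂ) j =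
      Ring.choose (l : ℂ) j * Ring.choose ((l - j : ℤ) : ℂ) k := by
  have h1 := Ring.choose_smul_choose (l : ℂ) (Nat.le_add_right k j)
  have h2 := Ring.choose_smul_choose (l : ℂ) (Nat.le_add_left j k)
  rw [Nat.add_sub_cancel_left] at h1
  rw [Nat.add_sub_cancel] at h2
  rw [Int.cast_sub, Int.cast_sub, Int.cast_natCast, Int.cast_natCast, ← h1, ← h2,
    Nat.choose_symm_add]

lemma neg_one_pow_mul_neg_zpow (z : ℂ) (l : ℤ) (j k : ℕ) :
    (-1 : ℂ) ^ k * (-z) ^ (l - (k : ℤ) - j) = (-1) ^ l * (-1) ^ j * z ^ (l - (j : ℤ) - k) := by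
  have h1 : ((-1 : ℂ)) ^ (l - (k : ℤ) - j) = (-1) ^ l * (-1) ^ k * (-1) ^ j := by
    rw [zpow_sub₀ (by norm_num), zpow_sub₀ (by norm_num), zpow_natCast, zpow_natCast,
      div_eq_mul_inv, div_eq_mul_inv, ← inv_pow, ← inv_pow]
    norm_num
  have h2 : ((-1 : ℂ)) ^ k * (-1) ^ k = 1 := by
    rw [← mul_pow]
    norm_num
  rw [neg_eq_neg_one_mul z, mul_zpow, h1, show l - (k : ℤ) - j = l - j - k by ring]
  linear_combination (-1 : ℂ) ^ l * (-1) ^ j * z ^ (l - (j : ℤ) - k) * h2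

variable {z : ℂ} {W₁ W₂ : GenMod.{u} 𝒱}

/-- When all the operators involved vanish on `w₁`, a product of two `Q(z)`-operators with
`(t₁-t₂)^l`, expanded in powers of `t₂`, is a product of operators on `W₂` with `(s₁-s₂)^l`, expanded
in powers of `s₁`. -/
lemma altSum_tauQ_tmul (hz : z ≠ 0) {l₀ : TDual W₁ W₂} (hl : l₀ ∈ COMP z W₁ W₂) (u v : V)
    (l m₁ n₁ m₂ n₂ : ℤ) (w₁ : W₁.carrier) (w₂ : W₂.carrier)
    (hu : ∀ k : ℕ, inftyExp z W₁ (n₁ + l - k) m₁ u w₁ = 0)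
    (hv : ∀ j : ℕ, inftyExp z W₁ n₂ (m₂ + l - j) v w₁ = 0) :
    altSum l (fun a b => tauQ z W₁ W₂ m₁ a u (tauQ z W₁ W₂ m₂ b v l₀)) n₁ n₂ (w₁ ⊗ₜ w₂) =
      (-1 : ℂ) ^ l • l₀ (w₁ ⊗ₜ altSum l
        (fun q p => zeroExp z W₂ n₂ q v (zeroExp z W₂ n₁ p u w₂)) m₂ m₁) := by
  obtain ⟨N, hN⟩ := (mem_COMP_iff hz).1 hl v
  obtain ⟨N', hN'⟩ := exists_zeroExp_eq_zero z W₂ u w₂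
  obtain ⟨K, hK⟩ : ∃ K : ℕ, ∀ k ≥ K, ∀ m, tauQ z W₁ W₂ m (n₂ + (k : ℕ)) v l₀ = 0 :=
    ⟨(N - n₂).toNat, fun k hk m => hN m _ (by omega)⟩
  obtain ⟨J, hJ⟩ : ∃ J : ℕ, ∀ j ≥ J, zeroExp z W₂ n₁ (m₁ + (j : ℕ)) u w₂ = 0 :=
    ⟨(N' - m₁).toNat, fun j hj => hN' _ _ (by omega)⟩
  -- As u annihilates w₁, only its action on W₂ is left, where t₁^{l-k} = (-z+s₁)^{l-k} is expanded
  -- in powers of s₁.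
  have e1 : ∀ k : ℕ, tauQ z W₁ W₂ m₁ (n₁ + l - k) u (tauQ z W₁ W₂ m₂ (n₂ + k) v l₀) (w₁ ⊗ₜ w₂) =
      -∑ j ∈ Finset.range J, (Ring.choose ((l - k : ℤ) : ℂ) j * (-z) ^ (l - (k : ℤ) - j)) *
        tauQ z W₁ W₂ m₂ (n₂ + k) v l₀ (w₁ ⊗ₜ zeroExp z W₂ n₁ (m₁ + j) u w₂) := by
    intro k
    have h := eq_expSum_of_recurrence (neg_ne_zero.2 hz)
      (X := fun a n => zeroExp z W₂ a n u w₂)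
      (fun a n => (zeroExp_isExpansion W₂ hz).succ a n u w₂) (fun a => ⟨N', hN' a⟩)
      (l - k) n₁ m₁
    rw [tauQ_tmul, hu, TensorProduct.zero_tmul, map_zero, zero_sub, add_sub_assoc, h, expSum,
      binSum_eq_sum (K := J) _ fun j hj => by rw [hJ j hj, smul_zero], TensorProduct.tmul_sum,
      map_sum]
    simp only [TensorProduct.tmul_smul, map_smul, smul_eq_mul, mul_assoc]
  -- As v annihilates w₁, its action on W₂ is minus its Q(z)-action on the functional. Compatibility
  -- expands s₂^{l-j} = (z+t₂)^{l-j} in powers of t₂.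
  have e2 : ∀ j : ℕ, l₀ (w₁ ⊗ₜ zeroExp z W₂ n₂ (m₂ + l - j) v (zeroExp z W₂ n₁ (m₁ + j) u w₂)) =
      -∑ k ∈ Finset.range K, (Ring.choose ((l - j : ℤ) : ℂ) k * z ^ (l - (j : ℤ) - k)) *
        tauQ z W₁ W₂ m₂ (n₂ + k) v l₀ (w₁ ⊗ₜ zeroExp z W₂ n₁ (m₁ + j) u w₂) := by
    intro j
    have h := tauQ_tmul (z := z) (m₂ + l - j) n₂ v l₀ w₁ (zeroExp z W₂ n₁ (m₁ + j) u w₂)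
    rw [hv, TensorProduct.zero_tmul, map_zero, zero_sub, add_sub_assoc,
      tauQ_add_eq_expSum hz hl v (l - j) m₂ n₂, expSum,
      binSum_eq_sum (K := K) _ fun k hk => by rw [hK k hk, smul_zero]] at h
    rw [add_sub_assoc, ← neg_eq_iff_eq_neg, ← h, LinearMap.sum_apply]
    simp only [LinearMap.smul_apply, smul_eq_mul, mul_assoc]
  rw [altSum, binSum_eq_sum (K := K) _ fun k hk => by rw [hK k hk, map_zero, smul_zero],
    altSum, binSum_eq_sum (K := J) _ fun j hj => by rw [hJ j hj, map_zero, smul_zero],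
    LinearMap.sum_apply, TensorProduct.tmul_sum, map_sum, smul_eq_mul, Finset.mul_sum]
  simp only [LinearMap.smul_apply, TensorProduct.tmul_smul, map_smul, smul_eq_mul, e1, e2, mul_neg,
    Finset.sum_neg_distrib, Finset.mul_sum]
  -- Both double sums now expand (-z + s₁ - t₂)^l in nonnegative powers of s₁ and t₂, once as (t₁ -
  -- t₂)^l and once as (-1)^l (s₂ - s₁)^l.
  rw [Finset.sum_comm]
  congr 1
  refine Finset.sum_congr rfl fun j _ => Finset.sum_congr rfl fun k _ => ?_
  have h1 := choose_mul_choose_comm l j k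
  have h2 := neg_one_pow_mul_neg_zpow z l j k
  generalize tauQ z W₁ W₂ m₂ (n₂ + k) v l₀ (w₁ ⊗ₜ zeroExp z W₂ n₁ (m₁ + j) u w₂) = x
  calc _ = (Ring.choose (l : ℂ) k * Ring.choose ((l - k : ℤ) : ℂ) j) *
        ((-1 : ℂ) ^ k * (-z) ^ (l - (k : ℤ) - j)) * x := by ring
    _ = _ := by rw [h1, h2]; ring

lemma tauQ_truncRight (hz : z ≠ 0) {l₀ : TDual W₁ W₂} (hl : l₀ ∈ COMP z W₁ W₂) (u v : V)
    (m₁ m₂ : ℤ) :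
    TruncRight fun a b => tauQ z W₁ W₂ m₁ a u (tauQ z W₁ W₂ m₂ b v l₀) := by
  obtain ⟨N, hN⟩ := (mem_COMP_iff hz).1 hl v
  exact ⟨N, fun a b hb => by simp only [hN m₂ b hb, map_zero]⟩

lemma tauQ_truncLeft (u v : V) (l₀ : TDual W₁ W₂) (m : ℤ) :
    TruncLeft fun j r => tauQ z W₁ W₂ m r (𝒱.adj.mode j u v) l₀ := by
  obtain ⟨N, hN⟩ := 𝒱.isWeak.truncation u v
  exact ⟨N, fun j hj r => by simp only [hN j hj, map_zero, LinearMap.zero_apply]⟩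

/-- The defect of the Jacobi identity for `u ⊗ t^{n₁}` and `v ⊗ s^m t^{n₂}` acting on `(W₁ ⊗ W₂)^*`. -/
noncomputable def dualDefect (z : ℂ) {W₁ W₂ : GenMod.{u} 𝒱} (u v : V) (l₀ : TDual W₁ W₂)
    (l n₁ m n₂ : ℤ) : TDual W₁ W₂ :=
  jacobiDefect l (fun a b => tauQ z W₁ W₂ 0 a u (tauQ z W₁ W₂ m b v l₀))
    (fun b a => tauQ z W₁ W₂ m b v (tauQ z W₁ W₂ 0 a u l₀))
    (fun j r => tauQ z W₁ W₂ m r (𝒱.adj.mode j u v) l₀) n₁ n₂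

lemma dualDefect_succ (hz : z ≠ 0) {l₀ : TDual W₁ W₂} (hl : l₀ ∈ COMP z W₁ W₂) (u v : V)
    (l n₁ m n₂ : ℤ) :
    dualDefect z u v l₀ (l + 1) n₁ m n₂ =
      dualDefect z u v l₀ l (n₁ + 1) m n₂ - dualDefect z u v l₀ l n₁ m (n₂ + 1) :=
  jacobiDefect_succ l (tauQ_truncRight hz hl u v 0 m) (tauQ_truncRight hz hl v u m 0)
    (tauQ_truncLeft u v l₀ m) n₁ n₂

/-- All three sums are linear in the action of v or of its iterates, which carry the factor s^m;
hence s = t + z applies to the whole defect. -/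
lemma dualDefect_succ_mid (hz : z ≠ 0) {l₀ : TDual W₁ W₂} (hl : l₀ ∈ COMP z W₁ W₂) (u v : V)
    (l n₁ m n₂ : ℤ) :
    dualDefect z u v l₀ l n₁ (m + 1) n₂ =
      dualDefect z u v l₀ l n₁ m (n₂ + 1) + z • dualDefect z u v l₀ l n₁ m n₂ := by
  simp only [dualDefect, jacobiDefect]
  rw [altSum_recurrence_right l (tauQ_truncRight hz hl u v 0 m) (c := z)
      (fun a b => by rw [tauQ_succ hz, map_add, map_smul]),
    altSum_recurrence_left l (tauQ_truncRight hz hl v u m 0) (c := z)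
      (fun b a => tauQ_succ hz _ _ _ _),
    iterSum_recurrence l n₁ (tauQ_truncLeft u v l₀ m) (c := z) (fun j r => tauQ_succ hz _ _ _ _),
    ← add_assoc]
  module

/-- Locality again, since the iterates vanish for large l; the bound depends on u and v only. -/
lemma dualDefect_of_large (hz : z ≠ 0) (u v : V) : ∃ L₀ : ℤ, ∀ l ≥ L₀,
    ∀ l₀ ∈ COMP z W₁ W₂, ∀ n₁ m n₂, dualDefect z u v l₀ l n₁ m n₂ = 0 := by
  obtain ⟨L, hL⟩ := dual_locality hz W₁ W₂ u v
  obtain ⟨L', hL'⟩ := 𝒱.exists_mode_eq_zero u v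
  refine ⟨(max L L' : ℕ), fun l hl l₀ hl₀ n₁ m n₂ => ?_⟩
  obtain ⟨d, rfl⟩ : ∃ d : ℕ, l = ((L' + d : ℕ) : ℤ) := ⟨(l - L').toNat, by omega⟩
  simp only [dualDefect, jacobiDefect]
  rw [zpow_natCast, altSum_sub_altSum_natCast (tauQ_truncRight hz hl₀ u v 0 m)
    (tauQ_truncRight hz hl₀ v u m 0), hL _ (by omega), iterSum,
    binSum_eq_zero _ fun i => by
      have := hL' (d + i)
      push_cast at this ⊢
      rw [add_assoc, this, map_zero, LinearMap.zero_apply]]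
  simp

/-- The defect vanishes when all the operators involved act trivially on `w₁`. -/
lemma dualDefect_tmul_eq_zero (hz : z ≠ 0) {l₀ : TDual W₁ W₂} (hl : l₀ ∈ COMP z W₁ W₂) (u v : V)
    (l n₁ m n₂ : ℤ) (w₁ : W₁.carrier) (w₂ : W₂.carrier)
    (hu : ∀ (a b : ℤ), a + b ≤ n₁ + l → inftyExp z W₁ a b u w₁ = 0)
    (hv : ∀ (a b : ℤ), a + b ≤ m + n₂ + l → inftyExp z W₁ a b v w₁ = 0)
    (huv : ∀ (i : ℕ) (a b : ℤ), a + b ≤ n₁ + n₂ + m →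
      inftyExp z W₁ a b (𝒱.adj.mode (l + i) u v) w₁ = 0) :
    dualDefect z u v l₀ l n₁ m n₂ (w₁ ⊗ₜ w₂) = 0 := by
  have h := expDefect_eq_zero W₂ hz u v w₂ l n₁ n₂ m
  -- Both products turn into products on W₂ in the opposite order, each with a factor (-1)^l; the
  -- one already present in the Jacobi identity cancels one of these.
  have a1 := altSum_tauQ_tmul hz hl u v l 0 n₁ m n₂ w₁ w₂ (fun k => hu _ _ (by omega))
    (fun j => hv _ _ (by omega))
  have a2 := altSum_tauQ_tmul hz hl v u l m n₂ 0 n₁ w₁ w₂ (fun k => hv _ _ (by omega))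
    (fun j => hu _ _ (by omega))
  have a3 : iterSum l n₁ (fun j r => tauQ z W₁ W₂ m r (𝒱.adj.mode j u v) l₀) (n₁ + n₂) (w₁ ⊗ₜ w₂) =
      -l₀ (w₁ ⊗ₜ iterSum l n₁ (fun j r => zeroExp z W₂ r m (𝒱.adj.mode j u v) w₂) (n₁ + n₂)) := by
    obtain ⟨K, hK⟩ := (tauQ_truncLeft (z := z) u v l₀ m).exists_nat l (n₁ + n₂)
    obtain ⟨K', hK'⟩ := (zeroExp_truncLeft (z := z) W₂ u v w₂ m).exists_nat l (n₁ + n₂)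
    rw [iterSum, binSum_eq_sum (K := max K K') _ fun i hi => hK i (by omega), iterSum,
      binSum_eq_sum (K := max K K') _ fun i hi => hK' i (by omega), LinearMap.sum_apply,
      TensorProduct.tmul_sum, map_sum, ← Finset.sum_neg_distrib]
    refine Finset.sum_congr rfl fun i _ => ?_
    rw [LinearMap.smul_apply, tauQ_tmul, huv i _ _ (by omega), TensorProduct.zero_tmul, map_zero,
      zero_sub, TensorProduct.tmul_smul, map_smul, smul_neg]
  have hsq : ((-1 : ℂ)) ^ l * (-1) ^ l = 1 := by
    rw [← mul_zpow]
    norm_num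
  rw [expDefect, sub_eq_zero] at h
  rw [← h, TensorProduct.tmul_sub, map_sub, TensorProduct.tmul_smul, map_smul] at a3
  simp only [dualDefect, jacobiDefect, LinearMap.sub_apply, LinearMap.smul_apply]
  rw [a1, a2, a3, smul_smul, hsq, one_smul]
  ring

/-- The Jacobi identity on the elements satisfying the compatibility condition. -/
lemma dualDefect_eq_zero (hz : z ≠ 0) {l₀ : TDual W₁ W₂} (hl : l₀ ∈ COMP z W₁ W₂) (u v : V)
    (l n₁ m n₂ : ℤ) : dualDefect z u v l₀ l n₁ m n₂ = 0 := by
  obtain ⟨L₀, hL₀⟩ := dualDefect_of_large (W₁ := W₁) (W₂ := W₂) hz u v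
  -- Descending induction on l, starting where locality applies.
  have key : ∀ d : ℕ, ∀ l n₁ m n₂, L₀ ≤ l + d → dualDefect z u v l₀ l n₁ m n₂ = 0 := by
    intro d
    induction d with
    | zero => exact fun l n₁ m n₂ hl' => hL₀ l (by simpa using hl') l₀ hl n₁ m n₂
    | succ d ihd =>
      intro l n₁ m n₂ hl'
      refine tdual_ext fun w₁ w₂ => ?_
      obtain ⟨Bu, hBu⟩ := exists_inftyExp_eq_zero z W₁ u w₁
      obtain ⟨Bv, hBv⟩ := exists_inftyExp_eq_zero z W₁ v w₁
      choose Buv hBuv using fun i : ℕ => exists_inftyExp_eq_zero z W₁ (𝒱.adj.mode (l + i) u v) w₁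
      obtain ⟨I, hI⟩ : ∃ I : ℕ, ∀ i ≥ I, 𝒱.adj.mode (l + (i : ℕ)) u v = 0 := by
        obtain ⟨N, hN⟩ := 𝒱.isWeak.truncation u v
        exact ⟨(N - l).toNat, fun i hi => hN _ (by omega)⟩
      obtain ⟨B, hB⟩ := ((Finset.range I).image Buv).bddBelow
      have hB' : ∀ i < I, B ≤ Buv i := fun i hi =>
        hB (Finset.mem_coe.2 (Finset.mem_image_of_mem _ (Finset.mem_range.2 hi)))
      -- At n₁ = M all operators of u that occur with the exponent l annihilate w₁.
      set M := Bu - l with hM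
      obtain ⟨Nv, hNv⟩ := (mem_COMP_iff hz).1 hl v
      obtain ⟨Nu, hNu⟩ := (mem_COMP_iff hz).1 hl u
      -- The bound must not depend on m. This is where the compatibility of τ(u ⊗ t^b)λ, and not
      -- only that of λ, is used.
      obtain ⟨N₁, hN₁⟩ := altSum_eventually_left l
        (y := fun m b a => tauQ z W₁ W₂ m b v (tauQ z W₁ W₂ 0 a u l₀))
        ⟨Nu, fun i a b hb => by rw [hNu 0 b hb, map_zero]⟩
        (fun b => (mem_COMP_iff hz).1 (tauQ_mem_COMP hz hl 0 b u) v) M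
      choose Nuv hNuv using fun i : ℕ => (mem_COMP_iff hz).1 hl (𝒱.adj.mode (l + i) u v)
      obtain ⟨C, hC⟩ := ((Finset.range I).image fun i : ℕ => Nuv i + i).bddAbove
      have hC' : ∀ i < I, Nuv i + i ≤ C := fun i hi =>
        hC (Finset.mem_coe.2 (Finset.mem_image_of_mem _ (Finset.mem_range.2 hi)))
      -- For a large exponent n₂ of t all three sums vanish, uniformly in m.
      have large : ∀ m n₂, max (max Nv N₁) (C - M) ≤ n₂ →
          dualDefect z u v l₀ l M m n₂ = 0 := by
        intro m n₂ hn
        simp only [dualDefect, jacobiDefect]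
        rw [altSum_eq_zero l fun k => by rw [hNv _ _ (by omega), map_zero], hN₁ m n₂ (by omega),
          iterSum, binSum_eq_zero _ fun i => ?_]
        · simp
        · by_cases hi : i < I
          · exact hNuv i _ _ (by have := hC' i hi; omega)
          · rw [hI i (not_lt.1 hi), map_zero, LinearMap.zero_apply]
      -- For very negative m + n₂ everything annihilates w₁ and the Jacobi identity on W₂ applies.
      have decay : ∀ m n₂, m + n₂ ≤ min (Bv - l) (B - M) →
          dualDefect z u v l₀ l M m n₂ (w₁ ⊗ₜ w₂) = 0 := by
        intro m n₂ hmn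
        refine dualDefect_tmul_eq_zero hz hl u v l M m n₂ w₁ w₂
          (fun a b hab => hBu _ _ (by omega)) (fun a b hab => hBv _ _ (by omega))
          fun i a b hab => ?_
        by_cases hi : i < I
        · exact hBuv i _ _ (by have := hB' i hi; omega)
        · rw [hI i (not_lt.1 hi), map_zero, LinearMap.zero_apply]
      obtain ⟨N₂, hN₂⟩ : ∃ N, N = max (max Nv N₁) (C - M) := ⟨_, rfl⟩
      obtain ⟨D, hD⟩ : ∃ D, D = min (Bv - l) (B - M) := ⟨_, rfl⟩
      -- In the row m = D - N₂ either n₂ ≥ N₂ or m + n₂ < D, so the two regions cover it. Rows above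
      -- follow by the recurrence; rows below are covered in the same way.
      have up : ∀ e : ℕ, ∀ n₂, dualDefect z u v l₀ l M (D - N₂ + e) n₂ (w₁ ⊗ₜ w₂) = 0 := by
        intro e
        induction e with
        | zero =>
          intro n₂
          by_cases h : N₂ ≤ n₂
          · rw [large _ n₂ (hN₂ ▸ h)]
            rfl
          · exact decay _ n₂ (by rw [← hD]; push_cast; omega)
        | succ e ihe =>
          intro n₂
          rw [Nat.cast_succ, ← add_assoc, dualDefect_succ_mid hz hl, LinearMap.add_apply,
            LinearMap.smul_apply, ihe, ihe, smul_zero, add_zero]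
      have all : ∀ m n₂, dualDefect z u v l₀ l M m n₂ (w₁ ⊗ₜ w₂) = 0 := by
        intro m n₂
        by_cases h : D - N₂ ≤ m
        · obtain ⟨e, he⟩ := Int.le.dest h
          rw [← he]
          exact up e n₂
        · by_cases h' : N₂ ≤ n₂
          · rw [large _ n₂ (hN₂ ▸ h')]
            rfl
          · exact decay _ n₂ (by rw [← hD]; omega)
      -- Since the defect vanishes for l + 1, for l it depends on n₁ + n₂ only, and n₁ may be
      -- replaced by M.
      have shift := eq_of_shift (e := fun a b => dualDefect z u v l₀ l a m b) (fun a b => by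
        have h := dualDefect_succ hz hl u v l a m b
        rw [ihd (l + 1) a m b (by push_cast at hl'; omega)] at h
        exact (sub_eq_zero.1 h.symm)) M n₂ (n₁ - M)
      simp only [add_sub_cancel] at shift
      rw [shift, all]
      rfl
  exact key (L₀ - l).toNat l n₁ m n₂ (by omega)

/-- A stable subspace of elements satisfying the compatibility condition is a weak module. -/
lemma isWeakModule_restrict (hz : z ≠ 0) (S : Submodule ℂ (TDual W₁ W₂))
    (hS : (S : Set (TDual W₁ W₂)) ⊆ COMP z W₁ W₂)
    (h : (dualAct z W₁ W₂).toVertexAction.Stable S) :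
    IsWeakModule 𝒱.adj 𝒱.one 𝒱.omega ((dualAct z W₁ W₂).toVertexAction.restrict S h) where
  truncation v w := by
    obtain ⟨N, hN⟩ := (hS w.2).1 v
    exact ⟨N, fun n hn => Subtype.ext (hN n hn)⟩
  vacuum n w := by
    refine Subtype.ext ((dual_vacuum n (w : TDual W₁ W₂)).trans ?_)
    split_ifs <;> rfl
  jacobi u v w l m n := by
    have h0 := dualDefect_eq_zero hz (hS w.2) u v l m 0 n
    rw [dualDefect, jacobiDefect, sub_eq_zero] at h0
    have inj := Subtype.coe_injective (p := fun x => x ∈ S)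
    have y1 := tauQ_truncRight hz (hS w.2) u v 0 0
    have y2 := tauQ_truncRight hz (hS w.2) v u 0 0
    obtain ⟨K₁, hK₁⟩ := y1
    obtain ⟨K₂, hK₂⟩ := y2
    obtain ⟨K₃, hK₃⟩ := (tauQ_truncLeft (z := z) u v (w : TDual W₁ W₂) 0).exists_nat l (m + n)
    refine inj ?_
    set D := (dualAct z W₁ W₂).toVertexAction.restrict S h
    have e1 := map_altSum S.subtype l (y := fun a b => D.mode a u (D.mode b v w))
      ⟨K₁, fun a b hb => inj (hK₁ a b hb)⟩ m n
    have e2 := map_altSum S.subtype l (y := fun b a => D.mode b v (D.mode a u w))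
      ⟨K₂, fun a b hb => inj (hK₂ a b hb)⟩ n m
    have e3 := map_binSum S.subtype m
      (g := fun k : ℕ => D.mode (m + n - k) (𝒱.adj.mode (l + k) u v) w)
      ⟨K₃, fun k hk => inj (hK₃ k hk)⟩
    rw [← altSum_eq_finsum l (fun a b => D.mode a u (D.mode b v w)),
      ← altSum_eq_finsum l (fun b a => D.mode b v (D.mode a u w))]
    change S.subtype (altSum l _ m n - (-1 : ℂ) ^ l • altSum l _ n m) = S.subtype (binSum m _)
    rw [map_sub, map_smul, e1, e2, e3]
    exact h0
  derivative n v w := Subtype.ext (dual_derivative hz n v (w : TDual W₁ W₂))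
  bracket_zero_neg w := Subtype.ext (dual_bracket_zero_neg (w : TDual W₁ W₂))
  bracket_zero_one w := Subtype.ext (dual_bracket_zero_one (w : TDual W₁ W₂))
  bracket_neg_one w := Subtype.ext (dual_bracket_neg_one (w : TDual W₁ W₂))
  comm_neg n v w := Subtype.ext (dual_comm_neg hz 0 n v (w : TDual W₁ W₂))
  comm_zero n v w := Subtype.ext (dual_comm_zero hz 0 n v (w : TDual W₁ W₂))
  comm_one n v w := Subtype.ext (dual_comm_one hz 0 n v (w : TDual W₁ W₂))
  conformal ω hω w :=
    have h := dual_conformal hz hω (w : TDual W₁ W₂)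
    ⟨Subtype.ext h.1, Subtype.ext h.2.1, Subtype.ext h.2.2⟩

end HLZ

namespace HLZ

open Filter

/-! ### Homogeneous subspaces -/

section Homogeneous

variable {ι κ : Type*} {M N : Type*} [AddCommGroup M] [Module ℂ M] [AddCommGroup N] [Module ℂ N]

/-- A subspace `S` that contains the summands of each finite sum of homogeneous elements that it
contains. -/
def Homogeneous (G : ι → Submodule ℂ M) (S : Submodule ℂ M) : Prop :=
  ∀ (s : Finset ι) (f : ι → M), (∀ i ∈ s, f i ∈ G i) → ∑ i ∈ s, f i ∈ S → ∀ i ∈ s, f i ∈ S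

lemma mem_iSup_iff_exists_finset {G : ι → Submodule ℂ M} {x : M} :
    x ∈ ⨆ i, G i ↔ ∃ (s : Finset ι) (f : ι → M), (∀ i ∈ s, f i ∈ G i) ∧ ∑ i ∈ s, f i = x := by
  constructor
  · intro h
    obtain ⟨f, hf, rfl⟩ := (Submodule.mem_iSup_iff_exists_finsupp _ _).1 h
    exact ⟨f.support, f, fun i _ => hf i, rfl⟩
  · rintro ⟨s, f, hf, rfl⟩
    exact Submodule.sum_mem _ fun i hi => Submodule.mem_iSup_of_mem i (hf i hi)

lemma homogeneous_bot_iff {G : ι → Submodule ℂ M} : Homogeneous G ⊥ ↔ iSupIndep G := by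
  rw [iSupIndep_iff_finsetSum_eq_zero_imp_eq_zero]
  simp only [Homogeneous, Submodule.mem_bot]

lemma Homogeneous.eq_iSup {G : ι → Submodule ℂ M} {S : Submodule ℂ M} (hS : Homogeneous G S)
    (h : S ≤ ⨆ i, G i) : S = ⨆ i, S ⊓ G i := by
  refine le_antisymm (fun x hx => ?_) (iSup_le fun i => inf_le_left)
  obtain ⟨s, f, hf, rfl⟩ := mem_iSup_iff_exists_finset.1 (h hx)
  exact mem_iSup_iff_exists_finset.2 ⟨s, f, fun i hi => ⟨hS s f hf hx i hi, hf i hi⟩, rfl⟩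

lemma homogeneous_inf {G : ι → Submodule ℂ M} {S T : Submodule ℂ M} (hS : Homogeneous G S)
    (hT : Homogeneous G T) : Homogeneous G (S ⊓ T) :=
  fun s f hf h i hi => ⟨hS s f hf h.1 i hi, hT s f hf h.2 i hi⟩

lemma homogeneous_sInf {G : ι → Submodule ℂ M} {F : Set (Submodule ℂ M)}
    (h : ∀ S ∈ F, Homogeneous G S) : Homogeneous G (sInf F) := fun s f hf hx i hi => by
  rw [Submodule.mem_sInf] at hx ⊢
  exact fun S hS => h S hS s f hf (hx S hS) i hi

/-- The homogeneous components of a sum of subspaces of the homogeneous subspaces. -/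
lemma iSup_inf_eq {G T : ι → Submodule ℂ M} (hG : iSupIndep G) (hT : ∀ i, T i ≤ G i) (i : ι) :
    (⨆ j, T j) ⊓ G i = T i := by
  have h1 : ⨆ j, T j = T i ⊔ ⨆ (j) (_ : j ≠ i), T j := by
    refine le_antisymm (iSup_le fun j => ?_)
      (sup_le (le_iSup T i) (iSup_le fun j => iSup_le fun _ => le_iSup T j))
    by_cases h : j = i
    · exact h ▸ le_sup_left
    · exact le_sup_of_le_right (le_iSup₂_of_le j h le_rfl)
  have h2 : (⨆ (j) (_ : j ≠ i), T j) ⊓ G i = ⊥ := by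
    rw [inf_comm]
    exact ((hG i).mono_right (iSup₂_mono fun j _ => hT j)).eq_bot
  rw [h1, sup_inf_assoc_of_le _ (hT i), h2, sup_bot_eq]

lemma homogeneous_iSup {G T : ι → Submodule ℂ M} (hG : iSupIndep G) (hT : ∀ i, T i ≤ G i) :
    Homogeneous G (⨆ i, T i) := by
  classical
  intro s f hf h i hi
  obtain ⟨t, g, hg, he⟩ := mem_iSup_iff_exists_finset.1 h
  have := (iSupIndep_iff_finsetSum_eq_imp_eq G).1 hG (s ∪ t)
    (fun j => if j ∈ s then f j else 0) (fun j => if j ∈ t then g j else 0)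
    (fun j _ => ⟨by
      split_ifs with hj
      exacts [hf j hj, zero_mem _], by
      split_ifs with hj
      exacts [hT j (hg j hj), zero_mem _]⟩)
    (by
      rw [Finset.sum_ite_mem, Finset.sum_ite_mem, Finset.union_inter_cancel_left,
        Finset.union_inter_cancel_right, he]) i (Finset.mem_union_left _ hi)
  simp only [hi, if_true] at this
  rw [this]
  split_ifs with hj
  exacts [Submodule.mem_iSup_of_mem i (hg i hj), zero_mem _]

lemma homogeneous_of_eq_iSup {G : ι → Submodule ℂ M} (hG : iSupIndep G) {S : Submodule ℂ M}
    (h : S = ⨆ i, S ⊓ G i) : Homogeneous G S := by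
  rw [h]
  exact homogeneous_iSup hG fun i => inf_le_right

/-- The terms with a given second index are collected first, and their sum is then separated by the
first index. -/
lemma Homogeneous.prod {G : ι → Submodule ℂ M} {E : κ → Submodule ℂ M} {S : Submodule ℂ M}
    (hG : Homogeneous G S) (hE : Homogeneous E S) :
    Homogeneous (fun p : κ × ι => G p.2 ⊓ E p.1) S := by
  classical
  intro s f hf h p hp
  have h1 : ∑ q ∈ s with q.2 = p.2, f q ∈ S := by
    refine hG (s.image Prod.snd) (fun b => ∑ q ∈ s with q.2 = b, f q) (fun b _ => ?_) ?_ p.2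
      (Finset.mem_image_of_mem _ hp)
    · refine Submodule.sum_mem _ fun q hq => ?_
      rw [Finset.mem_filter] at hq
      exact hq.2 ▸ (hf q hq.1).1
    · convert h using 1
      convert Finset.sum_fiberwise_of_maps_to (g := Prod.snd)
        (fun q hq => Finset.mem_image_of_mem Prod.snd hq) f
  have h2 : ∑ n ∈ (s.filter fun q => q.2 = p.2).image Prod.fst, f (n, p.2) =
      ∑ q ∈ s with q.2 = p.2, f q := by
    rw [Finset.sum_image]
    · refine Finset.sum_congr rfl fun q hq => ?_
      rw [← (Finset.mem_filter.1 hq).2]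
    · intro q hq r hr e
      simp only [Finset.coe_filter, Set.mem_ofPred_eq] at hq hr
      exact Prod.ext e (hq.2.trans hr.2.symm)
  refine hE ((s.filter fun q => q.2 = p.2).image Prod.fst) (fun n => f (n, p.2)) (fun n hn => ?_)
    (h2 ▸ h1) p.1
    (Finset.mem_image.2 ⟨p, Finset.mem_filter.2 ⟨hp, rfl⟩, rfl⟩)
  obtain ⟨q, hq, rfl⟩ := Finset.mem_image.1 hn
  rw [Finset.mem_filter] at hq
  rw [← hq.2]
  exact (hf q hq.1).2

/-- A subspace that is stable under an endomorphism is homogeneous for its generalized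
eigenspaces. -/
lemma homogeneous_maxGenEigenspace (L : End ℂ M) {S : Submodule ℂ M} (hS : ∀ x ∈ S, L x ∈ S) :
    Homogeneous L.maxGenEigenspace S := by
  -- The claim is the independence of generalized eigenspaces for the map induced on the quotient by
  -- S.
  let Q : End ℂ (M ⧸ S) := S.mapQ S L hS
  have hc : ∀ (μ : ℂ) (k : ℕ) (x : M),
      ((Q - μ • 1) ^ k) (S.mkQ x) = S.mkQ (((L - μ • 1) ^ k) x) := by
    intro μ k
    induction k with
    | zero => simp
    | succ k ih =>
      intro x
      rw [pow_succ, pow_succ, Module.End.mul_apply, Module.End.mul_apply, ← ih]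
      congr 1
  intro s f hf h i hi
  have h1 := (homogeneous_bot_iff.2 Q.independent_maxGenEigenspace) s (fun i => S.mkQ (f i))
    (fun i hi => by
      obtain ⟨k, hk⟩ := Module.End.mem_maxGenEigenspace _ _ _ |>.1 (hf i hi)
      refine (Module.End.mem_maxGenEigenspace _ _ _).2 ⟨k, ?_⟩
      rw [hc, hk, map_zero])
    (by rw [← map_sum]; exact (Submodule.Quotient.mk_eq_zero S).2 h) i hi
  simpa using h1

lemma pow_sub_smul_comm {f : End ℂ M} {g : End ℂ N} {T : M →ₗ[ℂ] N} {c : ℂ}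
    (h : ∀ x, g (T x) = T (f x) + c • T x) (μ : ℂ) (k : ℕ) (x : M) :
    ((g - (μ + c) • 1) ^ k) (T x) = T (((f - μ • 1) ^ k) x) := by
  induction k generalizing x with
  | zero => simp
  | succ k ih =>
    rw [pow_succ, pow_succ, Module.End.mul_apply, Module.End.mul_apply, ← ih]
    congr 1
    simp only [LinearMap.sub_apply, LinearMap.smul_apply, Module.End.one_apply, h, map_sub,
      map_smul]
    module

/-- A linear map which shifts the eigenvalues of an endomorphism. -/
lemma map_mem_maxGenEigenspace {f : End ℂ M} {g : End ℂ N} {T : M →ₗ[ℂ] N} {c : ℂ}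
    (h : ∀ x, g (T x) = T (f x) + c • T x) {μ : ℂ} {x : M} (hx : x ∈ f.maxGenEigenspace μ) :
    T x ∈ g.maxGenEigenspace (μ + c) := by
  rw [Module.End.mem_maxGenEigenspace] at hx ⊢
  obtain ⟨k, hk⟩ := hx
  exact ⟨k, by rw [pow_sub_smul_comm h, hk, map_zero]⟩

lemma map_mem_eigenspace {f : End ℂ M} {g : End ℂ N} {T : M →ₗ[ℂ] N} {c : ℂ}
    (h : ∀ x, g (T x) = T (f x) + c • T x) {μ : ℂ} {x : M} (hx : x ∈ f.eigenspace μ) :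
    T x ∈ g.eigenspace (μ + c) := by
  rw [Module.End.mem_eigenspace_iff] at hx ⊢
  rw [h, hx, map_smul, add_smul]

end Homogeneous

variable {Γ : Type v} [AddCommGroup Γ] {A : AddSubgroup Γ} {V : Type w} [AddCommGroup V]
  [Module ℂ V] {𝒱 : VertexAlg A V}

lemma VertexAlg.gr_le_of_wt {α : A} {S : Submodule ℂ V} (h : ∀ n, 𝒱.gr α ⊓ 𝒱.wt n ≤ S) :
    𝒱.gr α ≤ S := by
  rw [𝒱.gr_compat α]
  exact iSup_le h

/-- A subspace of `V` is everything when it contains the homogeneous elements. -/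
lemma VertexAlg.mem_of_gr_le {S : Submodule ℂ V} (h : ∀ α, 𝒱.gr α ≤ S) (v : V) : v ∈ S := by
  have : (⊤ : Submodule ℂ V) ≤ S := by
    rw [← 𝒱.gr_iSup]
    exact iSup_le h
  exact this trivial

lemma VertexAlg.Lone_pow_mem_gr {α : A} {v : V} (hv : v ∈ 𝒱.gr α) (p : ℕ) :
    (𝒱.adj.Lone ^ p) v ∈ 𝒱.gr α := by
  induction p with
  | zero => simpa using hv
  | succ p ih =>
    rw [pow_succ', Module.End.mul_apply]
    exact 𝒱.gr_one α _ ih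

/-! ### Gradings on the modules and on the dual space -/

section Modules

variable {z : ℂ} (W : GenMod.{u} 𝒱)

lemma oppMode_mem_gr (n : ℤ) {α : A} {v : V} (hv : v ∈ 𝒱.gr α) {γ : Γ} {w : W.carrier}
    (hw : w ∈ W.act.gr γ) : 𝒱.oppMode W.act.toVertexAction n v w ∈ W.act.gr (α + γ) := by
  suffices h : 𝒱.gr α ≤ (W.act.gr (α + γ)).comap
      ((𝒱.oppMode W.act.toVertexAction n).flip w) from h hv
  refine VertexAlg.gr_le_of_wt fun h v hv => ?_
  obtain ⟨K, hK⟩ := 𝒱.Lone_nilp v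
  rw [Submodule.mem_comap, LinearMap.flip_apply, 𝒱.oppMode_of_mem _ n hv.2 w hK]
  exact Submodule.smul_mem _ _ (Submodule.sum_mem _ fun p _ => Submodule.smul_mem _ _
    (W.isGenModule.gr_mode _ _ _ _ (VertexAlg.Lone_pow_mem_gr hv.1 p) _ hw))

lemma inftyExp_mem_gr (a n : ℤ) {α : A} {v : V} (hv : v ∈ 𝒱.gr α) {γ : Γ} {w : W.carrier}
    (hw : w ∈ W.act.gr γ) : inftyExp z W a n v w ∈ W.act.gr (α + γ) := by
  change ∑ᶠ k : ℕ, _ ∈ _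
  exact finsum_induction (· ∈ W.act.gr (α + γ)) (zero_mem _) (fun _ _ => add_mem)
    fun k => Submodule.smul_mem _ _ (oppMode_mem_gr W _ hv hw)

lemma zeroExp_mem_gr (a n : ℤ) {α : A} {v : V} (hv : v ∈ 𝒱.gr α) {γ : Γ} {w : W.carrier}
    (hw : w ∈ W.act.gr γ) : zeroExp z W a n v w ∈ W.act.gr (α + γ) := by
  change ∑ᶠ k : ℕ, _ ∈ _
  exact finsum_induction (· ∈ W.act.gr (α + γ)) (zero_mem _) (fun _ _ => add_mem)
    fun k => Submodule.smul_mem _ _ (W.isGenModule.gr_mode _ _ _ _ hv _ hw)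

lemma GenMod.mem_of_gr_le {W : GenMod.{u} 𝒱} {S : Submodule ℂ W.carrier}
    (h : ∀ γ, W.act.gr γ ≤ S) (w : W.carrier) : w ∈ S := by
  have : (⊤ : Submodule ℂ W.carrier) ≤ S := by
    rw [← W.isGenModule.gr_iSup]
    exact iSup_le h
  exact this trivial

end Modules

section Dual

variable {z : ℂ} {W₁ W₂ : GenMod.{u} 𝒱}

/-- The operators `τ(v ⊗ f)` are compatible with the gradings. -/
lemma tauQ_mem_gr (m n : ℤ) {α : A} {v : V} (hv : v ∈ 𝒱.gr α) {β : Γ} {l : TDual W₁ W₂}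
    (hl : l ∈ (dualAct z W₁ W₂).gr β) :
    tauQ z W₁ W₂ m n v l ∈ (dualAct z W₁ W₂).gr (α + β) := by
  intro γ₁ γ₂ h w₁ h₁ w₂ h₂
  rw [tauQ_tmul, hl (α + γ₁) γ₂ (fun e => h ?_) _ (inftyExp_mem_gr W₁ _ _ hv h₁) _ h₂,
    hl γ₁ (α + γ₂) (fun e => h ?_) _ h₁ _ (zeroExp_mem_gr W₂ _ _ hv h₂), sub_zero]
  · rw [neg_add, ← e]
    abel
  · rw [neg_add, ← e]
    abel

lemma dualDiff_mem_gr {S : End ℂ W₁.carrier} {T : End ℂ W₂.carrier}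
    (hS : ∀ γ, ∀ w ∈ W₁.act.gr γ, S w ∈ W₁.act.gr γ)
    (hT : ∀ γ, ∀ w ∈ W₂.act.gr γ, T w ∈ W₂.act.gr γ) {β : Γ} {l : TDual W₁ W₂}
    (hl : l ∈ (dualAct z W₁ W₂).gr β) : dualDiff W₁ W₂ S T l ∈ (dualAct z W₁ W₂).gr β := by
  intro γ₁ γ₂ h w₁ h₁ w₂ h₂
  rw [dualDiff_tmul, hl γ₁ γ₂ h _ (hS _ _ h₁) _ h₂, hl γ₁ γ₂ h _ h₁ _ (hT _ _ h₂), sub_zero]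

lemma Lneg_mem_gr {β : Γ} {l : TDual W₁ W₂} (hl : l ∈ (dualAct z W₁ W₂).gr β) :
    (dualAct z W₁ W₂).Lneg l ∈ (dualAct z W₁ W₂).gr β :=
  dualDiff_mem_gr W₁.isGenModule.gr_one W₂.isGenModule.gr_neg hl

lemma Lzero_mem_gr {β : Γ} {l : TDual W₁ W₂} (hl : l ∈ (dualAct z W₁ W₂).gr β) :
    (dualAct z W₁ W₂).Lzero l ∈ (dualAct z W₁ W₂).gr β :=
  dualDiff_mem_gr
    (fun γ w hw => sub_mem (W₁.isGenModule.gr_zero γ w hw)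
      (Submodule.smul_mem _ z (W₁.isGenModule.gr_one γ w hw)))
    (fun γ w hw => sub_mem (W₂.isGenModule.gr_zero γ w hw)
      (Submodule.smul_mem _ z (W₂.isGenModule.gr_neg γ w hw))) hl

lemma Lone_mem_gr {β : Γ} {l : TDual W₁ W₂} (hl : l ∈ (dualAct z W₁ W₂).gr β) :
    (dualAct z W₁ W₂).Lone l ∈ (dualAct z W₁ W₂).gr β :=
  dualDiff_mem_gr
    (fun γ w hw => add_mem (sub_mem (W₁.isGenModule.gr_neg γ w hw)
      (Submodule.smul_mem _ (2 * z) (W₁.isGenModule.gr_zero γ w hw)))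
      (Submodule.smul_mem _ (z ^ 2) (W₁.isGenModule.gr_one γ w hw)))
    (fun γ w hw => add_mem (sub_mem (W₂.isGenModule.gr_one γ w hw)
      (Submodule.smul_mem _ (2 * z) (W₂.isGenModule.gr_zero γ w hw)))
      (Submodule.smul_mem _ (z ^ 2) (W₂.isGenModule.gr_neg γ w hw))) hl

lemma tdual_eq_zero_of_gr {l : TDual W₁ W₂} (h : ∀ γ₁ γ₂, ∀ w₁ ∈ W₁.act.gr γ₁,
    ∀ w₂ ∈ W₂.act.gr γ₂, l (w₁ ⊗ₜ[ℂ] w₂) = 0) : l = 0 := by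
  refine tdual_ext fun w₁ w₂ => ?_
  refine GenMod.mem_of_gr_le (S := LinearMap.ker (l ∘ₗ (TensorProduct.mk ℂ _ _).flip w₂))
    (fun γ₁ w₁ h₁ => ?_) w₁
  refine GenMod.mem_of_gr_le (S := LinearMap.ker (l ∘ₗ TensorProduct.mk ℂ _ _ w₁))
    (fun γ₂ w₂ h₂ => ?_) w₂
  exact h γ₁ γ₂ w₁ h₁ w₂ h₂

variable (z W₁ W₂)

/-- On W₁^(γ₁) ⊗ W₂^(γ₂) only the component of degree -(γ₁+γ₂) can be nonzero, so evaluation there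
isolates one summand. -/
lemma dual_gr_indep : iSupIndep (dualAct z W₁ W₂).gr := by
  rw [← homogeneous_bot_iff]
  intro s f hf hs β hβ
  refine tdual_eq_zero_of_gr fun γ₁ γ₂ w₁ h₁ w₂ h₂ => ?_
  by_cases h : γ₁ + γ₂ = -β
  · have h1 := congrArg (fun l : TDual W₁ W₂ => l (w₁ ⊗ₜ w₂)) ((Submodule.mem_bot ℂ).1 hs)
    simp only [LinearMap.sum_apply, LinearMap.zero_apply] at h1
    rwa [Finset.sum_eq_single_of_mem β hβ fun γ hγ hne => hf γ hγ γ₁ γ₂ (fun e => hne ?_) w₁ h₁ w₂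
      h₂] at h1
    rw [← neg_inj, ← e, h]
  · exact hf β hβ γ₁ γ₂ h w₁ h₁ w₂ h₂

lemma dual_genWt_indep : iSupIndep fun p : ℂ × Γ => (dualAct z W₁ W₂).genWt p.1 p.2 :=
  homogeneous_bot_iff.1 ((homogeneous_bot_iff.2 (dual_gr_indep z W₁ W₂)).prod
    (homogeneous_maxGenEigenspace _ fun x hx => by
      rw [Submodule.mem_bot] at hx ⊢
      rw [hx, map_zero]))

variable {z W₁ W₂}

/-- Homogeneous vectors act with a definite weight. -/
lemma Lzero_tauQ_of_wt (hz : z ≠ 0) (n : ℤ) {h : ℤ} {v : V} (hv : v ∈ 𝒱.wt h) (l : TDual W₁ W₂) :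
    (dualAct z W₁ W₂).Lzero (tauQ z W₁ W₂ 0 n v l) =
      tauQ z W₁ W₂ 0 n v ((dualAct z W₁ W₂).Lzero l) +
        ((h - n - 1 : ℤ) : ℂ) • tauQ z W₁ W₂ 0 n v l := by
  have h1 := dual_comm_zero hz 0 n v l
  rw [dual_derivative hz, 𝒱.mem_wt.1 hv, map_smul, LinearMap.smul_apply, add_sub_cancel_right,
    sub_eq_iff_eq_add] at h1
  rw [h1]
  push_cast
  module

lemma Lzero_Lneg (l : TDual W₁ W₂) :
    (dualAct z W₁ W₂).Lzero ((dualAct z W₁ W₂).Lneg l) =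
      (dualAct z W₁ W₂).Lneg ((dualAct z W₁ W₂).Lzero l) + (1 : ℂ) • (dualAct z W₁ W₂).Lneg l := by
  rw [one_smul, ← sub_eq_iff_eq_add', dual_bracket_zero_neg]

lemma Lzero_Lone (l : TDual W₁ W₂) :
    (dualAct z W₁ W₂).Lzero ((dualAct z W₁ W₂).Lone l) =
      (dualAct z W₁ W₂).Lone ((dualAct z W₁ W₂).Lzero l) +
        (-1 : ℂ) • (dualAct z W₁ W₂).Lone l := by
  rw [neg_one_smul, ← sub_eq_iff_eq_add', dual_bracket_zero_one]

/-- A sum of doubly homogeneous subspaces is stable when the operators move these subspaces. -/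
lemma stable_iSup {G : ℂ × Γ → Submodule ℂ (TDual W₁ W₂)}
    (hm : ∀ (n h : ℤ) (α : A) (p : ℂ × Γ), ∀ v ∈ 𝒱.gr α ⊓ 𝒱.wt h, ∀ l ∈ G p,
      tauQ z W₁ W₂ 0 n v l ∈ G (p.1 + (h - n - 1 : ℤ), α + p.2))
    (hneg : ∀ p, ∀ l ∈ G p, (dualAct z W₁ W₂).Lneg l ∈ G (p.1 + 1, p.2))
    (hzero : ∀ p, ∀ l ∈ G p, (dualAct z W₁ W₂).Lzero l ∈ G p)
    (hone : ∀ p, ∀ l ∈ G p, (dualAct z W₁ W₂).Lone l ∈ G (p.1 + -1, p.2)) :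
    (dualAct z W₁ W₂).toVertexAction.Stable (⨆ p, G p) := by
  have key : ∀ (T : End ℂ (TDual W₁ W₂)), (∀ p, ∀ l ∈ G p, T l ∈ ⨆ p, G p) →
      ∀ l ∈ ⨆ p, G p, T l ∈ ⨆ p, G p := fun T h => by
    change ⨆ p, G p ≤ Submodule.comap T (⨆ p, G p)
    exact iSup_le fun p l hl => h p l hl
  refine ⟨fun n v l hl => ?_, key _ fun p l hl => Submodule.mem_iSup_of_mem _ (hneg p l hl),
    key _ fun p l hl => Submodule.mem_iSup_of_mem _ (hzero p l hl),
    key _ fun p l hl => Submodule.mem_iSup_of_mem _ (hone p l hl)⟩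
  refine VertexAlg.mem_of_gr_le (𝒱 := 𝒱) (S := (⨆ p, G p).comap ((tauQ z W₁ W₂ 0 n).flip l))
    (fun (α : A) => VertexAlg.gr_le_of_wt (𝒱 := 𝒱) fun h v hv => ?_) v
  exact key (tauQ z W₁ W₂ 0 n v)
    (fun p l hl => Submodule.mem_iSup_of_mem _ (hm n h α p v hv l hl)) l hl

lemma stable_iSup_genWt (hz : z ≠ 0) (W₁ W₂ : GenMod.{u} 𝒱) :
    (dualAct z W₁ W₂).toVertexAction.Stable
      (⨆ p : ℂ × Γ, (dualAct z W₁ W₂).genWt p.1 p.2) :=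
  stable_iSup (G := fun p : ℂ × Γ => (dualAct z W₁ W₂).genWt p.1 p.2)
    (fun n _ _ _ _ hv _ hl => ⟨tauQ_mem_gr 0 n hv.1 hl.1,
      map_mem_maxGenEigenspace (Lzero_tauQ_of_wt hz n hv.2) hl.2⟩)
    (fun _ _ hl => ⟨Lneg_mem_gr hl.1, map_mem_maxGenEigenspace Lzero_Lneg hl.2⟩)
    (fun p _ hl => ⟨Lzero_mem_gr hl.1,
      Module.End.mapsTo_maxGenEigenspace_of_comm (Commute.refl _) p.1 hl.2⟩)
    (fun _ _ hl => ⟨Lone_mem_gr hl.1, map_mem_maxGenEigenspace Lzero_Lone hl.2⟩)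

lemma stable_iSup_ordWt (hz : z ≠ 0) (W₁ W₂ : GenMod.{u} 𝒱) :
    (dualAct z W₁ W₂).toVertexAction.Stable
      (⨆ p : ℂ × Γ, (dualAct z W₁ W₂).ordWt p.1 p.2) :=
  stable_iSup (G := fun p : ℂ × Γ => (dualAct z W₁ W₂).ordWt p.1 p.2)
    (fun n _ _ _ _ hv _ hl => ⟨tauQ_mem_gr 0 n hv.1 hl.1,
      map_mem_eigenspace (Lzero_tauQ_of_wt hz n hv.2) hl.2⟩)
    (fun _ _ hl => ⟨Lneg_mem_gr hl.1, map_mem_eigenspace Lzero_Lneg hl.2⟩)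
    (fun p _ hl => ⟨Lzero_mem_gr hl.1, by
      rw [Module.End.mem_eigenspace_iff.1 hl.2]
      exact Submodule.smul_mem _ _ hl.2⟩)
    (fun _ _ hl => ⟨Lone_mem_gr hl.1, map_mem_eigenspace Lzero_Lone hl.2⟩)

/-- The compatibility condition can be tested on homogeneous components. -/
lemma homogeneous_compSubmodule (hz : z ≠ 0) (W₁ W₂ : GenMod.{u} 𝒱) :
    Homogeneous (fun p : ℂ × Γ => (dualAct z W₁ W₂).genWt p.1 p.2)
      (compSubmodule (W₁ := W₁) (W₂ := W₂) hz) := by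
  refine Homogeneous.prod (G := (dualAct z W₁ W₂).gr) ?_
    (homogeneous_maxGenEigenspace _ fun l hl => (compSubmodule_stable hz).zero_mem l hl)
  intro s f hf hs β hβ
  rw [mem_compSubmodule, mem_COMP_iff hz] at hs ⊢
  -- The vectors for which the component `f β` is uniformly truncated form a subspace, so it
  -- suffices to treat homogeneous v.
  let S : Submodule ℂ V :=
    { carrier := {v | ∃ N : ℤ, ∀ m, ∀ n ≥ N, tauQ z W₁ W₂ m n v (f β) = 0}
      zero_mem' := ⟨0, fun m n _ => by rw [map_zero, LinearMap.zero_apply]⟩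
      add_mem' := by
        rintro a b ⟨N, hN⟩ ⟨M, hM⟩
        refine ⟨max N M, fun m n hn => ?_⟩
        rw [map_add, LinearMap.add_apply, hN m n (le_trans (le_max_left _ _) hn),
          hM m n (le_trans (le_max_right _ _) hn), add_zero]
      smul_mem' := by
        rintro c a ⟨N, hN⟩
        exact ⟨N, fun m n hn => by
          rw [map_smul, LinearMap.smul_apply, hN m n hn, smul_zero]⟩ }
  refine VertexAlg.mem_of_gr_le (𝒱 := 𝒱) (S := S) fun α v hv => ?_
  obtain ⟨N, hN⟩ := hs v
  refine ⟨N, fun m n hn => ?_⟩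
  have h1 := hN m n hn
  rw [map_sum] at h1
  -- A vector of degree α shifts all degrees by α, so distinct components remain independent and the
  -- bound for the sum serves for each.
  have h2 : iSupIndep fun β => (dualAct z W₁ W₂).gr ((α : Γ) + β) :=
    (dual_gr_indep z W₁ W₂).comp (add_right_injective _)
  exact homogeneous_bot_iff.2 h2 s (fun β => tauQ z W₁ W₂ m n v (f β))
    (fun β hβ => tauQ_mem_gr m n hv (hf β hβ)) h1 β hβ

end Dual

/-! ### Local grading restriction and the modules W_λ -/

/-- The conditions on the subspace `W_λ` in the local grading restriction condition. -/
structure GradingRestricted (z : ℂ) (W₁ W₂ : GenMod.{u} 𝒱) (S : Submodule ℂ (TDual W₁ W₂)) :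
    Prop where
  stable : (dualAct z W₁ W₂).toVertexAction.Stable S
  graded : S = ⨆ p : ℂ × Γ, S ⊓ (dualAct z W₁ W₂).genWt p.1 p.2
  finite : ∀ (n : ℂ) (β : Γ), FiniteDimensional ℂ ↥(S ⊓ (dualAct z W₁ W₂).genWt n β)
  lower : ∀ (n : ℂ) (β : Γ), ∃ N : ℤ, ∀ k ≤ N, S ⊓ (dualAct z W₁ W₂).genWt (n + k) β = ⊥

section

variable {z : ℂ} {W₁ W₂ : GenMod.{u} 𝒱}

lemma stable_bot : (dualAct z W₁ W₂).toVertexAction.Stable ⊥ := by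
  constructor
  · intro n v w hw
    rw [(Submodule.mem_bot ℂ).1 hw, map_zero]
    exact zero_mem _
  all_goals
    intro w hw
    rw [(Submodule.mem_bot ℂ).1 hw, map_zero]
    exact zero_mem _

lemma VertexAction.Stable.sup {D : VertexAction V (TDual W₁ W₂)} {S T : Submodule ℂ (TDual W₁ W₂)}
    (hS : D.Stable S) (hT : D.Stable T) : D.Stable (S ⊔ T) := by
  have key : ∀ L : End ℂ (TDual W₁ W₂), (∀ x ∈ S, L x ∈ S) → (∀ x ∈ T, L x ∈ T) →
      ∀ x ∈ S ⊔ T, L x ∈ S ⊔ T := fun L h h' x hx => by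
    obtain ⟨a, ha, b, hb, rfl⟩ := Submodule.mem_sup.1 hx
    rw [map_add]
    exact Submodule.add_mem_sup (h a ha) (h' b hb)
  exact ⟨fun n v => key (D.mode n v) (hS.mode_mem n v) (hT.mode_mem n v),
    key _ hS.neg_mem hT.neg_mem, key _ hS.zero_mem hT.zero_mem, key _ hS.one_mem hT.one_mem⟩

lemma VertexAction.Stable.inf {D : VertexAction V (TDual W₁ W₂)} {S T : Submodule ℂ (TDual W₁ W₂)}
    (hS : D.Stable S) (hT : D.Stable T) : D.Stable (S ⊓ T) :=
  ⟨fun n v x hx => ⟨hS.mode_mem n v x hx.1, hT.mode_mem n v x hx.2⟩,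
    fun x hx => ⟨hS.neg_mem x hx.1, hT.neg_mem x hx.2⟩,
    fun x hx => ⟨hS.zero_mem x hx.1, hT.zero_mem x hx.2⟩,
    fun x hx => ⟨hS.one_mem x hx.1, hT.one_mem x hx.2⟩⟩

lemma VertexAction.stable_sInf {D : VertexAction V (TDual W₁ W₂)}
    {F : Set (Submodule ℂ (TDual W₁ W₂))} (h : ∀ S ∈ F, D.Stable S) : D.Stable (sInf F) := by
  have key : ∀ L : End ℂ (TDual W₁ W₂), (∀ S ∈ F, ∀ x ∈ S, L x ∈ S) →
      ∀ x ∈ sInf F, L x ∈ sInf F := fun L h x hx =>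
    Submodule.mem_sInf.2 fun S hS => h S hS x (Submodule.mem_sInf.1 hx S hS)
  exact ⟨fun n v => key (D.mode n v) fun S hS => (h S hS).mode_mem n v,
    key _ fun S hS => (h S hS).neg_mem, key _ fun S hS => (h S hS).zero_mem,
    key _ fun S hS => (h S hS).one_mem⟩

/-- The sum of families of subspaces of the homogeneous subspaces is grading restricted as soon as
it is stable and the homogeneous parts are. -/
lemma gradingRestricted_iSup {T : ℂ × Γ → Submodule ℂ (TDual W₁ W₂)}
    (hT : ∀ p : ℂ × Γ, T p ≤ (dualAct z W₁ W₂).genWt p.1 p.2)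
    (stable : (dualAct z W₁ W₂).toVertexAction.Stable (⨆ p, T p))
    (finite : ∀ p, FiniteDimensional ℂ (T p))
    (lower : ∀ (n : ℂ) (β : Γ), ∃ N : ℤ, ∀ k ≤ N, T (n + (k : ℤ), β) = ⊥) :
    GradingRestricted z W₁ W₂ (⨆ p, T p) := by
  have h : ∀ p : ℂ × Γ, (⨆ p, T p) ⊓ (dualAct z W₁ W₂).genWt p.1 p.2 = T p :=
    iSup_inf_eq (dual_genWt_indep z W₁ W₂) hT
  refine ⟨stable, iSup_congr fun p => (h p).symm, fun n β => ?_, fun n β => ?_⟩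
  · rw [h (n, β)]
    exact finite (n, β)
  · obtain ⟨N, hN⟩ := lower n β
    exact ⟨N, fun k hk => (h (n + k, β)).trans (hN k hk)⟩

lemma gradingRestricted_bot : GradingRestricted z W₁ W₂ ⊥ where
  stable := stable_bot
  graded := by simp
  finite n β := by
    rw [bot_inf_eq]
    infer_instance
  lower n β := ⟨0, fun k _ => bot_inf_eq _⟩

namespace GradingRestricted

variable {S T : Submodule ℂ (TDual W₁ W₂)}

lemma sup (hS : GradingRestricted z W₁ W₂ S) (hT : GradingRestricted z W₁ W₂ T) :
    GradingRestricted z W₁ W₂ (S ⊔ T) := by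
  have e : S ⊔ T = ⨆ p : ℂ × Γ, (S ⊓ (dualAct z W₁ W₂).genWt p.1 p.2 ⊔
      T ⊓ (dualAct z W₁ W₂).genWt p.1 p.2) := by
    rw [iSup_sup_eq, ← hS.graded, ← hT.graded]
  rw [e]
  refine gradingRestricted_iSup (fun p => sup_le inf_le_right inf_le_right)
    (e ▸ hS.stable.sup hT.stable) (fun p => ?_) fun n β => ?_
  · have := hS.finite p.1 p.2
    have := hT.finite p.1 p.2
    infer_instance
  · obtain ⟨N, hN⟩ := hS.lower n β
    obtain ⟨M, hM⟩ := hT.lower n β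
    refine ⟨min N M, fun k hk => ?_⟩
    rw [hN k (le_trans hk (min_le_left _ _)), hM k (le_trans hk (min_le_right _ _)), bot_sup_eq]

lemma le_iSup (hS : GradingRestricted z W₁ W₂ S) :
    S ≤ ⨆ p : ℂ × Γ, (dualAct z W₁ W₂).genWt p.1 p.2 :=
  hS.graded.le.trans (iSup_mono fun _ => inf_le_right)

lemma mono (hS : GradingRestricted z W₁ W₂ S) (h : T ≤ S)
    (stable : (dualAct z W₁ W₂).toVertexAction.Stable T)
    (graded : T = ⨆ p : ℂ × Γ, T ⊓ (dualAct z W₁ W₂).genWt p.1 p.2) :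
    GradingRestricted z W₁ W₂ T := by
  refine ⟨stable, graded, fun n β => ?_, fun n β => ?_⟩
  · have := hS.finite n β
    exact Submodule.finiteDimensional_of_le (inf_le_inf_right _ h)
  · obtain ⟨N, hN⟩ := hS.lower n β
    exact ⟨N, fun k hk => eq_bot_mono (inf_le_inf_right _ h) (hN k hk)⟩

end GradingRestricted

lemma mem_Wlam (l : TDual W₁ W₂) : l ∈ Wlam z W₁ W₂ l :=
  Submodule.mem_sInf.2 fun _ hS => hS.1

lemma Wlam_le {l : TDual W₁ W₂} {S : Submodule ℂ (TDual W₁ W₂)} (hl : l ∈ S)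
    (hS : (dualAct z W₁ W₂).toVertexAction.Stable S)
    (h : S = ⨆ p : ℂ × Γ, S ⊓ (dualAct z W₁ W₂).genWt p.1 p.2) : Wlam z W₁ W₂ l ≤ S :=
  sInf_le ⟨hl, hS, h⟩

lemma Wlam_stable (l : TDual W₁ W₂) :
    (dualAct z W₁ W₂).toVertexAction.Stable (Wlam z W₁ W₂ l) :=
  VertexAction.stable_sInf fun _ hS => hS.2.1

/-- Homogeneity, unlike a decomposition as a sum, obviously passes to intersections. The sum of all
weight spaces is itself an admissible subspace, so W_λ lies in it and decomposes. -/
lemma Wlam_graded (hz : z ≠ 0) {l : TDual W₁ W₂}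
    (hl : l ∈ ⨆ p : ℂ × Γ, (dualAct z W₁ W₂).genWt p.1 p.2) :
    Wlam z W₁ W₂ l = ⨆ p : ℂ × Γ, Wlam z W₁ W₂ l ⊓ (dualAct z W₁ W₂).genWt p.1 p.2 := by
  refine Homogeneous.eq_iSup (homogeneous_sInf fun S hS =>
    homogeneous_of_eq_iSup (dual_genWt_indep z W₁ W₂) hS.2.2)
    (Wlam_le hl (stable_iSup_genWt hz W₁ W₂) ?_)
  refine iSup_congr fun p => (inf_eq_right.2 ?_).symm
  exact le_iSup (fun p : ℂ × Γ => (dualAct z W₁ W₂).genWt p.1 p.2) p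

lemma Wlam_gradingRestricted (hz : z ≠ 0) {l : TDual W₁ W₂} (hl : l ∈ LGRgen z W₁ W₂) :
    GradingRestricted z W₁ W₂ (Wlam z W₁ W₂ l) :=
  ⟨Wlam_stable l, Wlam_graded hz hl.1, fun n β => (hl.2 n β).1, fun n β => (hl.2 n β).2⟩

/-- W_λ lies in every admissible S and inherits its bounds. The existential form makes closure under
sums and operators immediate. -/
lemma mem_LGRgen_iff (hz : z ≠ 0) {l : TDual W₁ W₂} :
    l ∈ LGRgen z W₁ W₂ ↔ ∃ S, GradingRestricted z W₁ W₂ S ∧ l ∈ S := by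
  refine ⟨fun hl => ⟨_, Wlam_gradingRestricted hz hl, mem_Wlam l⟩, fun ⟨S, hS, hl⟩ => ?_⟩
  have h1 := hS.le_iSup hl
  have h2 := hS.mono (Wlam_le hl hS.stable hS.graded) (Wlam_stable l) (Wlam_graded hz h1)
  exact ⟨h1, fun n β => ⟨h2.finite n β, h2.lower n β⟩⟩

lemma ordWt_le_genWt (n : ℂ) (β : Γ) :
    (dualAct z W₁ W₂).ordWt n β ≤ (dualAct z W₁ W₂).genWt n β :=
  inf_le_inf_left _ Module.End.eigenspace_le_maxGenEigenspace

lemma iSup_ordWt_inf (p : ℂ × Γ) :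
    (⨆ p : ℂ × Γ, (dualAct z W₁ W₂).ordWt p.1 p.2) ⊓ (dualAct z W₁ W₂).genWt p.1 p.2 =
      (dualAct z W₁ W₂).ordWt p.1 p.2 :=
  iSup_inf_eq (G := fun p : ℂ × Γ => (dualAct z W₁ W₂).genWt p.1 p.2)
    (T := fun p : ℂ × Γ => (dualAct z W₁ W₂).ordWt p.1 p.2) (dual_genWt_indep z W₁ W₂)
    (fun p => ordWt_le_genWt p.1 p.2) p

lemma Wlam_le_iSup_ordWt (hz : z ≠ 0) {l : TDual W₁ W₂}
    (hl : l ∈ ⨆ p : ℂ × Γ, (dualAct z W₁ W₂).ordWt p.1 p.2) :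
    Wlam z W₁ W₂ l ≤ ⨆ p : ℂ × Γ, (dualAct z W₁ W₂).ordWt p.1 p.2 :=
  Wlam_le hl (stable_iSup_ordWt hz W₁ W₂) (iSup_congr fun p => (iSup_ordWt_inf p).symm)

/-- W_λ lies in the sum of the ordinary weight spaces, and there a generalized weight vector is an
ordinary one because the generalized weight spaces are independent. -/
lemma Wlam_inf_genWt (hz : z ≠ 0) {l : TDual W₁ W₂}
    (hl : l ∈ ⨆ p : ℂ × Γ, (dualAct z W₁ W₂).ordWt p.1 p.2) (n : ℂ) (β : Γ) :
    Wlam z W₁ W₂ l ⊓ (dualAct z W₁ W₂).genWt n β =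
      Wlam z W₁ W₂ l ⊓ (dualAct z W₁ W₂).ordWt n β := by
  refine le_antisymm (le_inf inf_le_left ?_) (inf_le_inf_left _ (ordWt_le_genWt n β))
  exact (inf_le_inf_right _ (Wlam_le_iSup_ordWt hz hl)).trans (iSup_ordWt_inf (n, β)).le

/-- The semisimple condition is the general one for sums of ordinary weight vectors. -/
lemma mem_LGRss_iff (hz : z ≠ 0) {l : TDual W₁ W₂} :
    l ∈ LGRss z W₁ W₂ ↔ l ∈ (⨆ p : ℂ × Γ, (dualAct z W₁ W₂).ordWt p.1 p.2) ∧
      l ∈ LGRgen z W₁ W₂ := by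
  have h0 : (⨆ p : ℂ × Γ, (dualAct z W₁ W₂).ordWt p.1 p.2) ≤
      ⨆ p : ℂ × Γ, (dualAct z W₁ W₂).genWt p.1 p.2 := iSup_mono fun p => ordWt_le_genWt p.1 p.2
  constructor
  · rintro ⟨h1, h2⟩
    refine ⟨h1, h0 h1, fun n β => ⟨?_, ?_⟩⟩
    · rw [Wlam_inf_genWt hz h1]
      exact (h2 n β).1
    · simp only [Wlam_inf_genWt hz h1]
      exact (h2 n β).2
  · rintro ⟨h1, -, h2⟩
    refine ⟨h1, fun n β => ⟨?_, ?_⟩⟩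
    · rw [← Wlam_inf_genWt hz h1]
      exact (h2 n β).1
    · simp only [← Wlam_inf_genWt hz h1]
      exact (h2 n β).2

/-- The elements satisfying the local grading restriction condition, as a subspace. -/
def lgrSubmodule (hz : z ≠ 0) : Submodule ℂ (TDual W₁ W₂) where
  carrier := LGRgen z W₁ W₂
  zero_mem' := (mem_LGRgen_iff hz).2 ⟨⊥, gradingRestricted_bot, zero_mem _⟩
  add_mem' := by
    intro a b ha hb
    obtain ⟨S, hS, ha⟩ := (mem_LGRgen_iff hz).1 ha
    obtain ⟨T, hT, hb⟩ := (mem_LGRgen_iff hz).1 hb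
    exact (mem_LGRgen_iff hz).2 ⟨S ⊔ T, hS.sup hT, Submodule.add_mem_sup ha hb⟩
  smul_mem' := by
    intro c a ha
    obtain ⟨S, hS, ha⟩ := (mem_LGRgen_iff hz).1 ha
    exact (mem_LGRgen_iff hz).2 ⟨S, hS, S.smul_mem c ha⟩

lemma lgrSubmodule_stable (hz : z ≠ 0) :
    (dualAct z W₁ W₂).toVertexAction.Stable (lgrSubmodule hz) := by
  have key : ∀ (T : End ℂ (TDual W₁ W₂)),
      (∀ S, GradingRestricted z W₁ W₂ S → ∀ x ∈ S, T x ∈ S) →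
      ∀ x ∈ lgrSubmodule hz, T x ∈ lgrSubmodule hz := fun T h x hx => by
    obtain ⟨S, hS, hx⟩ := (mem_LGRgen_iff hz).1 hx
    exact (mem_LGRgen_iff hz).2 ⟨S, hS, h S hS x hx⟩
  exact ⟨fun n v => key ((dualAct z W₁ W₂).mode n v) fun S hS => hS.stable.mode_mem n v,
    key _ fun S hS => hS.stable.neg_mem, key _ fun S hS => hS.stable.zero_mem,
    key _ fun S hS => hS.stable.one_mem⟩

lemma formsWeakModule_of_le (hz : z ≠ 0) {S : Submodule ℂ (TDual W₁ W₂)}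
    {T : Set (TDual W₁ W₂)} (hT : (S : Set (TDual W₁ W₂)) = T) (hc : T ⊆ COMP z W₁ W₂)
    (h : (dualAct z W₁ W₂).toVertexAction.Stable S) : FormsWeakModule z W₁ W₂ T :=
  ⟨S, hT, h, isWeakModule_restrict hz S (hT ▸ hc) h⟩

lemma formsWeakModule_COMP (hz : z ≠ 0) : FormsWeakModule z W₁ W₂ (COMP z W₁ W₂) :=
  formsWeakModule_of_le hz (S := compSubmodule hz) rfl subset_rfl (compSubmodule_stable hz)

lemma formsWeakModule_LGRgen (hz : z ≠ 0) :
    FormsWeakModule z W₁ W₂ (COMP z W₁ W₂ ∩ LGRgen z W₁ W₂) :=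
  formsWeakModule_of_le hz (S := compSubmodule hz ⊓ lgrSubmodule hz) rfl Set.inter_subset_left
    ((compSubmodule_stable hz).inf (lgrSubmodule_stable hz))

lemma formsWeakModule_LGRss (hz : z ≠ 0) :
    FormsWeakModule z W₁ W₂ (COMP z W₁ W₂ ∩ LGRss z W₁ W₂) :=
  formsWeakModule_of_le hz
    (S := compSubmodule hz ⊓ ((⨆ p : ℂ × Γ, (dualAct z W₁ W₂).ordWt p.1 p.2) ⊓ lgrSubmodule hz))
    (Set.ext fun _ => and_congr Iff.rfl (mem_LGRss_iff hz).symm) Set.inter_subset_left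
    ((compSubmodule_stable hz).inf ((stable_iSup_ordWt hz W₁ W₂).inf (lgrSubmodule_stable hz)))

/-- The subspace `W_λ` inherits the compatibility condition. -/
lemma Wlam_le_compSubmodule (hz : z ≠ 0) {l : TDual W₁ W₂} (hc : l ∈ COMP z W₁ W₂)
    (hl : l ∈ ⨆ p : ℂ × Γ, (dualAct z W₁ W₂).genWt p.1 p.2) :
    Wlam z W₁ W₂ l ≤ compSubmodule hz := by
  refine (Wlam_le (S := compSubmodule hz ⊓ ⨆ p : ℂ × Γ, (dualAct z W₁ W₂).genWt p.1 p.2)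
    ⟨hc, hl⟩ ((compSubmodule_stable hz).inf (stable_iSup_genWt hz W₁ W₂)) ?_).trans inf_le_left
  exact (homogeneous_inf (homogeneous_compSubmodule hz W₁ W₂)
    (homogeneous_iSup (dual_genWt_indep z W₁ W₂) fun _ => le_rfl)).eq_iSup inf_le_right

lemma maxGenEigenspace_restrict {M : Type*} [AddCommGroup M] [Module ℂ M] (L : End ℂ M)
    {S : Submodule ℂ M} (h : ∀ x ∈ S, L x ∈ S) (μ : ℂ) :
    Module.End.maxGenEigenspace (L.restrict h) μ = (L.maxGenEigenspace μ).comap S.subtype :=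
  Module.End.genEigenspace_restrict L S ⊤ μ h

lemma iSup_comap_subtype {ι M : Type*} [AddCommGroup M] [Module ℂ M] {S : Submodule ℂ M}
    {G : ι → Submodule ℂ M} {T : Submodule ℂ M} (h : S ⊓ T = ⨆ i, S ⊓ G i) :
    T.comap S.subtype = ⨆ i, (G i).comap S.subtype := by
  refine Submodule.map_injective_of_injective S.injective_subtype ?_
  rw [Submodule.map_iSup, Submodule.map_comap_subtype, h]
  simp only [Submodule.map_comap_subtype]

/-- A grading restricted subspace of elements satisfying the compatibility condition is a
generalized module. -/
lemma GradingRestricted.formsGenModule (hz : z ≠ 0) {S : Submodule ℂ (TDual W₁ W₂)}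
    (hS : GradingRestricted z W₁ W₂ S) (hc : S ≤ compSubmodule hz) :
    FormsGenModule z W₁ W₂ S where
  stable := hS.stable
  isGenModule := by
    have hg : ∀ n β, ((dualAct z W₁ W₂).restrict S hS.stable).genWt n β =
        ((dualAct z W₁ W₂).genWt n β).comap S.subtype := fun n β => by
      rw [GradedAction.genWt, GradedAction.genWt, Submodule.comap_inf]
      exact congrArg _ (maxGenEigenspace_restrict _ hS.stable.zero_mem n)
    have hinf : ∀ β, S ⊓ (dualAct z W₁ W₂).gr β =
        ⨆ n : ℂ, S ⊓ (dualAct z W₁ W₂).genWt n β := fun β => by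
      -- The double grading is grouped by β, so that the part of degree β can be read off by
      -- independence.
      have e : S = ⨆ β, ⨆ n : ℂ, S ⊓ (dualAct z W₁ W₂).genWt n β := by
        conv_lhs => rw [hS.graded]
        rw [iSup_prod, iSup_comm]
      conv_lhs => rw [e]
      exact iSup_inf_eq (dual_gr_indep z W₁ W₂)
        (fun β => iSup_le fun n => inf_le_right.trans inf_le_left) β
    have hinj : ∀ T : Submodule ℂ (TDual W₁ W₂), S ⊓ T = ⊥ → T.comap S.subtype = ⊥ := fun T h =>
      Submodule.map_injective_of_injective S.injective_subtype (by
        rw [Submodule.map_comap_subtype, h, Submodule.map_bot])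
    refine ⟨isWeakModule_restrict hz S hc hS.stable, ?_, ?_, ?_, fun β => ?_, fun n β => ?_,
      fun n β => ?_, ?_, fun β w => Lneg_mem_gr (z := z),
      fun β w => Lzero_mem_gr (z := z), fun β w => Lone_mem_gr (z := z)⟩
    · have h1 : ∀ n, ((dualAct z W₁ W₂).restrict S hS.stable).Lzero.maxGenEigenspace n =
          ((dualAct z W₁ W₂).Lzero.maxGenEigenspace n).comap S.subtype :=
        maxGenEigenspace_restrict _ hS.stable.zero_mem
      simp only [h1]
      rw [← iSup_comap_subtype (T := ⊤), Submodule.comap_top]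
      rw [inf_top_eq]
      refine le_antisymm ?_ (iSup_le fun _ => inf_le_left)
      conv_lhs => rw [hS.graded]
      exact iSup_le fun p => le_iSup_of_le p.1 (inf_le_inf_left _ inf_le_right)
    · rw [← homogeneous_bot_iff]
      intro s f hf h i hi
      have := homogeneous_bot_iff.2 (dual_gr_indep z W₁ W₂) s (fun i => (f i : TDual W₁ W₂))
        (fun i hi => hf i hi) (by
          rw [Submodule.mem_bot] at h ⊢
          simpa using congrArg S.subtype h) i hi
      rw [Submodule.mem_bot] at this ⊢
      exact Subtype.ext this
    · change ⨆ β, ((dualAct z W₁ W₂).gr β).comap S.subtype = ⊤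
      rw [← iSup_comap_subtype (T := ⊤), Submodule.comap_top]
      rw [inf_top_eq]
      refine le_antisymm ?_ (iSup_le fun _ => inf_le_left)
      conv_lhs => rw [hS.graded]
      exact iSup_le fun p => le_iSup_of_le p.2 (inf_le_inf_left _ inf_le_left)
    · simp only [hg]
      exact iSup_comap_subtype (hinf β)
    · obtain ⟨N, hN⟩ := hS.lower n β
      exact ⟨N, fun k hk => (hg _ _).trans (hinj _ (hN k hk))⟩
    · rw [hg]
      have := hS.finite n β
      rw [← Submodule.map_comap_subtype] at this
      exact LinearEquiv.finiteDimensional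
        (Submodule.equivMapOfInjective S.subtype S.injective_subtype _).symm
    · intro α β n v hv w hw
      exact tauQ_mem_gr 0 n hv hw

lemma formsGenModule_Wlam (hz : z ≠ 0) {l : TDual W₁ W₂}
    (hl : l ∈ COMP z W₁ W₂ ∩ LGRgen z W₁ W₂) : FormsGenModule z W₁ W₂ (Wlam z W₁ W₂ l) :=
  (Wlam_gradingRestricted hz hl.2).formsGenModule hz (Wlam_le_compSubmodule hz hl.1 hl.2.1)

lemma isOrdinary_of_le (S : Submodule ℂ (TDual W₁ W₂)) (h : FormsGenModule z W₁ W₂ S)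
    (hS : S = ⨆ p : ℂ × Γ, S ⊓ (dualAct z W₁ W₂).ordWt p.1 p.2) :
    h.toGenMod.act.IsOrdinary := by
  have h1 : ∀ n, ((dualAct z W₁ W₂).restrict S h.stable).Lzero.eigenspace n =
      ((dualAct z W₁ W₂).Lzero.eigenspace n).comap S.subtype := fun n =>
    Module.End.genEigenspace_restrict _ S 1 n h.stable.zero_mem
  change ⨆ n : ℂ, ((dualAct z W₁ W₂).restrict S h.stable).Lzero.eigenspace n = ⊤
  simp only [h1]
  rw [← iSup_comap_subtype (T := ⊤), Submodule.comap_top]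
  rw [inf_top_eq]
  refine le_antisymm ?_ (iSup_le fun _ => inf_le_left)
  conv_lhs => rw [hS]
  exact iSup_le fun p => le_iSup_of_le p.1 (inf_le_inf_left _ inf_le_right)

lemma isOrdinary_Wlam (hz : z ≠ 0) {l : TDual W₁ W₂}
    (hl : l ∈ COMP z W₁ W₂ ∩ LGRss z W₁ W₂) :
    ∃ h : FormsGenModule z W₁ W₂ (Wlam z W₁ W₂ l), h.toGenMod.act.IsOrdinary := by
  have h1 := (mem_LGRss_iff hz).1 hl.2
  refine ⟨formsGenModule_Wlam hz ⟨hl.1, h1.2⟩, isOrdinary_of_le _ _ ?_⟩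
  simp only [← Wlam_inf_genWt hz h1.1]
  exact Wlam_graded hz h1.2.1

lemma GenMod.IsIso.refl (W : GenMod.{u} 𝒱) : W.IsIso W :=
  ⟨LinearEquiv.refl ℂ _, fun _ _ _ => rfl, fun _ => rfl, fun _ => rfl, fun _ => rfl,
    fun _ _ => Iff.rfl⟩

/-- The inclusion of a generalized module of elements satisfying the compatibility condition. -/
lemma isQMap_subtype (hz : z ≠ 0) {S : Submodule ℂ (TDual W₁ W₂)}
    (h : FormsGenModule z W₁ W₂ S) (hc : S ≤ compSubmodule hz) :
    IsQMap z W₁ W₂ h.toGenMod S.subtype where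
  gr_compat _ _ hx := hx
  intertwine m n v x := by
    have h1 := tauQ_add_eq_expSum hz (hc x.2) v m 0 n
    rw [zero_add] at h1
    refine (congrArg S.subtype (VertexAlg.tauPlus_apply _ _ _ _ _ _ _)).trans
      (Eq.trans ?_ h1.symm)
    exact map_expSum S.subtype z (h.toGenMod.isGenModule.isWeak.truncation v x) m n
  neg _ := rfl
  zero _ := rfl
  one _ := rfl

lemma wlamInObject (hz : z ≠ 0) {l : TDual W₁ W₂} (hl : l ∈ COMP z W₁ W₂ ∩ LGRgen z W₁ W₂)
    {C : Set (GenMod.{u} 𝒱)} (hC : (formsGenModule_Wlam hz hl).toGenMod ∈ C) :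
    WlamInObject z W₁ W₂ C l :=
  ⟨Wlam z W₁ W₂ l, formsGenModule_Wlam hz hl, ⟨_, hC, GenMod.IsIso.refl _⟩,
    isQMap_subtype hz _ (Wlam_le_compSubmodule hz hl.1 hl.2.1), le_rfl⟩

end

/-! ### Contragredients and double contragredients -/

section Modules

lemma GenMod.iSup_genWt (W : GenMod.{u} 𝒱) :
    ⨆ p : ℂ × Γ, W.act.genWt p.1 p.2 = ⊤ := by
  rw [iSup_prod, iSup_comm, ← W.isGenModule.gr_iSup]
  exact iSup_congr fun β => (W.isGenModule.gr_compat β).symm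

lemma GenMod.genWt_indep (W : GenMod.{u} 𝒱) :
    iSupIndep fun p : ℂ × Γ => W.act.genWt p.1 p.2 :=
  homogeneous_bot_iff.1 ((homogeneous_bot_iff.2 W.isGenModule.gr_indep).prod
    (homogeneous_maxGenEigenspace _ fun x hx => by
      rw [Submodule.mem_bot] at hx ⊢
      rw [hx, map_zero]))

lemma GenMod.mem_of_genWt_le {W : GenMod.{u} 𝒱} {S : Submodule ℂ W.carrier}
    (h : ∀ p : ℂ × Γ, W.act.genWt p.1 p.2 ≤ S) (w : W.carrier) : w ∈ S := by
  have : (⊤ : Submodule ℂ W.carrier) ≤ S := by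
    rw [← W.iSup_genWt]
    exact iSup_le h
  exact this trivial

/-- Generalized eigenspaces with distinct eigenvalues of adjoint operators are orthogonal. -/
lemma apply_eq_zero_of_maxGenEigenspace {M N : Type*} [AddCommGroup M] [Module ℂ M]
    [AddCommGroup N] [Module ℂ N] {B : M →ₗ[ℂ] Dual ℂ N} {f : End ℂ M} {g : End ℂ N}
    (h : ∀ x y, B (f x) y = B x (g y)) {μ ν : ℂ} (hne : μ ≠ ν) {x : M} {y : N}
    (hx : x ∈ f.maxGenEigenspace μ) (hy : y ∈ g.maxGenEigenspace ν) : B x y = 0 := by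
  obtain ⟨k, hk⟩ := (Module.End.mem_maxGenEigenspace _ _ _).1 hx
  clear hx
  induction k generalizing x y with
  | zero =>
    rw [pow_zero, Module.End.one_apply] at hk
    rw [hk, map_zero, LinearMap.zero_apply]
  | succ k ihk =>
    obtain ⟨j, hj⟩ := (Module.End.mem_maxGenEigenspace _ _ _).1 hy
    clear hy
    induction j generalizing y with
    | zero =>
      rw [pow_zero, Module.End.one_apply] at hj
      rw [hj, map_zero]
    | succ j ihj =>
      -- Both nilpotency orders are lowered in turn; the two resulting equations differ by (μ - ν)
      -- times the pairing.
      have h1 := ihk (x := (f - μ • 1) x) (y := y)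
        ((Module.End.mem_maxGenEigenspace _ _ _).2 ⟨_, hj⟩) (by
          rwa [pow_succ, Module.End.mul_apply] at hk)
      have h2 := ihj (y := (g - ν • 1) y) (by rwa [pow_succ, Module.End.mul_apply] at hj)
      simp only [LinearMap.sub_apply, LinearMap.smul_apply, Module.End.one_apply, map_sub,
        map_smul, h, smul_eq_mul] at h1 h2
      have h3 : (μ - ν) * B x y = 0 := by linear_combination h2 - h1
      exact (mul_eq_zero.1 h3).resolve_left (sub_ne_zero.2 hne)

/-- The contragredient of an ordinary module is ordinary. -/
lemma IsContragredient.maxGenEigenspace_eq {W X : GenMod.{u} 𝒱} (h : IsContragredient W X)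
    (hW : W.act.IsOrdinary) (n : ℂ) :
    X.act.Lzero.maxGenEigenspace n = X.act.Lzero.eigenspace n := by
  obtain ⟨e, inj, -, -, -, hzero, -, -⟩ := h
  refine le_antisymm (fun x hx => ?_) Module.End.eigenspace_le_maxGenEigenspace
  rw [Module.End.mem_eigenspace_iff]
  refine inj (LinearMap.ext fun w => ?_)
  have hw : (⊤ : Submodule ℂ W.carrier) ≤
      LinearMap.ker (e (X.act.Lzero x) - e (n • x)) := by
    rw [← hW]
    refine iSup_le fun m w hw => ?_
    rw [LinearMap.mem_ker, LinearMap.sub_apply, hzero, Module.End.mem_eigenspace_iff.1 hw, map_smul,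
      map_smul, LinearMap.smul_apply, ← sub_smul]
    by_cases hm : n = m
    · rw [hm, sub_self, zero_smul]
    · rw [apply_eq_zero_of_maxGenEigenspace hzero hm hx
        (Module.End.eigenspace_le_maxGenEigenspace hw), smul_zero]
  exact sub_eq_zero.1 (hw (x := w) trivial)

/-- A generalized module is a contragredient of its contragredients. -/
lemma IsContragredient.symm {W X : GenMod.{u} 𝒱} (h : IsContragredient W X) :
    IsContragredient X W := by
  obtain ⟨e, inj, range, hmode, hneg, hzero, hone, hgr⟩ := h
  -- X_[n]^(β) pairs nontrivially only with W_[n]^(-β).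
  have pair : ∀ (p q : ℂ × Γ), q ≠ (p.1, -p.2) → ∀ x ∈ X.act.genWt p.1 p.2,
      ∀ w ∈ W.act.genWt q.1 q.2, e x w = 0 := by
    intro p q hne x hx w hw
    by_cases h1 : p.1 = q.1
    · exact (hgr p.2 x).1 hx.1 q.2 (fun h2 => hne (Prod.ext h1.symm h2)) w hw.1
    · exact apply_eq_zero_of_maxGenEigenspace hzero h1 hx.2 hw.2
  have hinj : Function.Injective e.flip := by
    rw [← LinearMap.ker_eq_bot, eq_bot_iff]
    intro w hw
    rw [LinearMap.mem_ker] at hw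
    have hw' : w ∈ ⨆ p : ℂ × Γ, W.act.genWt p.1 p.2 := by
      rw [W.iSup_genWt]
      trivial
    obtain ⟨s, f, hf, rfl⟩ := mem_iSup_iff_exists_finset.1 hw'
    refine Submodule.sum_mem _ fun p hp => ?_
    by_contra hne
    -- By independence, some functional is nonzero on the component `f p` and zero on all other
    -- weight spaces. It lies in the graded dual, hence comes from X, and detects w.
    have hnot : f p ∉ ⨆ (q : ℂ × Γ) (_ : q ≠ p), W.act.genWt q.1 q.2 := fun hmem =>
      hne ((W.genWt_indep p).eq_bot.le ⟨hf p hp, hmem⟩)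
    obtain ⟨φ, hφ, hker⟩ := Submodule.exists_le_ker_of_notMem hnot
    have hzero' : ∀ q, q ≠ p → ∀ w ∈ W.act.genWt q.1 q.2, φ w = 0 := fun q hq w hw =>
      hker (Submodule.mem_iSup_of_mem q (Submodule.mem_iSup_of_mem hq hw))
    have hφr : φ ∈ Set.range e := by
      rw [range]
      refine (Set.finite_singleton p).subset fun q hq => ?_
      obtain ⟨w, hw, hne⟩ := hq
      by_contra hqp
      exact hne (hzero' q hqp w hw)
    obtain ⟨x, rfl⟩ := hφr
    have h1 := LinearMap.congr_fun hw x
    rw [LinearMap.flip_apply, map_sum, LinearMap.zero_apply,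
      Finset.sum_eq_single_of_mem p hp fun q hq hqp => hzero' q hqp _ (hf q hq)] at h1
    exact hφ h1
  refine ⟨e.flip, hinj, ?_, ?_, fun w x => (hone x w).symm, fun w x => (hzero x w).symm,
    fun w x => (hneg x w).symm, ?_⟩
  · ext f
    constructor
    · rintro ⟨w, rfl⟩
      have hw' : w ∈ ⨆ p : ℂ × Γ, W.act.genWt p.1 p.2 := by
        rw [W.iSup_genWt]
        trivial
      obtain ⟨s, g, hg, rfl⟩ := mem_iSup_iff_exists_finset.1 hw'
      refine (s.finite_toSet.image fun p => (p.1, -p.2)).subset ?_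
      rintro p ⟨x, hx, hne⟩
      by_contra hp
      refine hne ?_
      rw [LinearMap.flip_apply, map_sum]
      refine Finset.sum_eq_zero fun q hq => pair p q (fun e => hp ⟨q, hq, ?_⟩) x hx _ (hg q hq)
      rw [e]
      simp
    · intro hf
      -- Each weight component of f is represented by a vector of W; only finitely many are needed,
      -- and they are added up.
      have hex : ∀ p : ℂ × Γ, ∃ w ∈ W.act.genWt p.1 (-p.2), ∀ x ∈ X.act.genWt p.1 p.2,
          e x w = f x := by
        intro p
        let B : X.act.genWt p.1 p.2 →ₗ[ℂ] Dual ℂ (W.act.genWt p.1 (-p.2)) :=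
          (W.act.genWt p.1 (-p.2)).subtype.dualMap ∘ₗ e ∘ₗ (X.act.genWt p.1 p.2).subtype
        have hB : Function.Injective B := by
          rw [← LinearMap.ker_eq_bot, eq_bot_iff]
          rintro ⟨x, hx⟩ hBx
          rw [LinearMap.mem_ker] at hBx
          have h1 : e x = 0 := LinearMap.ext fun w => GenMod.mem_of_genWt_le
            (S := LinearMap.ker (e x)) (fun q w hw => by
              by_cases hq : q = (p.1, -p.2)
              · subst hq
                exact LinearMap.congr_fun hBx ⟨w, hw⟩
              · exact pair p q hq x hx w hw) w
          exact Subtype.ext (inj (h1.trans (map_zero e).symm))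
        -- The pairing of the two weight spaces is injective on the X side, so finite-dimensionality
        -- makes the transposed map surjective.
        have := X.isGenModule.gr_finite p.1 p.2
        obtain ⟨w, hw⟩ := LinearMap.flip_surjective_iff₁.2 hB (f ∘ₗ (X.act.genWt p.1 p.2).subtype)
        exact ⟨w, w.2, fun x hx => LinearMap.congr_fun hw ⟨x, hx⟩⟩
      choose w hw hwf using hex
      refine ⟨∑ p ∈ hf.toFinset, w p, LinearMap.ext fun x => ?_⟩
      refine sub_eq_zero.1 (GenMod.mem_of_genWt_le (S := LinearMap.ker
        (e.flip (∑ p ∈ hf.toFinset, w p) - f)) (fun q x hx => ?_) x)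
      rw [LinearMap.mem_ker, LinearMap.sub_apply, sub_eq_zero, LinearMap.flip_apply, map_sum]
      have hoff : ∀ p ∈ hf.toFinset, p ≠ q → e x (w p) = 0 := fun p _ hne =>
        pair q (p.1, -p.2) (fun h => hne (by
          rw [Prod.mk.injEq, neg_inj] at h
          exact Prod.ext h.1 h.2)) x hx _ (hw p)
      by_cases hq : q ∈ hf.toFinset
      · rw [Finset.sum_eq_single_of_mem q hq hoff]
        exact hwf q x hx
      · rw [Finset.sum_eq_zero fun p hp => hoff p hp fun h => hq (h ▸ hp)]
        by_contra hne
        exact hq (hf.mem_toFinset.2 ⟨x, hx, fun h => hne h.symm⟩)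
  · intro n v w x
    rw [LinearMap.flip_apply, LinearMap.flip_apply]
    induction v using 𝒱.wt_induction with
    | add v v' h h' => simp only [map_add, LinearMap.add_apply, h, h']
    -- Here the involutivity of Yᵒ is needed: taking the opposite twice gives back the mode of v on
    -- W.
    | hp h v hv =>
      obtain ⟨K, hK⟩ := 𝒱.Lone_nilp v
      rw [← 𝒱.sum_oppMode_Lone_pow W.act.toVertexAction n hv w hK, map_smul, map_sum,
        𝒱.oppMode_of_mem _ n hv x hK, map_smul, LinearMap.smul_apply, map_sum,
        LinearMap.sum_apply]
      congr 1
      refine Finset.sum_congr rfl fun p _ => ?_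
      rw [map_smul, VertexAlg.oppTerm, map_smul, LinearMap.smul_apply, hmode]
  · intro γ w
    constructor
    · intro hw β hβ x hx
      exact (hgr β x).1 hx γ (fun h => hβ (by rw [h, neg_neg])) w hw
    · intro hw
      have hw' : w ∈ ⨆ δ, W.act.gr δ := by
        rw [W.isGenModule.gr_iSup]
        trivial
      obtain ⟨s, f, hf, rfl⟩ := mem_iSup_iff_exists_finset.1 hw'
      refine Submodule.sum_mem _ fun δ hδ => ?_
      by_cases hne : δ = γ
      · exact hne ▸ hf δ hδ
      -- A component of degree δ ≠ γ pairs to zero with X^(-δ), since w does and no other component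
      -- of w meets that space; with the other degrees it pairs to zero anyway.
      suffices h0 : f δ = 0 by
        rw [h0]
        exact zero_mem _
      refine hinj (LinearMap.ext fun x => ?_)
      rw [map_zero, LinearMap.zero_apply]
      refine GenMod.mem_of_gr_le (S := LinearMap.ker (e.flip (f δ))) (fun β x hx => ?_) x
      rw [LinearMap.mem_ker, LinearMap.flip_apply]
      by_cases hβ : β = -δ
      · have h1 := hw β (fun h => hne (neg_inj.1 (hβ.symm.trans h))) x hx
        rwa [LinearMap.flip_apply, map_sum, Finset.sum_eq_single_of_mem δ hδ fun ε hε hεδ =>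
          (hgr β x).1 hx ε (fun h => hεδ (by rw [h, hβ, neg_neg])) _ (hf ε hε)] at h1
      · exact (hgr β x).1 hx δ (fun h => hβ (by rw [h, neg_neg])) _ (hf δ hδ)

end Modules

/-! ### Intertwining maps and the comparison with the product -/

section

variable {z : ℂ} {W₁ W₂ X : GenMod.{u} 𝒱} {J : X.carrier →ₗ[ℂ] TDual W₁ W₂}

namespace IsQMap

lemma map_mode (hJ : IsQMap z W₁ W₂ X J) (n : ℤ) (v : V) (x : X.carrier) :
    J (X.act.mode n v x) = (dualAct z W₁ W₂).mode n v (J x) := by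
  have h := hJ.intertwine 0 n v x
  rwa [VertexAlg.tauPlus_zero] at h

/-- On X the expansion of (z+t)^m t^n involves only modes of index at least n, so its truncation
bound is independent of m. The intertwining map carries this uniform truncation to the image. -/
lemma range_le (hz : z ≠ 0) (hJ : IsQMap z W₁ W₂ X J) :
    LinearMap.range J ≤ compSubmodule hz := by
  rintro _ ⟨x, rfl⟩
  rw [mem_compSubmodule, mem_COMP_iff hz]
  intro v
  obtain ⟨N, hN⟩ := X.isGenModule.isWeak.truncation v x
  exact ⟨N, fun m n hn => by
    rw [← hJ.intertwine, VertexAlg.tauPlus_eq_zero _ _ m fun k hk => hN k (le_trans hn hk),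
      map_zero]⟩

lemma range_stable (hJ : IsQMap z W₁ W₂ X J) :
    (dualAct z W₁ W₂).toVertexAction.Stable (LinearMap.range J) := by
  constructor
  · rintro n v _ ⟨x, rfl⟩
    exact ⟨_, hJ.map_mode n v x⟩
  · rintro _ ⟨x, rfl⟩
    exact ⟨_, hJ.neg x⟩
  · rintro _ ⟨x, rfl⟩
    exact ⟨_, hJ.zero x⟩
  · rintro _ ⟨x, rfl⟩
    exact ⟨_, hJ.one x⟩

lemma map_genWt_le (hJ : IsQMap z W₁ W₂ X J) (n : ℂ) (β : Γ) :
    (X.act.genWt n β).map J ≤ (dualAct z W₁ W₂).genWt n β := by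
  rintro _ ⟨x, hx, rfl⟩
  refine ⟨hJ.gr_compat β x hx.1, ?_⟩
  rw [← add_zero n]
  exact map_mem_maxGenEigenspace (c := 0) (fun y => by rw [← hJ.zero, zero_smul, add_zero]) hx.2

lemma range_eq_iSup (J : X.carrier →ₗ[ℂ] TDual W₁ W₂) :
    LinearMap.range J = ⨆ p : ℂ × Γ, (X.act.genWt p.1 p.2).map J := by
  rw [← Submodule.map_iSup, X.iSup_genWt, Submodule.map_top]

/-- The image of a generalized module is grading restricted. -/
lemma range_gradingRestricted (hJ : IsQMap z W₁ W₂ X J) :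
    GradingRestricted z W₁ W₂ (LinearMap.range J) := by
  have h := hJ.range_stable
  rw [range_eq_iSup] at h ⊢
  refine gradingRestricted_iSup (fun p => hJ.map_genWt_le p.1 p.2) h (fun p => ?_) fun n β => ?_
  · have := X.isGenModule.gr_finite p.1 p.2
    infer_instance
  · obtain ⟨N, hN⟩ := X.isGenModule.gr_lower n β
    exact ⟨N, fun k hk => by rw [hN k hk, Submodule.map_bot]⟩

lemma mem_COMP_inter_LGRgen (hz : z ≠ 0) (hJ : IsQMap z W₁ W₂ X J) (x : X.carrier) :
    J x ∈ COMP z W₁ W₂ ∩ LGRgen z W₁ W₂ :=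
  ⟨hJ.range_le hz ⟨x, rfl⟩,
    (mem_LGRgen_iff hz).2 ⟨_, hJ.range_gradingRestricted, ⟨x, rfl⟩⟩⟩

/-- When L(0) is semisimple on X, weight vectors of X map to ordinary weight vectors; this applies
to contragredients of ordinary modules. -/
lemma mem_COMP_inter_LGRss (hz : z ≠ 0) (hJ : IsQMap z W₁ W₂ X J)
    (hX : ∀ n, X.act.Lzero.maxGenEigenspace n = X.act.Lzero.eigenspace n) (x : X.carrier) :
    J x ∈ COMP z W₁ W₂ ∩ LGRss z W₁ W₂ := by
  have h := hJ.mem_COMP_inter_LGRgen hz x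
  refine ⟨h.1, (mem_LGRss_iff hz).2 ⟨?_, h.2⟩⟩
  have hx : J x ∈ LinearMap.range J := ⟨x, rfl⟩
  rw [range_eq_iSup] at hx
  have hle : ⨆ p : ℂ × Γ, (X.act.genWt p.1 p.2).map J ≤
      ⨆ p : ℂ × Γ, (dualAct z W₁ W₂).ordWt p.1 p.2 := iSup_mono fun p => ?_
  · exact hle hx
  rintro _ ⟨y, hy, rfl⟩
  have hy2 := hy.2
  rw [hX, SetLike.mem_coe, Module.End.mem_eigenspace_iff] at hy2
  refine ⟨hJ.gr_compat _ y hy.1, Module.End.mem_eigenspace_iff.2 ?_⟩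
  rw [← hJ.zero, hy2, map_smul]

/-- Transport along an isomorphism. -/
lemma comp_iso {Y : GenMod.{u} 𝒱} (hJ : IsQMap z W₁ W₂ X J) (e : Y.carrier ≃ₗ[ℂ] X.carrier)
    (hmode : ∀ n v w, e (Y.act.mode n v w) = X.act.mode n v (e w))
    (hneg : ∀ w, e (Y.act.Lneg w) = X.act.Lneg (e w))
    (hzero : ∀ w, e (Y.act.Lzero w) = X.act.Lzero (e w))
    (hone : ∀ w, e (Y.act.Lone w) = X.act.Lone (e w))
    (hgr : ∀ β w, w ∈ Y.act.gr β ↔ e w ∈ X.act.gr β) :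
    IsQMap z W₁ W₂ Y (J ∘ₗ e.toLinearMap) where
  gr_compat β y hy := hJ.gr_compat β _ ((hgr β y).1 hy)
  intertwine m n v y := by
    have h := map_expSum e.toLinearMap z (Y.isGenModule.isWeak.truncation v y) m n
    rw [← VertexAlg.tauPlus_apply _ Y.isGenModule.isWeak.truncation] at h
    rw [LinearMap.comp_apply, h]
    simp only [LinearEquiv.coe_coe, hmode]
    rw [← VertexAlg.tauPlus_apply _ X.isGenModule.isWeak.truncation, hJ.intertwine]
    rfl
  neg y := by
    rw [LinearMap.comp_apply, LinearEquiv.coe_coe, hneg, hJ.neg]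
    rfl
  zero y := by
    rw [LinearMap.comp_apply, LinearEquiv.coe_coe, hzero, hJ.zero]
    rfl
  one y := by
    rw [LinearMap.comp_apply, LinearEquiv.coe_coe, hone, hJ.one]
    rfl

end IsQMap

/-- An element of a module in `C` that is included in the dual space belongs to the product. -/
lemma WlamInObject.mem_hboxtr {C : Set (GenMod.{u} 𝒱)} (hC : ClosedUnderContragredients C)
    {l : TDual W₁ W₂} (h : WlamInObject z W₁ W₂ C l) : l ∈ hboxtr z W₁ W₂ C := by
  obtain ⟨U, hU, ⟨X, hX, e, hmode, hneg, hzero, hone, hgr⟩, hJ, hle⟩ := h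
  -- A contragredient W of X lies in C, and X is itself a contragredient of W, so X plays the role
  -- of W'.
  obtain ⟨W, hW, hWX⟩ := hC X hX
  refine ⟨W, hW, X, hWX.symm, _, hJ.comp_iso e hmode hneg hzero hone hgr,
    e.symm ⟨l, hle (mem_Wlam l)⟩, ?_⟩
  exact congrArg U.subtype (e.apply_symm_apply ⟨l, hle (mem_Wlam l)⟩)

end

end HLZ

/-! ### The theorem -/

theorem mainTheorem9 {Γ : Type v} [AddCommGroup Γ] {A : AddSubgroup Γ}
    {V : Type w} [AddCommGroup V] [Module ℂ V] (𝒱 : VertexAlg A V)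
    (z : ℂ) (hz : z ≠ 0) (W₁ W₂ : GenMod.{u} 𝒱) :
    -- the weak modules
    FormsWeakModule z W₁ W₂ (COMP z W₁ W₂) ∧
    FormsWeakModule z W₁ W₂ (COMP z W₁ W₂ ∩ LGRgen z W₁ W₂) ∧
    FormsWeakModule z W₁ W₂ (COMP z W₁ W₂ ∩ LGRss z W₁ W₂) ∧
    -- the modules generated by single elements
    (∀ l ∈ COMP z W₁ W₂ ∩ LGRgen z W₁ W₂, FormsGenModule z W₁ W₂ (Wlam z W₁ W₂ l)) ∧
    (∀ l ∈ COMP z W₁ W₂ ∩ LGRss z W₁ W₂,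
      ∃ h : FormsGenModule z W₁ W₂ (Wlam z W₁ W₂ l), h.toGenMod.act.IsOrdinary) ∧
    -- the hypotheses of the last part hold for `𝒢ℳ_sg` and for `ℳ_sg`, respectively
    (∀ l ∈ COMP z W₁ W₂ ∩ LGRgen z W₁ W₂, WlamInObject z W₁ W₂ Set.univ l) ∧
    (∀ l ∈ COMP z W₁ W₂ ∩ LGRss z W₁ W₂, WlamInObject z W₁ W₂ (ordinaryModules 𝒱) l) ∧
    -- the two descriptions of `W₁ ⊠-backslash_{Q(z)} W₂`
    ∀ C : Set (GenMod.{u} 𝒱), ClosedUnderContragredients C → W₁ ∈ C → W₂ ∈ C →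
      ((∀ l ∈ COMP z W₁ W₂ ∩ LGRgen z W₁ W₂, WlamInObject z W₁ W₂ C l) →
        hboxtr z W₁ W₂ C = COMP z W₁ W₂ ∩ LGRgen z W₁ W₂) ∧
      (C ⊆ ordinaryModules 𝒱 →
        (∀ l ∈ COMP z W₁ W₂ ∩ LGRss z W₁ W₂, WlamInObject z W₁ W₂ C l) →
        hboxtr z W₁ W₂ C = COMP z W₁ W₂ ∩ LGRss z W₁ W₂) := by
  refine ⟨formsWeakModule_COMP hz, formsWeakModule_LGRgen hz, formsWeakModule_LGRss hz,
    fun l hl => formsGenModule_Wlam hz hl, fun l hl => isOrdinary_Wlam hz hl,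
    fun l hl => wlamInObject hz hl (Set.mem_univ _), fun l hl => ?_, fun C hC _ _ => ⟨?_, ?_⟩⟩
  · obtain ⟨h, ho⟩ := isOrdinary_Wlam hz hl
    exact wlamInObject hz ⟨hl.1, ((mem_LGRss_iff hz).1 hl.2).2⟩ ho
  · intro h
    refine Set.Subset.antisymm ?_ fun l hl => (h l hl).mem_hboxtr hC
    rintro _ ⟨W, hW, X, hX, J, hJ, x, rfl⟩
    exact hJ.mem_COMP_inter_LGRgen hz x
  · intro ho h
    refine Set.Subset.antisymm ?_ fun l hl => (h l hl).mem_hboxtr hC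
    rintro _ ⟨W, hW, X, hX, J, hJ, x, rfl⟩
    exact hJ.mem_COMP_inter_LGRss hz (hX.maxGenEigenspace_eq (ho hW)) x
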